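/- All diagrams are link diagrams on the oriented sphere $S^2$, up to orientation-preserving homeomorphism. A connected alternating diagram $D$ carries a canonical chessboard coloring of its regions, in which the black corners at every crossing are those swept out when the over-strand is turned counterclockwise until it meets the under-strand; it is called a chessboard-colored alternating diagram. Its black Tait graph $G(D)$ has one vertex for each black region and one edge through each crossing, joining the black regions at that crossing. Let $\Lambda(D)=\mathrm{Flow}(G(D))\subset\mathbb Z^{E(G(D))}$ be the lattice of integer flows on $G(D)$, with the dot product. A lattice is a *2-cube tiling lattice* if it admits a lattice embedding into some $\mathbb Z^n$ whose image meets each unit cube $x+\{0,1\}^n$, $x\in\mathbb Z^n$, in exactly one point. Let $\bigcirc$ be the crossingless diagram of one circle, and let $D_\times$ be the one-crossing diagram whose black Tait graph is a single edge with two distinct endpoints. A *composition* of two connected chessboard-colored alternating diagrams $D_1,D_2$, each having at least one crossing, is obtained as follows: remove a crossing ball from each of $D_1$ and $D_2$; glue the two complementary disks along their boundary circles, matching the four ends of the two tangles; and add the common boundary circle to the diagram as a new component, with four new crossings where it meets the strands. The matching of the ends (for given crossings there are two possible ones) and the new crossings are chosen such that the result is alternating and its coloring agrees with those of $D_1$ and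 $D_2$. Let $\mathcal D$ be the smallest set of connected chessboard-colored alternating diagrams that contains $\bigcirc$ and $D_\times$ and contains every composition of any two of its members with at least one crossing each. Connected sums of diagrams are formed compatibly with the colorings, and a connected sum has one or more summands. A diagram is *prime* if it is not a connected sum of two diagrams that both have crossings (so $\bigcirc$ and one-crossing diagrams are prime). It is *reduced* if it has no nugatory crossing, that is, no crossing at which two opposite corners belong to the same region. Let $D$ be a connected chessboard-colored alternating diagram. Then: 1. $\Lambda(D)$ is a 2-cube tiling lattice if and only if $D$ is a connected sum of diagrams in $\mathcal D$. 2. If $\Lambda(D)$ is a 2-cube tiling lattice, then $D$ is prime if and only if $D\in\mathcal D$, and $D$ is reduced if and only if $D$ is a connected sum of diagrams in $\mathcal D\setminus\{D_\times\}$. 3. If $D$ is a composition of connected chessboard-colored alternating diagrams $D_1$ and $D_2$, then $D\in\mathcal D$ if and only if $D_1\in\mathcal D$ and $D_2\in\mathcal D$. -/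

import Mathlib

/-! ## Lattices -/

/-- A lattice `(L, q)` is a *2-cube tiling lattice* if it admits a lattice embedding into some
`ℤⁿ` (with the dot product) whose image has exactly one point in each unit cube
`x + {0,1}ⁿ`, `x ∈ ℤⁿ`. -/
def IsTwoCubeTilingLattice {L : Type*} [AddCommGroup L] (q : L → L → ℤ) : Prop :=
  ∃ (n : ℕ) (φ : L →+ (Fin n → ℤ)), Function.Injective φ ∧
    (∀ a b : L, φ a ⬝ᵥ φ b = q a b) ∧
    ∀ x : Fin n → ℤ, ∃! y : Fin n → ℤ, y ∈ Set.range φ ∧ ∀ i, y i = x i ∨ y i = x i + 1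

open Classical in
/-- The group of integer flows on the finite (multi)graph with vertex set `V` and edge set `E`
whose edge `e` is directed from `tail e` to `head e`: the kernel of the boundary map
`ℤ^E → ℤ^V`. As a lattice it carries the dot product of `ℤ^E`. -/
def FlowLattice {V E : Type*} [Fintype E] (tail head : E → V) : AddSubgroup (E → ℤ) where
  carrier := {f | ∀ v : V, (∑ e with head e = v, f e) - ∑ e with tail e = v, f e = 0}
  zero_mem' := by intro v; simp
  add_mem' := by
    intro a b ha hb v
    have h1 := ha v
    have h2 := hb v
    simp only [Pi.add_apply, Finset.sum_add_distrib]
    linarith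
  neg_mem' := by
    intro a ha v
    have h1 := ha v
    simp only [Pi.neg_apply, Finset.sum_neg_distrib]
    linarith

/-! ## Link diagrams on the sphere -/

/-- A planar diagram code. At every crossing `x` the four half-edges are
`(x,0), (x,1), (x,2), (x,3)` in counterclockwise order, the strand `(x,0), (x,2)` passes under
and the strand `(x,1), (x,3)` passes over. The half-edge at the other end of the edge
starting with the half-edge `h` is `opp h`. -/
structure DiagramCode where
  Crossing : Type
  [fintype : Fintype Crossing]
  [decEq : DecidableEq Crossing]
  opp : Crossing × ZMod 4 → Crossing × ZMod 4

attribute [instance] DiagramCode.fintype DiagramCode.decEq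

/-- The labels of the half-edges that belong to the over-strand of a crossing. -/
def IsOver (i : ZMod 4) : Prop := i = 1 ∨ i = 3

instance : DecidablePred IsOver := fun i => inferInstanceAs (Decidable (i = 1 ∨ i = 3))

namespace DiagramCode

/-- Half-edges. The pair `(x, i)` also stands for the corner at the crossing `x` between the
half-edges `(x, i)` and `(x, i + 1)`. -/
abbrev HalfEdge (C : DiagramCode) : Type := C.Crossing × ZMod 4

/-- Leave the crossing of the corner `h` along the half-edge `h`, keeping the corner on the left.
At the other end of the edge, the next corner of the same region lies clockwise of the half-edge
`opp h`. -/
def nextCorner (C : DiagramCode) (h : C.HalfEdge) : C.HalfEdge :=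
  ((C.opp h).1, (C.opp h).2 - 1)

/-- The regions of a diagram with at least one crossing: the orbits of corners under
`nextCorner`. -/
def Region (C : DiagramCode) : Type := Quot fun h k : C.HalfEdge => k = C.nextCorner h

/-- The region at the corner of the crossing `x` between `(x, i)` and `(x, i + 1)`. -/
def region (C : DiagramCode) (x : C.Crossing) (i : ZMod 4) : C.Region := Quot.mk _ (x, i)

/-- An edge of the diagram joins the two crossings. -/
def Adj (C : DiagramCode) (x y : C.Crossing) : Prop :=
  ∃ i j : ZMod 4, C.opp (x, i) = (y, j)

/-- Equality of diagrams up to orientation-preserving homeomorphism of the sphere: a bijection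
of crossings that, at every crossing, preserves the cyclic order of the half-edges and the
under-strand, and that respects the edges. -/
def Iso (C C' : DiagramCode) : Prop :=
  ∃ (f : C.Crossing ≃ C'.Crossing) (r : C.Crossing → ZMod 4), (∀ x, r x = 0 ∨ r x = 2) ∧
    ∀ x i, C'.opp (f x, i + r x) =
      (f (C.opp (x, i)).1, (C.opp (x, i)).2 + r (C.opp (x, i)).1)

/-- The connected sum of two diagrams along the edges of `h₁` and `h₂`: both edges are cut open
and `h₁` is joined to the other end of the edge of `h₂` and vice versa. -/
def splice (C₁ C₂ : DiagramCode) (h₁ : C₁.HalfEdge) (h₂ : C₂.HalfEdge) : DiagramCode where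
  Crossing := C₁.Crossing ⊕ C₂.Crossing
  opp := fun p =>
    let inl' : C₁.HalfEdge → (C₁.Crossing ⊕ C₂.Crossing) × ZMod 4 := fun h => (.inl h.1, h.2)
    let inr' : C₂.HalfEdge → (C₁.Crossing ⊕ C₂.Crossing) × ZMod 4 := fun h => (.inr h.1, h.2)
    match p with
    | (.inl x, i) =>
      if (x, i) = h₁ then inr' (C₂.opp h₂)
      else if (x, i) = C₁.opp h₁ then inr' h₂
      else inl' (C₁.opp (x, i))
    | (.inr x, i) =>
      if (x, i) = h₂ then inl' (C₁.opp h₁)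
      else if (x, i) = C₂.opp h₂ then inl' h₁
      else inr' (C₂.opp (x, i))

/-- The crossings of a composition of `C₁` and `C₂` at the crossings `c₁` and `c₂`: the remaining
crossings of `C₁` and of `C₂`, and four crossings, numbered counterclockwise, on the new circle. -/
abbrev ComposeCrossing (C₁ C₂ : DiagramCode) (c₁ : C₁.Crossing) (c₂ : C₂.Crossing) : Type :=
  {x : C₁.Crossing // x ≠ c₁} ⊕ ({x : C₂.Crossing // x ≠ c₂} ⊕ ZMod 4)

/-- Half-edges of `C₁` in the composition. The strand of the composition that leaves the tangle
`C₁ ∖ c₁` at its end number `p` meets the new circle in the new crossing number `p`, and it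
arrives there through the half-edge number `p` of this crossing. -/
def composeLeft (C₁ C₂ : DiagramCode) (c₁ : C₁.Crossing) (c₂ : C₂.Crossing)
    (h : C₁.HalfEdge) : ComposeCrossing C₁ C₂ c₁ c₂ × ZMod 4 :=
  if hx : h.1 = c₁ then (.inr (.inr h.2), h.2) else (.inl ⟨h.1, hx⟩, h.2)

/-- Half-edges of `C₂` in the composition. The end number `q` of the tangle `C₂ ∖ c₂` is joined to
the new crossing number `s - q` from the other side of the new circle. (The complement of the ball
at `c₂` is turned inside out, so the order of the ends is reversed.) -/
def composeRight (C₁ C₂ : DiagramCode) (c₁ : C₁.Crossing) (c₂ : C₂.Crossing) (s : ZMod 4)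
    (h : C₂.HalfEdge) : ComposeCrossing C₁ C₂ c₁ c₂ × ZMod 4 :=
  if hx : h.1 = c₂ then (.inr (.inr (s - h.2)), s - h.2 + 2) else (.inr (.inl ⟨h.1, hx⟩), h.2)

/-- The composition of two diagrams. Remove the crossings `c₁` and `c₂`, put the two
resulting tangles on the two sides of a circle so that the end `p` of the first tangle meets the end
`s - p` of the second one, and add the circle to the diagram as a new component, with four
new crossings. At the new crossing number `p`, the half-edge `p` points to the first tangle,
`p + 1` to the next new crossing along the circle, `p + 2` to the second tangle, and `p + 3` to the
previous new crossing. -/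
def compose (C₁ C₂ : DiagramCode) (c₁ : C₁.Crossing) (c₂ : C₂.Crossing) (s : ZMod 4) :
    DiagramCode where
  Crossing := ComposeCrossing C₁ C₂ c₁ c₂
  opp := fun h =>
    match h with
    | (.inl x, i) => composeLeft C₁ C₂ c₁ c₂ (C₁.opp (x.1, i))
    | (.inr (.inl x), i) => composeRight C₁ C₂ c₁ c₂ s (C₂.opp (x.1, i))
    | (.inr (.inr p), i) =>
      if i = p then composeLeft C₁ C₂ c₁ c₂ (C₁.opp (c₁, p))
      else if i = p + 1 then (.inr (.inr (p + 1)), p)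
      else if i = p + 2 then composeRight C₁ C₂ c₁ c₂ s (C₂.opp (c₂, s - p))
      else (.inr (.inr (p - 1)), p)

end DiagramCode

/-- A connected link diagram on the oriented sphere, up to homeomorphism. The code without
crossings stands for the crossingless diagram of one circle. The last condition is
Euler's formula: a connected 4-valent map with `c` crossings has `2 c` edges, so it is drawn on the
sphere if and only if it has `c + 2` regions. -/
structure LinkDiagram extends DiagramCode where
  opp_opp : ∀ h, opp (opp h) = h
  opp_ne : ∀ h, opp h ≠ h
  connected : ∀ x y : Crossing, Relation.ReflTransGen toDiagramCode.Adj x y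
  planar : Nonempty Crossing →
    Nat.card toDiagramCode.Region = Fintype.card Crossing + 2

/-- A connected alternating link diagram: over- and undercrossings alternate along every component,
that is, every edge joins an over-strand to an under-strand. It comes with its
chessboard coloring, see `AltDiagram.IsBlack`. -/
structure AltDiagram extends LinkDiagram where
  alternating : ∀ h, IsOver (opp h).2 ↔ ¬ IsOver h.2

namespace AltDiagram

/-- The chessboard coloring of an alternating diagram. At every crossing, the
two black corners are those that the over-strand sweeps out when it is turned counterclockwise
towards the under-strand. -/
def IsBlack (D : AltDiagram) : D.Region → Prop :=
  Quot.lift (fun h => IsOver h.2) (by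
    rintro h k rfl
    have key : ∀ i j : ZMod 4, (IsOver j ↔ ¬ IsOver i) → (IsOver i ↔ IsOver (j - 1)) := by decide
    exact propext (key h.2 (D.opp h).2 (D.alternating h)))

/-- The black regions: the vertices of the black Tait graph. -/
def BlackRegion (D : AltDiagram) : Type := {R : D.Region // D.IsBlack R}

/-- The black Tait graph has one edge through each crossing, joining the two black regions there.
It is directed from `taitTail` to `taitHead`. -/
def taitTail (D : AltDiagram) (x : D.Crossing) : D.BlackRegion :=
  ⟨D.region x 1, Or.inl rfl⟩

/-- The second end of an edge of the black Tait graph. -/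
def taitHead (D : AltDiagram) (x : D.Crossing) : D.BlackRegion :=
  ⟨D.region x 3, Or.inr rfl⟩

/-- The chessboard lattice `Λ(D)`: the integer flows on the black Tait graph. (For the
crossingless diagram the Tait graph has no edges and the lattice is zero.) -/
def chessboardLattice (D : AltDiagram) : AddSubgroup (D.Crossing → ℤ) :=
  FlowLattice D.taitTail D.taitHead

/-- `Λ(D)`, with the dot product, is a 2-cube tiling lattice. -/
def HasTwoCubeTilingLattice (D : AltDiagram) : Prop :=
  IsTwoCubeTilingLattice fun a b : D.chessboardLattice => (a : D.Crossing → ℤ) ⬝ᵥ b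

/-- Equality of diagrams up to orientation-preserving homeomorphism of the sphere. -/
def Iso (D D' : AltDiagram) : Prop := D.toDiagramCode.Iso D'.toDiagramCode

/-- The crossingless diagram of one circle. -/
def round : AltDiagram where
  Crossing := Empty
  opp := fun h => h
  opp_opp := by rintro ⟨⟨⟩, _⟩
  opp_ne := by rintro ⟨⟨⟩, _⟩
  connected := by rintro ⟨⟩
  planar := by rintro ⟨⟨⟩⟩
  alternating := by rintro ⟨⟨⟩, _⟩

/-- The code of a diagram with one crossing, whose black corners lie in different regions. -/
def oneCrossingCode : DiagramCode where
  Crossing := Unit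
  opp := fun h => ((), 3 - h.2)

theorem card_region_oneCrossingCode : Nat.card oneCrossingCode.Region = 3 := by
  have hstep : ∀ h k : Unit × ZMod 4, k = oneCrossingCode.nextCorner h → k.2 = 2 - h.2 := by
    rintro ⟨⟨⟩, i⟩ k rfl
    change 3 - i - 1 = 2 - i
    ring
  let g : ZMod 4 → Fin 3 := fun i => if i = 1 then 1 else if i = 3 then 2 else 0
  have hg : ∀ i : ZMod 4, g i = g (2 - i) := by simp only [g]; decide
  let f : oneCrossingCode.Region → Fin 3 := Quot.lift (fun h => g h.2) (by
    intro h k hk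
    have h1 := hstep h k hk
    change g h.2 = g k.2
    rw [h1]
    exact hg _)
  have h02 : oneCrossingCode.region () 0 = oneCrossingCode.region () 2 := Quot.sound (by rfl)
  have hf : Function.Bijective f := by
    constructor
    · intro a b
      induction a using Quot.ind with | _ a
      induction b using Quot.ind with | _ b
      obtain ⟨⟨⟩, i⟩ := a
      obtain ⟨⟨⟩, j⟩ := b
      intro hij
      change g i = g j at hij
      have key : ∀ i j : ZMod 4, g i = g j →
          i = j ∨ (i = 0 ∧ j = 2) ∨ (i = 2 ∧ j = 0) := by simp only [g]; decide
      rcases key i j hij with rfl | ⟨rfl, rfl⟩ | ⟨rfl, rfl⟩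
      · rfl
      · exact h02
      · exact h02.symm
    · intro c
      have key : ∀ c : Fin 3, ∃ i : ZMod 4, g i = c := by simp only [g]; decide
      obtain ⟨i, hi⟩ := key c
      exact ⟨oneCrossingCode.region () i, hi⟩
  rw [Nat.card_congr (Equiv.ofBijective f hf)]
  simp

/-- The diagram with one crossing whose black Tait graph is a single edge with two ends. -/
def oneCrossing : AltDiagram where
  toDiagramCode := oneCrossingCode
  opp_opp := by
    rintro ⟨⟨⟩, i⟩
    change ((), 3 - (3 - i)) = ((), i)
    simp
  opp_ne := by
    rintro ⟨⟨⟩, i⟩ h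
    have key : ∀ i : ZMod 4, 3 - i ≠ i := by decide
    exact key i (congrArg Prod.snd h)
  connected := by
    rintro ⟨⟩ ⟨⟩
    exact Relation.ReflTransGen.refl
  planar := fun _ => card_region_oneCrossingCode
  alternating := by
    have key : ∀ i : ZMod 4, IsOver (3 - i) ↔ ¬ IsOver i := by decide
    exact fun h => key h.2

/-- `D` is a connected sum of `D₁` and `D₂`: it is obtained by splicing an edge of `D₁` with an edge
of `D₂`, compatibly with the colorings; a connected sum with the crossingless circle changes
nothing. -/
def IsConnectedSum (D D₁ D₂ : AltDiagram) : Prop :=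
  (∃ (h₁ : D₁.HalfEdge) (h₂ : D₂.HalfEdge), IsOver h₁.2 ∧ IsOver h₂.2 ∧
    D.toDiagramCode.Iso (D₁.splice D₂.toDiagramCode h₁ h₂)) ∨
  (D₁.Iso round ∧ D.Iso D₂) ∨ (D₂.Iso round ∧ D.Iso D₁)

/-- `D` is a connected sum of one or more diagrams, all of which belong to `S`. -/
inductive IsConnectedSumOf (S : Set AltDiagram) : AltDiagram → Prop
  | summand (D : AltDiagram) : D ∈ S → IsConnectedSumOf S D
  | sum (D D₁ D₂ : AltDiagram) : IsConnectedSumOf S D₁ → IsConnectedSumOf S D₂ →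
      D.IsConnectedSum D₁ D₂ → IsConnectedSumOf S D

/-- `D` is a composition of `D₁` and `D₂`. For given crossings `c₁` and `c₂`, the two
values of `s` are the two ways of gluing for which the result is again alternating and
coherently colored. -/
def IsComposition (D D₁ D₂ : AltDiagram) : Prop :=
  ∃ (c₁ : D₁.Crossing) (c₂ : D₂.Crossing) (s : ZMod 4), (s = 0 ∨ s = 2) ∧
    D.toDiagramCode.Iso (D₁.compose D₂.toDiagramCode c₁ c₂ s)

/-- The recursively defined family `𝒟` of diagrams. -/
inductive InFamily : AltDiagram → Prop
  | round (D : AltDiagram) : D.Iso round → InFamily D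
  | oneCrossing (D : AltDiagram) : D.Iso oneCrossing → InFamily D
  | composition (D D₁ D₂ : AltDiagram) : InFamily D₁ → InFamily D₂ →
      D.IsComposition D₁ D₂ → InFamily D

/-- The family `𝒟` as a set of diagrams. -/
def family : Set AltDiagram := {D | InFamily D}

/-- A diagram is prime if it is not a connected sum of two diagrams that both have crossings. (The
crossingless circle and the diagrams with one crossing are prime.) -/
def IsPrime (D : AltDiagram) : Prop :=
  ∀ D₁ D₂ : AltDiagram, D.IsConnectedSum D₁ D₂ → D₁.Iso round ∨ D₂.Iso round

/-- A crossing is nugatory if some circle in the sphere meets the diagram in this crossing only,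
passing through two opposite corners; that is, if two opposite corners lie in the same region. -/
def IsNugatory (D : AltDiagram) (x : D.Crossing) : Prop :=
  ∃ i : ZMod 4, D.region x i = D.region x (i + 2)

/-- A diagram is reduced if it has no nugatory crossings. -/
def IsReduced (D : AltDiagram) : Prop := ∀ x : D.Crossing, ¬ D.IsNugatory x

end AltDiagram

/-! ### Irredundant covers by cosets, and Hajós's theorem for cubes of side two -/

open Finset in
theorem Set.exists_irredundant_cover {α ι : Type*} (A : Set α) (C : ι → Set α) (J : Finset ι)
    (h : ∀ a ∈ A, ∃ j ∈ J, a ∈ C j) :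
    ∃ J' ⊆ J, (∀ a ∈ A, ∃ j ∈ J', a ∈ C j) ∧
      ∀ j ∈ J', ∃ a ∈ A, a ∈ C j ∧ ∀ i ∈ J', i ≠ j → a ∉ C i := by
  classical
  induction J using Finset.strongInduction with
  | H J ih =>
    by_cases hirr : ∀ j ∈ J, ∃ a ∈ A, a ∈ C j ∧ ∀ i ∈ J, i ≠ j → a ∉ C i
    · exact ⟨J, subset_rfl, h, hirr⟩
    · push Not at hirr
      obtain ⟨j, hj, hcov⟩ := hirr
      obtain ⟨J', hJ', h1, h2⟩ := ih (J.erase j) (erase_ssubset hj) (by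
        intro a ha
        obtain ⟨i, hi, hai⟩ := h a ha
        by_cases hij : i = j
        · subst hij
          obtain ⟨k, hk, hki, hak⟩ := hcov a ha hai
          exact ⟨k, mem_erase.2 ⟨hki, hk⟩, hak⟩
        · exact ⟨i, mem_erase.2 ⟨hij, hi⟩, hai⟩)
      exact ⟨J', hJ'.trans (erase_subset _ _), h1, h2⟩

/-- In a finite abelian 2-group, a proper subgroup is contained in a subgroup of index two. -/
theorem Subgroup.exists_index_two {K : Type*} [CommGroup K] [Finite K] {n : ℕ}
    (hK : Nat.card K = 2 ^ n) {H M : Subgroup K} (hHM : H < M) :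
    ∃ N : Subgroup K, H ≤ N ∧ N ≤ M ∧ 2 * Nat.card N = Nat.card M := by
  obtain ⟨a, -, ha⟩ := (Nat.dvd_prime_pow Nat.prime_two).1 (hK ▸ M.card_subgroup_dvd_card)
  obtain ⟨b, -, hb⟩ := (Nat.dvd_prime_pow Nat.prime_two).1 (hK ▸ H.card_subgroup_dvd_card)
  have hlt : Nat.card H < Nat.card M := by
    have hss : (H : Set K) ⊂ M := hHM
    exact Set.Finite.card_lt_card (Set.toFinite _) hss
  have hab : b < a := by
    rw [ha, hb] at hlt
    exact (Nat.pow_lt_pow_iff_right (by norm_num)).1 hlt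
  have : Fact (Nat.Prime 2) := ⟨Nat.prime_two⟩
  obtain ⟨N, hN, hHN⟩ := Sylow.exists_subgroup_card_pow_prime_le (G := M) 2 (n := b) (m := a - 1)
    (by rw [ha]; exact pow_dvd_pow 2 (by omega)) (H.subgroupOf M)
    (by rw [← hb]; exact Nat.card_congr (Subgroup.subgroupOfEquivOfLe hHM.le).toEquiv)
    (by omega)
  refine ⟨N.map M.subtype, ?_, ?_, ?_⟩
  · intro x hx
    exact ⟨⟨x, hHM.le hx⟩, hHN (by simpa [Subgroup.mem_subgroupOf] using hx), rfl⟩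
  · rintro _ ⟨x, -, rfl⟩
    exact x.2
  · rw [Subgroup.card_map_of_injective M.subtype_injective, hN, ha, ← pow_succ']
    congr 1
    omega

/-- If a coset of a subgroup `M` of a finite abelian 2-group is irredundantly covered by the cosets
of the subgroups `N j`, `j ∈ J`, then the intersection of these subgroups has index at most
`2 ^ (|J| - 1)` in `M`. -/
theorem Subgroup.two_mul_card_le_of_irredundant_cover {K ι : Type*} [CommGroup K] [Finite K] {n : ℕ}
    (hK : Nat.card K = 2 ^ n) (N : ι → Subgroup K) (c : ι → K) (J : Finset ι) :
    ∀ (M : Subgroup K) (p : K), (∀ m ∈ M, ∃ j ∈ J, p * m / c j ∈ N j) →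
      (∀ j ∈ J, ∃ m ∈ M, p * m / c j ∈ N j ∧ ∀ i ∈ J, i ≠ j → p * m / c i ∉ N i) →
      2 * Nat.card M ≤ 2 ^ J.card * Nat.card (M ⊓ ⨅ j ∈ J, N j : Subgroup K) := by
  classical
  induction J using Finset.strongInductionOn with | _ J ih
  intro M p hcov hirr
  -- The induction hypothesis for a coset that is covered by fewer members, after passing to an
  -- irredundant subcover.
  have hmin : ∀ (W : Subgroup K) (q : K) (I : Finset ι), I ⊂ J →
      (∀ m ∈ W, ∃ j ∈ I, q * m / c j ∈ N j) → ∃ I' ⊆ I, I'.Nonempty ∧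
        2 * Nat.card W ≤ 2 ^ I'.card * Nat.card (W ⊓ ⨅ j ∈ I', N j : Subgroup K) := by
    intro W q I hI hW
    obtain ⟨I', hI', h1, h2⟩ := Set.exists_irredundant_cover (W : Set K)
      (fun j => {m | q * m / c j ∈ N j}) I hW
    obtain ⟨j, hj, -⟩ := h1 1 W.one_mem
    exact ⟨I', hI', ⟨j, hj⟩, ih I' (hI'.trans_ssubset hI) W q h1 h2⟩
  -- A bound for a proper part `I` that is weaker by a factor 2 suffices: enlarging `I` by parts of
  -- its complement gains a factor 2 each time, and the process ends at `J`.
  have hext : ∀ (k : ℕ) (I : Finset ι), (J \ I).card = k → I ⊂ J → I.Nonempty →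
      Nat.card M ≤ 2 ^ I.card * Nat.card (M ⊓ ⨅ j ∈ I, N j : Subgroup K) →
      2 * Nat.card M ≤ 2 ^ J.card * Nat.card (M ⊓ ⨅ j ∈ J, N j : Subgroup K) := by
    intro k
    induction k using Nat.strong_induction_on with | _ k ihk
    intro I hk hIJ hI hle
    obtain ⟨j, hj, hjI⟩ := Finset.exists_of_ssubset hIJ
    obtain ⟨m, hm, -, hpriv⟩ := hirr j hj
    -- Starting from a point private to `j ∉ I`, translation by the intersection of the `N i`, `i ∈
    -- I`, never enters a coset with index in `I`. So this translate is covered by the cosets with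
    -- index in `J \ I`.
    obtain ⟨I2, hI2, hne, h2⟩ := hmin (M ⊓ ⨅ j ∈ I, N j) (p * m) (J \ I)
      (Finset.sdiff_ssubset hIJ.subset hI) (by
        intro w hw
        obtain ⟨hwM, hwI⟩ := Subgroup.mem_inf.1 hw
        obtain ⟨i, hi, hiN⟩ := hcov (m * w) (M.mul_mem hm hwM)
        refine ⟨i, Finset.mem_sdiff.2 ⟨hi, fun hiI => ?_⟩, by rwa [mul_assoc]⟩
        have hw : w ∈ N i := by
          rw [Subgroup.mem_iInf] at hwI
          exact Subgroup.mem_iInf.1 (hwI i) hiI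
        refine hpriv i hi (by rintro rfl; exact hjI hiI) ?_
        have := (N i).mul_mem hiN ((N i).inv_mem hw)
        convert this using 1
        rw [← mul_assoc, div_mul_eq_mul_div, mul_inv_cancel_right])
    have hdisj : Disjoint I I2 :=
      (Finset.disjoint_sdiff).mono_right hI2
    have hinf : (M ⊓ ⨅ j ∈ I, N j) ⊓ ⨅ j ∈ I2, N j = M ⊓ ⨅ j ∈ I ∪ I2, N j := by
      rw [Finset.iInf_union, inf_assoc]
    rw [hinf] at h2
    have hsub : I ∪ I2 ⊆ J := Finset.union_subset hIJ.subset (hI2.trans Finset.sdiff_subset)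
    have hle2 : 2 * Nat.card M ≤
        2 ^ (I ∪ I2).card * Nat.card (M ⊓ ⨅ j ∈ I ∪ I2, N j : Subgroup K) := by
      rw [Finset.card_union_of_disjoint hdisj, pow_add, mul_assoc]
      calc 2 * Nat.card M ≤ 2 * (2 ^ I.card * Nat.card (M ⊓ ⨅ j ∈ I, N j : Subgroup K)) :=
            Nat.mul_le_mul_left _ hle
        _ = 2 ^ I.card * (2 * Nat.card (M ⊓ ⨅ j ∈ I, N j : Subgroup K)) := by ring
        _ ≤ _ := Nat.mul_le_mul_left _ h2
    by_cases hJ : I ∪ I2 = J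
    · rwa [hJ] at hle2
    · refine ihk (J \ (I ∪ I2)).card ?_ (I ∪ I2) rfl
        (Finset.ssubset_iff_subset_ne.2 ⟨hsub, hJ⟩) (hI.mono Finset.subset_union_left) (by omega)
      rw [← hk]
      obtain ⟨i, hi⟩ := hne
      refine Finset.card_lt_card (Finset.ssubset_iff_of_subset
        (Finset.sdiff_subset_sdiff subset_rfl Finset.subset_union_left) |>.2 ⟨i, hI2 hi, ?_⟩)
      simp [hi]
  obtain ⟨j1, hj1, -⟩ := hcov 1 M.one_mem
  by_cases hsing : ∃ j2 ∈ J, j2 ≠ j1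
  · obtain ⟨j2, hj2, hne⟩ := hsing
    obtain ⟨m1, hm1, hm1N, -⟩ := hirr j1 hj1
    obtain ⟨m2, hm2, -, hm2N⟩ := hirr j2 hj2
    have hlt : M ⊓ N j1 < M := by
      refine lt_of_le_of_ne inf_le_left fun heq => hm2N j1 hj1 hne.symm ?_
      have h1 : m1⁻¹ * m2 ∈ N j1 := (heq.symm ▸ M.mul_mem (M.inv_mem hm1) hm2 :
        m1⁻¹ * m2 ∈ M ⊓ N j1).2
      have := (N j1).mul_mem hm1N h1
      convert this using 1
      rw [div_mul_eq_mul_div, mul_assoc, mul_inv_cancel_left]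
    -- Outside an index-two subgroup containing `M ⊓ N j1`, a coset of `N'` misses the `j1`-th
    -- member altogether. The bound for this coset loses only a factor 2, which is what `hext`
    -- allows.
    obtain ⟨N', hN1, hN2, hN3⟩ := Subgroup.exists_index_two hK hlt
    have hssub : N' < M := by
      refine lt_of_le_of_ne hN2 ?_
      rintro rfl
      have : 0 < Nat.card N' := Nat.card_pos
      omega
    obtain ⟨q, hqM, hqN⟩ := SetLike.exists_of_lt hssub
    obtain ⟨I, hI, hIne, hle⟩ := hmin N' (p * m1 * q) (J.erase j1) (Finset.erase_ssubset hj1) (by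
      intro m hm
      obtain ⟨i, hi, hiN⟩ := hcov (m1 * q * m) (M.mul_mem (M.mul_mem hm1 hqM) (hN2 hm))
      refine ⟨i, Finset.mem_erase.2 ⟨?_, hi⟩, by simpa only [mul_assoc] using hiN⟩
      rintro rfl
      have h1 : q * m ∈ N i := by
        have := (N i).mul_mem ((N i).inv_mem hm1N) hiN
        convert this using 1
        rw [inv_div, div_mul_div_comm, mul_comm (c i), mul_div_mul_right_eq_div]
        rw [eq_div_iff_mul_eq']
        ac_rfl
      have h2 : q * m ∈ N' := hN1 ⟨M.mul_mem hqM (hN2 hm), h1⟩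
      exact hqN (by simpa using N'.mul_mem h2 (N'.inv_mem hm)))
    refine hext _ I rfl (hI.trans_ssubset (Finset.erase_ssubset hj1)) hIne ?_
    rw [← hN3]
    refine hle.trans (Nat.mul_le_mul_left _ ?_)
    exact Nat.card_mono (Set.toFinite _) (inf_le_inf_right _ hN2)
  · push Not at hsing
    -- A single coset that covers everything forces `M ≤ N j1`, and the bound is an equality.
    have hJ : J = {j1} := Finset.eq_singleton_iff_unique_mem.2 ⟨hj1, hsing⟩
    have hM : M ≤ N j1 := by
      have key : ∀ m ∈ M, p * m / c j1 ∈ N j1 := by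
        intro m hm
        obtain ⟨j, hj, hjN⟩ := hcov m hm
        rwa [hsing j hj] at hjN
      intro m hm
      have h1 := (N j1).mul_mem ((N j1).inv_mem (key 1 M.one_mem)) (key m hm)
      convert h1 using 1
      rw [mul_one, inv_div, div_mul_div_comm, mul_comm (c j1), mul_div_mul_right_eq_div]
      simp
    rw [hJ]
    simp [inf_eq_left.2 hM]

/-- The annihilator of a set of elements in the character group. -/
def AddChar.annihilator {G : Type*} [AddCommGroup G] (a : G) : Subgroup (AddChar G ℂ) where
  carrier := {χ | χ a = 1}
  one_mem' := rfl
  mul_mem' := by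
    intro χ ψ hχ hψ
    simp only [Set.mem_ofPred_eq] at *
    rw [AddChar.mul_apply, hχ, hψ, one_mul]
  inv_mem' := by
    intro χ hχ
    simp only [Set.mem_ofPred_eq] at *
    rw [AddChar.inv_apply, AddChar.map_neg_eq_inv, hχ, inv_one]

theorem AddChar.mem_annihilator {G : Type*} [AddCommGroup G] {a : G} {χ : AddChar G ℂ} :
    χ ∈ AddChar.annihilator a ↔ χ a = 1 := Iff.rfl

/-- There are at most `|G / H|` characters that are trivial on a subgroup `H`. -/
theorem AddChar.card_le_of_trivial_on {G : Type*} [AddCommGroup G] [Finite G] (H : AddSubgroup G)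
    (A : Set (AddChar G ℂ)) (hA : ∀ χ ∈ A, ∀ h ∈ H, χ h = 1) :
    Nat.card A ≤ Nat.card (G ⧸ H) := by
  have : Fintype (G ⧸ H) := Fintype.ofFinite _
  have hcard : Nat.card (AddChar (G ⧸ H) ℂ) = Nat.card (G ⧸ H) := by
    rw [Nat.card_eq_fintype_card, Nat.card_eq_fintype_card, AddChar.card_eq]
  rw [← hcard]
  let F : A → AddChar (G ⧸ H) ℂ := fun χ =>
    AddChar.toAddMonoidHomEquiv.symm (QuotientAddGroup.lift H χ.1.toAddMonoidHom (by
      intro h hh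
      exact congrArg Additive.ofMul (hA χ.1 χ.2 h hh)))
  refine Nat.card_le_card_of_injective F ?_
  intro χ ψ h
  ext g
  have := DFunLike.congr_fun h (QuotientAddGroup.mk g)
  exact this

/-- **Hajós's theorem** for cubes of side two: if every element of an abelian group is in a unique
way a sum over a subset of the family `x`, then a member of the family has order two. -/
theorem exists_add_self_eq_zero_of_bijective_subset_sum {G : Type*} [AddCommGroup G] {ι : Type*}
    [Fintype ι] [Nonempty ι] (x : ι → G)
    (hx : Function.Bijective fun S : Finset ι => ∑ i ∈ S, x i) : ∃ i, x i + x i = 0 := by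
  classical
  induction hn : Fintype.card ι using Nat.strong_induction_on generalizing G ι with | _ n ih
  have hfin : Finite G := Finite.of_surjective _ hx.2
  have hcG : Nat.card G = 2 ^ n := by
    rw [← Nat.card_congr (Equiv.ofBijective _ hx), Nat.card_eq_fintype_card, Fintype.card_finset, hn]
  have : Fintype G := Fintype.ofFinite G
  -- Since the subset sums run through `G` once, `∏ (1 + χ (x i))` equals `∑ χ g`, which vanishes.
  have hchar : ∀ χ : AddChar G ℂ, χ ≠ 0 → ∃ i, χ (x i) = -1 := by
    intro χ hχ
    have h1 : ∑ g, χ g = 0 := AddChar.sum_eq_zero_iff_ne_zero.2 hχ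
    have h2 : ∏ i, (1 + χ (x i)) = ∑ g, χ g := by
      rw [Finset.prod_one_add, Finset.powerset_univ,
        ← Equiv.sum_comp (Equiv.ofBijective _ hx)]
      refine Finset.sum_congr rfl fun S _ => ?_
      change _ = χ (∑ i ∈ S, x i)
      induction S using Finset.induction_on with
      | empty => simp
      | insert i S hi ihS =>
        rw [Finset.prod_insert hi, Finset.sum_insert hi, AddChar.map_add_eq_mul,
          ihS (Finset.mem_univ _)]
    rw [h1, Finset.prod_eq_zero_iff] at h2
    obtain ⟨i, -, hi⟩ := h2
    exact ⟨i, by linear_combination hi⟩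
  obtain ⟨i1⟩ := ‹Nonempty ι›
  by_contra! hno
  obtain ⟨k, -, hk⟩ := (Nat.dvd_prime_pow Nat.prime_two).1 (hcG ▸ addOrderOf_dvd_natCard (x i1))
  have hk2 : 2 ≤ k := by
    by_contra hlt
    have h1 : addOrderOf (x i1) ∣ 2 := by
      rw [hk]
      exact pow_dvd_pow 2 (n := 1) (by omega)
    have := addOrderOf_dvd_iff_nsmul_eq_zero.1 h1
    rw [two_nsmul] at this
    exact hno i1 this
  -- The element of order two in the cyclic group generated by `x i1`. As `x i1` does not have order
  -- two, it is a proper even multiple of `x i1`.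
  set a : G := 2 ^ (k - 1) • x i1 with ha
  have ha0 : a ≠ 0 := by
    intro h0
    have h1 := addOrderOf_dvd_iff_nsmul_eq_zero.2 h0
    rw [hk] at h1
    have := (Nat.pow_dvd_pow_iff_le_right (by norm_num)).1 h1
    omega
  have haa : a + a = 0 := by
    rw [ha, ← two_nsmul, ← mul_nsmul', ← pow_succ', Nat.sub_add_cancel (by omega), ← hk]
    exact addOrderOf_nsmul_eq_zero _
  have hχa : ∀ χ : AddChar G ℂ, χ a = 1 ∨ χ a = -1 := by
    intro χ
    have : χ a * χ a = 1 := by rw [← AddChar.map_add_eq_mul, haa, AddChar.map_zero_eq_one]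
    exact mul_self_eq_one_iff.1 this
  obtain ⟨χ0, hχ0'⟩ := AddChar.exists_apply_ne_zero.2 ha0
  have hχ0 := (hχa χ0).resolve_left hχ0'
  -- If `χ (x i1) = -1` then `χ a = 1`, so the index `i1` does not contribute to the covering of
  -- this coset of characters.
  have hcov : ∀ χ : AddChar G ℂ, χ a = -1 → ∃ j ∈ Finset.univ.erase i1, χ (x j) = -1 := by
    intro χ hχ
    obtain ⟨j, hj⟩ := hchar χ (by
      rintro rfl
      rw [AddChar.zero_apply] at hχ
      norm_num at hχ)
    refine ⟨j, Finset.mem_erase.2 ⟨?_, Finset.mem_univ _⟩, hj⟩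
    rintro rfl
    rw [ha, AddChar.map_nsmul_eq_pow, hj, Even.neg_one_pow] at hχ
    · norm_num at hχ
    · exact (Nat.even_pow.2 ⟨even_two, by omega⟩)
  obtain ⟨J, hJ, hJcov, hJirr⟩ := Set.exists_irredundant_cover {χ : AddChar G ℂ | χ a = -1}
    (fun j => {χ : AddChar G ℂ | χ (x j) = -1}) _ hcov
  have hJne : J.Nonempty := by
    obtain ⟨j, hj, -⟩ := hJcov χ0 hχ0
    exact ⟨j, hj⟩
  have hcK : Nat.card (AddChar G ℂ) = 2 ^ n := by
    rw [← hcG, Nat.card_eq_fintype_card, Nat.card_eq_fintype_card, AddChar.card_eq]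
  have hc : ∀ j ∈ J, ∃ c : AddChar G ℂ, c (x j) = -1 := by
    intro j hj
    obtain ⟨χ, -, h, -⟩ := hJirr j hj
    exact ⟨χ, h⟩
  choose! c hc using hc
  have hiff : ∀ j ∈ J, ∀ χ : AddChar G ℂ,
      χ / c j ∈ AddChar.annihilator (x j) ↔ χ (x j) = -1 := by
    intro j hj χ
    rw [AddChar.mem_annihilator, AddChar.div_apply', hc j hj, div_eq_iff (by norm_num)]
    norm_num
  have hcover := Subgroup.two_mul_card_le_of_irredundant_cover hcK
    (fun j => AddChar.annihilator (x j)) c J (AddChar.annihilator a) χ0 (by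
      intro m hm
      obtain ⟨j, hj, h⟩ := hJcov (χ0 * m) (by
        change _ = _
        rw [AddChar.mul_apply, hχ0, AddChar.mem_annihilator.1 hm, mul_one])
      exact ⟨j, hj, (hiff j hj _).2 h⟩) (by
      intro j hj
      obtain ⟨χ, hχ, h1, h2⟩ := hJirr j hj
      have hχ' : χ0 * (χ0⁻¹ * χ) = χ := by rw [mul_inv_cancel_left]
      refine ⟨χ0⁻¹ * χ, ?_, ?_, ?_⟩
      · rw [AddChar.mem_annihilator, AddChar.mul_apply, AddChar.inv_apply,
          AddChar.map_neg_eq_inv, hχ0, show χ a = -1 from hχ]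
        norm_num
      · rw [hχ', hiff j hj]
        exact h1
      · intro i hi hij
        rw [hχ', hiff i hi]
        exact h2 i hi hij)
  set H : AddSubgroup G := AddSubgroup.closure (x '' J) with hH
  -- The annihilator of `a` has index at most two, which cancels the factor 2 in the covering bound.
  have hM : Nat.card (AddChar G ℂ) ≤ 2 * Nat.card (AddChar.annihilator a) := by
    have hsub : (Set.univ : Set (AddChar G ℂ)) ⊆
        (AddChar.annihilator a : Set (AddChar G ℂ)) ∪
          (fun χ => χ0 * χ) '' (AddChar.annihilator a : Set (AddChar G ℂ)) := by
      intro χ _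
      rcases hχa χ with h | h
      · exact Or.inl h
      · refine Or.inr ⟨χ0⁻¹ * χ, ?_, mul_inv_cancel_left _ _⟩
        rw [SetLike.mem_coe, AddChar.mem_annihilator, AddChar.mul_apply, AddChar.inv_apply,
          AddChar.map_neg_eq_inv, hχ0, h]
        norm_num
    have h1 := Set.ncard_le_ncard hsub (Set.toFinite _)
    have h2 := Set.ncard_union_le (AddChar.annihilator a : Set (AddChar G ℂ))
          ((fun χ => χ0 * χ) '' (AddChar.annihilator a : Set (AddChar G ℂ)))
    have h3 := Set.ncard_image_le (f := fun χ => χ0 * χ)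
      (Set.toFinite (AddChar.annihilator a : Set (AddChar G ℂ)))
    rw [Set.ncard_univ] at h1
    have h4 : Nat.card (AddChar.annihilator a) =
      (AddChar.annihilator a : Set (AddChar G ℂ)).ncard := rfl
    omega
  have hann : Nat.card (AddChar.annihilator a ⊓ ⨅ j ∈ J, AddChar.annihilator (x j) :
      Subgroup (AddChar G ℂ)) ≤ Nat.card (G ⧸ H) := by
    refine AddChar.card_le_of_trivial_on H
      ((AddChar.annihilator a ⊓ ⨅ j ∈ J, AddChar.annihilator (x j) :
        Subgroup (AddChar G ℂ)) : Set (AddChar G ℂ)) ?_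
    intro χ hχ h hh
    replace hχ := (Subgroup.mem_inf.1 hχ).2
    have hχj : ∀ j ∈ J, χ (x j) = 1 := by
      intro j hj
      rw [Subgroup.mem_iInf] at hχ
      exact Subgroup.mem_iInf.1 (hχ j) hj
    induction hh using AddSubgroup.closure_induction with
    | mem y hy =>
      obtain ⟨j, hj, rfl⟩ := hy
      exact hχj j hj
    | zero => exact AddChar.map_zero_eq_one _
    | add y z _ _ hy hz => rw [AddChar.map_add_eq_mul, hy, hz, one_mul]
    | neg y _ hy => rw [AddChar.map_neg_eq_inv, hy, inv_one]
  -- The characters trivial on the generators of `H` number at most `|G / H|`, so the covering bound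
  -- becomes `|G| ≤ 2 ^ |J| |G / H|`.
  have hHcard : Nat.card H ≤ 2 ^ J.card := by
    have h1 : Nat.card G = Nat.card (G ⧸ H) * Nat.card H := AddSubgroup.card_eq_card_quotient_mul_card_addSubgroup H
    have h2 : 0 < Nat.card (G ⧸ H) := Nat.card_pos
    have h3 : Nat.card (G ⧸ H) * Nat.card H ≤ Nat.card (G ⧸ H) * 2 ^ J.card := by
      rw [← h1, hcG, ← hcK]
      calc _ ≤ _ := hM
        _ ≤ _ := hcover
        _ ≤ 2 ^ J.card * Nat.card (G ⧸ H) := Nat.mul_le_mul_left _ hann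
        _ = _ := mul_comm _ _
    exact Nat.le_of_mul_le_mul_left h3 h2
  have hmemH : ∀ j : J, x j ∈ H := fun j => AddSubgroup.subset_closure ⟨j, j.2, rfl⟩
  have hJn : J.card < n := by
    have := Finset.card_le_card hJ
    rw [Finset.card_erase_of_mem (Finset.mem_univ _), Finset.card_univ, hn] at this
    have : 0 < n := hn ▸ Fintype.card_pos_iff.2 ⟨i1⟩
    omega
  have : Nonempty J := hJne.to_subtype
  -- Subset sums over `J` are distinct, and `H` is too small for more elements. So they run through
  -- `H` exactly once and the theorem applies to the smaller group `H`.
  have hinj : Function.Injective fun S : Finset J => ∑ i ∈ S, (⟨x i, hmemH i⟩ : H) := by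
    intro S T hST
    have h1 := congrArg (fun h : H => (h : G)) hST
    simp only [AddSubgroup.val_finsetSum] at h1
    have h2 : S.map (Function.Embedding.subtype _) = T.map (Function.Embedding.subtype _) :=
      hx.1 (by simpa [Finset.sum_map] using h1)
    exact Finset.map_injective _ h2
  obtain ⟨j, hj⟩ := ih J.card hJn (G := H) (ι := J) (fun j => ⟨x j, hmemH j⟩) (by
    have : Fintype H := Fintype.ofFinite H
    rw [Fintype.bijective_iff_injective_and_card]
    refine ⟨hinj, le_antisymm (Fintype.card_le_of_injective _ hinj) ?_⟩
    rw [← Nat.card_eq_fintype_card, Fintype.card_finset, Fintype.card_coe]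
    exact hHcard) (Fintype.card_coe J)
  exact hno j (congrArg (fun h : H => (h : G)) hj)

/-! ### Cube tilings and their orthogonal summands -/

theorem sum_subtype_of_support {ι M : Type*} [Fintype ι] [AddCommMonoid M] (J : ι → Prop)
    [DecidablePred J] (f : ι → M) (h : ∀ i, ¬ J i → f i = 0) :
    ∑ i : {i // J i}, f i = ∑ i, f i := by
  rw [← Finset.sum_subtype (Finset.univ.filter J) (by simp) f]
  exact Finset.sum_filter_of_ne fun i _ hi => by_contra fun hJ => hi (h i hJ)

/-- The translates of the unit cube `{0,1}^ι` by the elements of `-M` tile the lattice `ℤ^ι`. -/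
def IsCubeTiling {ι : Type*} (M : AddSubgroup (ι → ℤ)) : Prop :=
  ∀ x : ι → ℤ, ∃! y : ι → ℤ, y ∈ M ∧ ∀ i, y i = x i ∨ y i = x i + 1

/-- A subgroup of `ℤ^E` with the dot product is a 2-cube tiling lattice. -/
def IsTilingSubgroup {E : Type*} [Fintype E] (L : AddSubgroup (E → ℤ)) : Prop :=
  IsTwoCubeTilingLattice fun a b : L => (a : E → ℤ) ⬝ᵥ b

theorem eq_zero_of_dotProduct_map_eq {E ι : Type*} [Fintype E] [Fintype ι]
    {L : AddSubgroup (E → ℤ)} {φ : L →+ (ι → ℤ)}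
    (hφ : ∀ a b : L, φ a ⬝ᵥ φ b = (a : E → ℤ) ⬝ᵥ b) {a : L} (ha : φ a = 0) : a = 0 := by
  have h := hφ a a
  rw [ha, zero_dotProduct] at h
  exact Subtype.ext (dotProduct_self_eq_zero.1 h.symm)

/-- Injectivity can be dropped because an isometry of a positive definite form has no kernel, and
the coordinates may be indexed by any finite type. -/
theorem isTilingSubgroup_iff {E : Type*} [Fintype E] {L : AddSubgroup (E → ℤ)} :
    IsTilingSubgroup L ↔ ∃ (ι : Type) (_ : Fintype ι) (φ : L →+ (ι → ℤ)),
      (∀ a b : L, φ a ⬝ᵥ φ b = (a : E → ℤ) ⬝ᵥ b) ∧ IsCubeTiling φ.range := by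
  constructor
  · rintro ⟨n, φ, -, h1, h2⟩
    exact ⟨Fin n, inferInstance, φ, h1, h2⟩
  · rintro ⟨ι, _, φ, h1, h2⟩
    let e := Fintype.equivFin ι
    let ψ : (ι → ℤ) ≃+ (Fin (Fintype.card ι) → ℤ) :=
      { toFun := fun x i => x (e.symm i)
        invFun := fun x i => x (e i)
        left_inv := fun x => by simp
        right_inv := fun x => by simp
        map_add' := fun x y => rfl }
    have hψ : ∀ x y, ψ x ⬝ᵥ ψ y = x ⬝ᵥ y := fun x y =>
      Equiv.sum_comp e.symm fun i => x i * y i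
    refine ⟨Fintype.card ι, ψ.toAddMonoidHom.comp φ, ?_, ?_, ?_⟩
    · intro a b hab
      exact sub_eq_zero.1 (eq_zero_of_dotProduct_map_eq h1 (a := a - b) (by
        rw [map_sub, sub_eq_zero]
        exact ψ.injective hab))
    · intro a b
      exact (hψ _ _).trans (h1 a b)
    · intro x
      obtain ⟨y, ⟨⟨a, rfl⟩, hy⟩, huniq⟩ := h2 (ψ.symm x)
      refine ⟨ψ (φ a), ⟨⟨a, rfl⟩, fun i => ?_⟩, ?_⟩
      · have := hy (e.symm i)
        simpa [ψ] using this
      · rintro _ ⟨⟨b, rfl⟩, hb⟩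
        refine congrArg ψ (huniq (φ b) ⟨⟨b, rfl⟩, fun i => ?_⟩)
        have := hb (e i)
        simpa [ψ] using this

namespace IsCubeTiling

variable {ι : Type*} {M : AddSubgroup (ι → ℤ)}

theorem eq_of_mem (hM : IsCubeTiling M) {y z x : ι → ℤ} (hy : y ∈ M) (hz : z ∈ M)
    (hyx : ∀ i, y i = x i ∨ y i = x i + 1) (hzx : ∀ i, z i = x i ∨ z i = x i + 1) : y = z :=
  (hM x).unique ⟨hy, hyx⟩ ⟨hz, hzx⟩

/-- If all entries of `y` are `-1`, `0` or `1`, then `y` and `0` lie in the common unit cube at `min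
y 0`. -/
theorem eq_zero_of_abs_le (hM : IsCubeTiling M) {y : ι → ℤ} (hy : y ∈ M) (h : ∀ i, |y i| ≤ 1) :
    y = 0 := by
  refine hM.eq_of_mem (x := fun i => min (y i) 0) hy M.zero_mem ?_ ?_
  · intro i
    have := abs_le.1 (h i)
    omega
  · intro i
    have := abs_le.1 (h i)
    simp only [Pi.zero_apply]
    omega

-- Tiling says that the subset sums of the unit vectors represent every class modulo `M` once, so
-- Hajós's theorem applies to the quotient.
open Classical in
theorem exists_single_two_mem [Fintype ι] [Nonempty ι] (hM : IsCubeTiling M) :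
    ∃ i, Pi.single i (2 : ℤ) ∈ M := by
  have hsum : ∀ (S : Finset ι) (i : ι), (∑ j ∈ S, Pi.single j (1 : ℤ) : ι → ℤ) i =
      if i ∈ S then 1 else 0 := by
    intro S i
    rw [Finset.sum_apply]
    simp [Pi.single_apply]
  obtain ⟨i, hi⟩ := exists_add_self_eq_zero_of_bijective_subset_sum
    (G := (ι → ℤ) ⧸ M) (fun i => QuotientAddGroup.mk (Pi.single i 1)) (by
      have hmk : ∀ S : Finset ι, ∑ i ∈ S, (QuotientAddGroup.mk (Pi.single i 1) : (ι → ℤ) ⧸ M) =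
          QuotientAddGroup.mk (∑ i ∈ S, Pi.single i 1) := by
        intro S
        exact (map_sum (QuotientAddGroup.mk' M) _ _).symm
      constructor
      · intro S T hST
        simp only [hmk] at hST
        rw [QuotientAddGroup.eq] at hST
        have := hM.eq_zero_of_abs_le hST (by
          intro i
          rw [Pi.add_apply, Pi.neg_apply, hsum, hsum]
          split_ifs <;> simp)
        ext i
        have h1 := congrFun this i
        rw [Pi.add_apply, Pi.neg_apply, hsum, hsum] at h1
        by_cases h2 : i ∈ S <;> by_cases h3 : i ∈ T <;> simp_all
      · intro g
        induction g using QuotientAddGroup.induction_on with | H x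
        -- For the point `y` of `M` in the cube at `-x`, the vector `x + y` is the indicator of a
        -- subset and represents the class of `x`.
        obtain ⟨y, ⟨hy, hyx⟩, -⟩ := hM (-x)
        refine ⟨Finset.univ.filter fun i => y i = -x i + 1, ?_⟩
        change ∑ i ∈ _, _ = _
        rw [hmk, QuotientAddGroup.eq]
        convert M.neg_mem hy using 1
        ext i
        rw [Pi.add_apply, Pi.neg_apply, hsum]
        have := hyx i
        simp only [Finset.mem_filter, Finset.mem_univ, true_and, Pi.neg_apply] at this ⊢
        split_ifs <;> omega)
  refine ⟨i, ?_⟩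
  rw [← QuotientAddGroup.mk_add, QuotientAddGroup.eq_zero_iff, ← Pi.single_add] at hi
  exact hi

/-- Forgetting a coordinate. -/
def forget (i : ι) : (ι → ℤ) →+ ({j : ι // j ≠ i} → ℤ) where
  toFun x j := x j
  map_zero' := rfl
  map_add' _ _ := rfl

-- Multiples of `2 eᵢ` move the forgotten coordinate to `0` or `1`, so points of the projection lift
-- to points of `M` in a cube with `i`-th corner coordinate `0`.
open Classical in
theorem map_forget (hM : IsCubeTiling M) {i : ι} (hi : Pi.single i (2 : ℤ) ∈ M) :
    IsCubeTiling (M.map (forget i)) := by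
  have hshift : ∀ y ∈ M, ∃ z ∈ M, forget i z = forget i y ∧ (z i = 0 ∨ z i = 1) := by
    intro y hy
    refine ⟨y - (y i / 2) • Pi.single i (2 : ℤ), M.sub_mem hy (M.zsmul_mem hi _), ?_, ?_⟩
    · ext j
      simp [forget, j.2]
    · simp only [Pi.sub_apply, Pi.smul_apply, Pi.single_eq_same, smul_eq_mul]
      omega
  intro x
  obtain ⟨y, ⟨hy, hyx⟩, huniq⟩ := hM fun j => if h : j = i then 0 else x ⟨j, h⟩
  refine ⟨forget i y, ⟨⟨y, hy, rfl⟩, fun j => ?_⟩, ?_⟩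
  · have := hyx j
    simpa [forget, j.2] using this
  · rintro _ ⟨⟨z, hz, rfl⟩, hzx⟩
    obtain ⟨w, hw, hwz, hwi⟩ := hshift z hz
    rw [← hwz, huniq w ⟨hw, fun j => ?_⟩]
    by_cases h : j = i
    · subst h
      simpa using hwi
    · have := hzx ⟨j, h⟩
      rw [← hwz] at this
      simpa [forget, h] using this

theorem four_le_dotProduct_self [Fintype ι] (hM : IsCubeTiling M) {y : ι → ℤ} (hy : y ∈ M)
    (h0 : y ≠ 0) : 4 ≤ y ⬝ᵥ y := by
  by_contra! hlt
  refine h0 (hM.eq_zero_of_abs_le hy fun i => ?_)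
  have h1 : y i * y i ≤ y ⬝ᵥ y :=
    Finset.single_le_sum (f := fun i => y i * y i) (fun j _ => mul_self_nonneg _)
      (Finset.mem_univ i)
  exact abs_le.2 ⟨by nlinarith, by nlinarith⟩

/-- The orthogonal summands of a tiling lattice are supported in disjoint sets of coordinates. -/
theorem exists_support_of_orthogonal (n : ℕ) : ∀ {ι : Type} [Fintype ι] {M M1 M2 : AddSubgroup (ι → ℤ)},
    Fintype.card ι = n → IsCubeTiling M → M1 ≤ M → M2 ≤ M →
    (∀ m ∈ M, ∃ m1 ∈ M1, ∃ m2 ∈ M2, m1 + m2 = m) →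
    (∀ m1 ∈ M1, ∀ m2 ∈ M2, m1 ⬝ᵥ m2 = 0) →
    ∃ J : ι → Prop, (∀ m ∈ M1, ∀ i, ¬ J i → m i = 0) ∧ (∀ m ∈ M2, ∀ i, J i → m i = 0) := by
  classical
  induction n using Nat.strong_induction_on with | _ n ih
  intro ι _ M M1 M2 hn hM h1 h2 hsum horth
  rcases isEmpty_or_nonempty ι with hι | hι
  · exact ⟨fun _ => True, fun _ _ i => isEmptyElim i, fun _ _ i => isEmptyElim i⟩
  obtain ⟨i, hi⟩ := hM.exists_single_two_mem
  -- If `2 eᵢ` lies in one summand, the other vanishes at `i`. Forgetting `i` then keeps the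
  -- summands orthogonal, and induction applies.
  have key : ∀ {N1 N2 : AddSubgroup (ι → ℤ)}, N1 ≤ M → N2 ≤ M →
      (∀ m ∈ M, ∃ m1 ∈ N1, ∃ m2 ∈ N2, m1 + m2 = m) → (∀ m1 ∈ N1, ∀ m2 ∈ N2, m1 ⬝ᵥ m2 = 0) →
      Pi.single i (2 : ℤ) ∈ N1 →
      ∃ J : ι → Prop, (∀ m ∈ N1, ∀ i, ¬ J i → m i = 0) ∧ (∀ m ∈ N2, ∀ i, J i → m i = 0) := by
    intro N1 N2 hN1 hN2 hs ho hi1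
    have hN2i : ∀ m ∈ N2, m i = 0 := by
      intro m hm
      have := ho _ hi1 _ hm
      rw [single_dotProduct] at this
      omega
    obtain ⟨J, hJ1, hJ2⟩ := ih (Fintype.card {j : ι // j ≠ i}) (by
        rw [← hn]
        exact Fintype.card_subtype_lt (x := i) (by simp)) rfl (hM.map_forget hi)
      (M1 := N1.map (forget i)) (M2 := N2.map (forget i))
      (AddSubgroup.map_mono hN1) (AddSubgroup.map_mono hN2) (by
        rintro _ ⟨m, hm, rfl⟩
        obtain ⟨a, ha, b, hb, rfl⟩ := hs m hm
        exact ⟨_, ⟨a, ha, rfl⟩, _, ⟨b, hb, rfl⟩, (map_add _ _ _).symm⟩) (by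
        rintro _ ⟨a, ha, rfl⟩ _ ⟨b, hb, rfl⟩
        rw [← ho a ha b hb]
        refine sum_subtype_of_support (fun j => j ≠ i) (fun j => a j * b j) fun j hj => ?_
        rw [not_not.1 hj, hN2i b hb, mul_zero])
    refine ⟨fun j => ∀ h : j ≠ i, J ⟨j, h⟩, fun m hm j hj => ?_, fun m hm j hj => ?_⟩
    · push Not at hj
      obtain ⟨h, hj⟩ := hj
      exact hJ1 _ ⟨m, hm, rfl⟩ ⟨j, h⟩ hj
    · by_cases h : j = i
      · rw [h]
        exact hN2i m hm
      · exact hJ2 _ ⟨m, hm, rfl⟩ ⟨j, h⟩ (hj h)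
  -- The norms of the components of `2 eᵢ` add up to 4, and nonzero vectors have norm at least 4. So
  -- one component is zero.
  obtain ⟨a, ha, b, hb, hab⟩ := hsum _ hi
  have hnorm : a ⬝ᵥ a + b ⬝ᵥ b = 4 := by
    have h3 : (a + b) ⬝ᵥ (a + b) = 4 := by
      rw [hab, single_dotProduct, Pi.single_eq_same]
      norm_num
    rw [add_dotProduct, dotProduct_add, dotProduct_add, dotProduct_comm b a, horth a ha b hb] at h3
    linarith
  by_cases hb0 : b = 0
  · rw [hb0, add_zero] at hab
    exact key h1 h2 hsum horth (hab ▸ ha)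
  · have ha0 : a = 0 := by
      by_contra ha0
      have := hM.four_le_dotProduct_self (h1 ha) ha0
      have := hM.four_le_dotProduct_self (h2 hb) hb0
      omega
    rw [ha0, zero_add] at hab
    obtain ⟨J, hJ1, hJ2⟩ := key h2 h1 (fun m hm => by
        obtain ⟨x, hx, y, hy, h⟩ := hsum m hm
        exact ⟨y, hy, x, hx, by rw [add_comm, h]⟩)
      (fun x hx y hy => by rw [dotProduct_comm, horth y hy x hx]) (hab ▸ hb)
    exact ⟨fun i => ¬ J i, fun m hm i hi => hJ2 m hm i (not_not.1 hi), fun m hm i hi => hJ1 m hm i hi⟩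

/-- An orthogonal summand of a tiling lattice is a tiling lattice. -/
theorem isTilingSubgroup_of_orthogonal {A E1 E2 ι : Type} [AddCommGroup A] [Fintype E1] [Fintype E2]
    [Fintype ι] {L1 : AddSubgroup (E1 → ℤ)} {L2 : AddSubgroup (E2 → ℤ)} {φ : A →+ (ι → ℤ)}
    (hφ : IsCubeTiling φ.range) (π1 : A →+ L1) (π2 : A →+ L2)
    (hsurj : ∀ f1 f2, ∃ a, π1 a = f1 ∧ π2 a = f2)
    (hform : ∀ a b, φ a ⬝ᵥ φ b = (π1 a : E1 → ℤ) ⬝ᵥ π1 b + (π2 a : E2 → ℤ) ⬝ᵥ π2 b) :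
    IsTilingSubgroup L1 := by
  classical
  obtain ⟨J, hJ1, hJ2⟩ := exists_support_of_orthogonal _ rfl hφ
    (M1 := π2.ker.map φ) (M2 := π1.ker.map φ) (by rintro _ ⟨a, -, rfl⟩; exact ⟨a, rfl⟩)
    (by rintro _ ⟨a, -, rfl⟩; exact ⟨a, rfl⟩) (by
      rintro _ ⟨a, rfl⟩
      obtain ⟨b, hb1, hb2⟩ := hsurj (π1 a) 0
      refine ⟨φ b, ⟨b, hb2, rfl⟩, φ (a - b), ⟨a - b, ?_, rfl⟩, by rw [← map_add, add_sub_cancel]⟩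
      change π1 (a - b) = 0
      rw [map_sub, hb1, sub_self]) (by
      rintro _ ⟨a, ha, rfl⟩ _ ⟨b, hb, rfl⟩
      rw [hform, show π2 a = 0 from ha, show π1 b = 0 from hb]
      simp)
  have hs : ∀ f : L1, ∃ a, π1 a = f ∧ π2 a = 0 := fun f => hsurj f 0
  choose s hs1 hs2 using hs
  have hzero : ∀ a, π1 a = 0 → π2 a = 0 → φ a = 0 := by
    intro a h1 h2
    have := hform a a
    rw [h1, h2] at this
    exact dotProduct_self_eq_zero.1 (by simpa using this)
  have hsJ : ∀ f i, ¬ J i → φ (s f) i = 0 := fun f i hi => hJ1 _ ⟨s f, hs2 f, rfl⟩ i hi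
  have hadd : ∀ f g, φ (s (f + g)) = φ (s f) + φ (s g) := by
    intro f g
    have := hzero (s (f + g) - (s f + s g)) (by simp [hs1]) (by simp [hs2])
    rw [map_sub, map_add, sub_eq_zero] at this
    exact this
  -- The embedding of the summand uses lifts with second component zero, which are supported in `J`.
  let ψ : L1 →+ ({i // J i} → ℤ) := AddMonoidHom.mk' (fun f i => φ (s f) i) (by
    intro f g
    ext i
    rw [hadd]
    rfl)
  refine isTilingSubgroup_iff.2 ⟨{i // J i}, inferInstance, ψ, ?_, ?_⟩
  · intro f g
    have h1 := hform (s f) (s g)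
    rw [hs1, hs1, hs2] at h1
    simp only [ZeroMemClass.coe_zero, zero_dotProduct, add_zero] at h1
    rw [← h1]
    exact sum_subtype_of_support J (fun i => φ (s f) i * φ (s g) i) fun i hi => by
      rw [hsJ f i hi, zero_mul]
  · intro x
    obtain ⟨_, ⟨⟨a, rfl⟩, hax⟩, -⟩ := hφ fun i => if h : J i then x ⟨i, h⟩ else 0
    have hb : ∀ i, J i → φ (a - s (π1 a)) i = 0 := fun i hi =>
      hJ2 _ ⟨a - s (π1 a), by
        change π1 (a - s (π1 a)) = 0
        rw [map_sub, hs1, sub_self], rfl⟩ i hi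
    refine ⟨ψ (π1 a), ⟨⟨_, rfl⟩, fun i => ?_⟩, ?_⟩
    · have h1 := hax i
      have h2 := hb i i.2
      rw [map_sub, Pi.sub_apply, sub_eq_zero] at h2
      rw [h2, dif_pos i.2] at h1
      exact h1
    · rintro _ ⟨⟨f, rfl⟩, hf⟩
      -- This vector has the coordinates of `φ (s f)` in `J` and those of `φ a` elsewhere. It lies
      -- in the same cube as `φ a`, so uniqueness in the full tiling gives uniqueness in the
      -- summand.
      have h3 : φ (s f + (a - s (π1 a))) = φ a := by
        refine hφ.eq_of_mem ⟨_, rfl⟩ ⟨_, rfl⟩ (fun i => ?_) hax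
        rw [map_add, Pi.add_apply]
        by_cases hi : J i
        · rw [hb i hi, add_zero, dif_pos hi]
          exact hf ⟨i, hi⟩
        · have := hax i
          rw [hsJ f i hi, zero_add, map_sub, Pi.sub_apply, hsJ _ i hi, sub_zero]
          exact this
      ext i
      have h4 := congrFun h3 i
      rw [map_add, Pi.add_apply, hb i i.2, add_zero] at h4
      have h5 := hb i i.2
      rw [map_sub, Pi.sub_apply, sub_eq_zero] at h5
      exact h4.trans h5

end IsCubeTiling

/-- A lattice is a tiling lattice if it is an orthogonal sum, up to gluing, of two tiling lattices and
of a family of coordinates. -/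
theorem isTilingSubgroup_of_sum {E E1 E2 κ : Type} [Fintype E] [Fintype E1] [Fintype E2] [Fintype κ]
    {L : AddSubgroup (E → ℤ)} {L1 : AddSubgroup (E1 → ℤ)} {L2 : AddSubgroup (E2 → ℤ)}
    (h1 : IsTilingSubgroup L1) (h2 : IsTilingSubgroup L2)
    (π1 : L →+ L1) (π2 : L →+ L2) (φ : L →+ (κ → ℤ))
    (hsurj : ∀ f1 f2 (x : κ → ℤ), ∃ a, π1 a = f1 ∧ π2 a = f2 ∧ ∀ i, φ a i = x i ∨ φ a i = x i + 1)
    (huniq : ∀ (x : κ → ℤ) a b, π1 a = π1 b → π2 a = π2 b → (∀ i, φ a i = x i ∨ φ a i = x i + 1) →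
      (∀ i, φ b i = x i ∨ φ b i = x i + 1) → φ a = φ b)
    (hform : ∀ a b : L, (a : E → ℤ) ⬝ᵥ b =
      (π1 a : E1 → ℤ) ⬝ᵥ π1 b + (π2 a : E2 → ℤ) ⬝ᵥ π2 b + φ a ⬝ᵥ φ b) :
    IsTilingSubgroup L := by
  obtain ⟨ι1, _, φ1, hf1, ht1⟩ := isTilingSubgroup_iff.1 h1
  obtain ⟨ι2, _, φ2, hf2, ht2⟩ := isTilingSubgroup_iff.1 h2
  have hi1 : Function.Injective φ1 := (injective_iff_map_eq_zero _).2 fun a ha =>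
    eq_zero_of_dotProduct_map_eq hf1 ha
  have hi2 : Function.Injective φ2 := (injective_iff_map_eq_zero _).2 fun a ha =>
    eq_zero_of_dotProduct_map_eq hf2 ha
  let ψ : L →+ (κ ⊕ (ι1 ⊕ ι2) → ℤ) := AddMonoidHom.mk'
    (fun a => Sum.elim (φ a) (Sum.elim (φ1 (π1 a)) (φ2 (π2 a)))) (by
      intro a b
      ext (i | i | i) <;> simp)
  refine isTilingSubgroup_iff.2 ⟨κ ⊕ (ι1 ⊕ ι2), inferInstance, ψ, ?_, ?_⟩
  · intro a b
    change Sum.elim _ _ ⬝ᵥ Sum.elim _ _ = _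
    rw [sumElim_dotProduct_sumElim, sumElim_dotProduct_sumElim, hf1, hf2, hform]
    ring
  · intro x
    obtain ⟨_, ⟨⟨f1, rfl⟩, hx1⟩, hu1⟩ := ht1 fun i => x (.inr (.inl i))
    obtain ⟨_, ⟨⟨f2, rfl⟩, hx2⟩, hu2⟩ := ht2 fun i => x (.inr (.inr i))
    -- The extra coordinates are chosen last, as their admissible values may depend on the two
    -- components.
    obtain ⟨a, ha1, ha2, ha⟩ := hsurj f1 f2 fun i => x (.inl i)
    refine ⟨ψ a, ⟨⟨a, rfl⟩, ?_⟩, ?_⟩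
    · rintro (i | i | i)
      · exact ha i
      · change φ1 (π1 a) i = _ ∨ φ1 (π1 a) i = _
        rw [ha1]
        exact hx1 i
      · change φ2 (π2 a) i = _ ∨ φ2 (π2 a) i = _
        rw [ha2]
        exact hx2 i
    · rintro _ ⟨⟨b, rfl⟩, hb⟩
      have hb1 : φ1 (π1 b) = φ1 f1 := hu1 _ ⟨⟨_, rfl⟩, fun i => hb (.inr (.inl i))⟩
      have hb2 : φ2 (π2 b) = φ2 f2 := hu2 _ ⟨⟨_, rfl⟩, fun i => hb (.inr (.inr i))⟩
      have hb0 := huniq _ b a ((hi1 hb1).trans ha1.symm) ((hi2 hb2).trans ha2.symm)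
        (fun i => hb (.inl i)) ha
      ext (i | i | i)
      · exact congrFun hb0 i
      · exact (congrFun hb1 i).trans (by rw [← ha1]; rfl)
      · exact (congrFun hb2 i).trans (by rw [← ha2]; rfl)

/-! ### Gluing two lattices along a 4-cycle -/

theorem ZMod.sum_univ_four {M : Type*} [AddCommMonoid M] (f : ZMod 4 → M) :
    ∑ i, f i = f 0 + f 1 + f 2 + f 3 := Fin.sum_univ_four f

open Classical in
/-- The extension of a function by a value at the point `a`. -/
noncomputable def extendAt {E : Type*} (a : E) (g : {e // e ≠ a} → ℤ) (X : ℤ) : E → ℤ :=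
  fun e => if h : e = a then X else g ⟨e, h⟩

theorem extendAt_self {E : Type*} (a : E) (g : {e // e ≠ a} → ℤ) (X : ℤ) :
    extendAt a g X a = X := dif_pos rfl

theorem extendAt_coe {E : Type*} (a : E) (g : {e // e ≠ a} → ℤ) (X : ℤ) (e : {e // e ≠ a}) :
    extendAt a g X e = g e := dif_neg e.2

theorem extendAt_eq_self {E : Type*} (a : E) (f : E → ℤ) :
    extendAt a (fun e => f e) (f a) = f := by
  ext e
  by_cases h : e = a
  · rw [h, extendAt_self]
  · exact extendAt_coe a _ _ ⟨e, h⟩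

open Classical in
theorem sum_eq_sum_ne_add {E M : Type*} [Fintype E] [AddCommMonoid M] (a : E) (f : E → M) :
    ∑ e, f e = ∑ e : {e // e ≠ a}, f e + f a := by
  rw [← Finset.sum_erase_add _ _ (Finset.mem_univ a),
    Finset.sum_subtype (p := fun e => e ≠ a) (Finset.univ.erase a) (by simp) f]

/-- The lattice `L` is glued from `L₁` and `L₂`: the coordinates `e₁` and `e₂` are replaced by a
4-cycle. -/
structure Gluing {E E₁ E₂ : Type} (L : AddSubgroup (E → ℤ)) (L₁ : AddSubgroup (E₁ → ℤ))
    (L₂ : AddSubgroup (E₂ → ℤ)) where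
  e₁ : E₁
  e₂ : E₂
  ε : {e // e ≠ e₁} ⊕ ({e // e ≠ e₂} ⊕ ZMod 4) ≃ E
  τ : ZMod 4 → ℤ
  τ_mul_self : ∀ p, τ p * τ p = 1
  σ₁ : ℤ
  σ₁_mul_self : σ₁ * σ₁ = 1
  σ₂ : ℤ
  σ₂_mul_self : σ₂ * σ₂ = 1
  mem_iff : ∀ f : E → ℤ, f ∈ L ↔
    τ 1 * f (ε (.inr (.inr 1))) + τ 3 * f (ε (.inr (.inr 3))) =
      τ 0 * f (ε (.inr (.inr 0))) + τ 2 * f (ε (.inr (.inr 2))) ∧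
    extendAt e₁ (fun e => f (ε (.inl e)))
      (σ₁ * (τ 2 * f (ε (.inr (.inr 2))) - τ 1 * f (ε (.inr (.inr 1))))) ∈ L₁ ∧
    extendAt e₂ (fun e => f (ε (.inr (.inl e))))
      (σ₂ * (τ 1 * f (ε (.inr (.inr 1))) - τ 0 * f (ε (.inr (.inr 0))))) ∈ L₂

theorem eq_single_two_of_norm_four {ι : Type*} [Fintype ι] [DecidableEq ι]
    {w : ι → ℤ} (hn : w ⬝ᵥ w = 4) {i : ι} (hi : ¬ |w i| ≤ 1) :
    w = Pi.single i 2 ∨ w = -Pi.single i 2 := by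
  have h2 : w i * w i + ∑ j ∈ Finset.univ.erase i, w j * w j = 4 := by
    rw [Finset.add_sum_erase _ (fun j => w j * w j) (Finset.mem_univ i)]
    exact hn
  have h3 : 0 ≤ ∑ j ∈ Finset.univ.erase i, w j * w j :=
    Finset.sum_nonneg fun j _ => mul_self_nonneg _
  have h4 : 4 ≤ w i * w i := by
    push Not at hi
    rcases lt_abs.1 hi with h | h <;> nlinarith
  have h5 : ∑ j ∈ Finset.univ.erase i, w j * w j = 0 := by linarith
  rw [Finset.sum_eq_zero_iff_of_nonneg fun j _ => mul_self_nonneg _] at h5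
  have h6 : ∀ j, j ≠ i → w j = 0 := fun j hj =>
    mul_self_eq_zero.1 (h5 j (Finset.mem_erase.2 ⟨hj, Finset.mem_univ j⟩))
  have h7 : w i * w i = 4 := by linarith
  have h8 : w i = 2 ∨ w i = -2 := by
    rcases mul_eq_zero.1 (show (w i - 2) * (w i + 2) = 0 by linarith) with h | h
    · left; linarith
    · right; linarith
  refine h8.imp (fun h => ?_) fun h => ?_ <;>
  · ext j
    by_cases hj : j = i
    · subst hj
      simp [h]
    · simp [hj, h6 j hj]

/-- A vector of norm 4 in the tiling lattice cannot have all entries in `{-1, 0, 1}`, and an entry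
of absolute value at least 2 uses up the whole norm. -/
theorem IsCubeTiling.exists_eq_single_two {ι : Type*} [Fintype ι] [DecidableEq ι]
    {M : AddSubgroup (ι → ℤ)} (hM : IsCubeTiling M) {w : ι → ℤ} (hw : w ∈ M) (hn : w ⬝ᵥ w = 4) :
    ∃ i, w = Pi.single i 2 ∨ w = -Pi.single i 2 := by
  by_contra! h
  have h1 : w = 0 := hM.eq_zero_of_abs_le hw fun i => by
    by_contra hi
    exact (eq_single_two_of_norm_four hn hi).elim (h i).1 (h i).2
  rw [h1, zero_dotProduct] at hn
  norm_num at hn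

namespace Gluing

variable {E E₁ E₂ : Type} {L : AddSubgroup (E → ℤ)}
  {L₁ : AddSubgroup (E₁ → ℤ)} {L₂ : AddSubgroup (E₂ → ℤ)}

/-- The signed coordinates on the 4-cycle. -/
def coord (S : Gluing L L₁ L₂) (f : E → ℤ) (p : ZMod 4) : ℤ := S.τ p * f (S.ε (.inr (.inr p)))

theorem coord_add (S : Gluing L L₁ L₂) (f g : E → ℤ) (p : ZMod 4) : S.coord (f + g) p = S.coord f p + S.coord g p :=
  mul_add _ _ _

/-- The first component of a vector of a glued lattice. -/
noncomputable def fst (S : Gluing L L₁ L₂) : L →+ L₁ := AddMonoidHom.mk'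
  (fun f => ⟨_, ((S.mem_iff f).1 f.2).2.1⟩) (by
    intro f g
    ext e
    simp only [AddSubgroup.coe_add, Pi.add_apply, extendAt]
    split_ifs
    · ring
    · rfl)

/-- The second component of a vector of a glued lattice. -/
noncomputable def snd (S : Gluing L L₁ L₂) : L →+ L₂ := AddMonoidHom.mk'
  (fun f => ⟨_, ((S.mem_iff f).1 f.2).2.2⟩) (by
    intro f g
    ext e
    simp only [AddSubgroup.coe_add, Pi.add_apply, extendAt]
    split_ifs
    · ring
    · rfl)

/-- The product with one half of the 4-cycle. -/
def height (S : Gluing L L₁ L₂) : L →+ (Unit → ℤ) := AddMonoidHom.mk' (fun f _ => S.coord f 0 + S.coord f 2) (by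
  intro f g
  ext
  simp only [AddSubgroup.coe_add, Pi.add_apply, coord_add]
  ring)

theorem coe_fst (S : Gluing L L₁ L₂) (f : L) : (S.fst f : E₁ → ℤ) =
    extendAt S.e₁ (fun e => (f : E → ℤ) (S.ε (.inl e))) (S.σ₁ * (S.coord f 2 - S.coord f 1)) := rfl

theorem coe_snd (S : Gluing L L₁ L₂) (f : L) : (S.snd f : E₂ → ℤ) =
    extendAt S.e₂ (fun e => (f : E → ℤ) (S.ε (.inr (.inl e))))
      (S.σ₂ * (S.coord f 1 - S.coord f 0)) := rfl

/-- A vector of a glued lattice with given components. -/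
theorem exists_of_fst_snd (S : Gluing L L₁ L₂) (f₁ : L₁) (f₂ : L₂) (c : ℤ) :
    ∃ f : L, S.fst f = f₁ ∧ S.snd f = f₂ ∧ S.coord f 0 = c := by
  have hσ₁ : ∀ x, S.σ₁ * (S.σ₁ * x) = x := fun x => by rw [← mul_assoc, S.σ₁_mul_self, one_mul]
  have hσ₂ : ∀ x, S.σ₂ * (S.σ₂ * x) = x := fun x => by rw [← mul_assoc, S.σ₂_mul_self, one_mul]
  have hτ : ∀ p x, S.τ p * (S.τ p * x) = x := fun p x => by
    rw [← mul_assoc, S.τ_mul_self, one_mul]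
  let X := S.σ₁ * (f₁ : E₁ → ℤ) S.e₁
  let Y := S.σ₂ * (f₂ : E₂ → ℤ) S.e₂
  -- The values are forced by `v 1 - v 0 = Y`, `v 2 - v 1 = X` and `v 1 + v 3 = v 0 + v 2`, once `v
  -- 0 = c` is chosen.
  let v : ZMod 4 → ℤ := fun p => if p = 0 then c else if p = 1 then c + Y else
    if p = 2 then c + X + Y else c + X
  have v0 : v 0 = c := rfl
  have v1 : v 1 = c + Y := rfl
  have v2 : v 2 = c + X + Y := rfl
  have v3 : v 3 = c + X := rfl
  let f : E → ℤ := fun e => Sum.elim (fun e : {e // e ≠ S.e₁} => (f₁ : E₁ → ℤ) e)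
    (Sum.elim (fun e : {e // e ≠ S.e₂} => (f₂ : E₂ → ℤ) e) fun p => S.τ p * v p) (S.ε.symm e)
  have hf1 : ∀ e, f (S.ε (.inl e)) = (f₁ : E₁ → ℤ) e := by intro e; simp [f]
  have hf2 : ∀ e, f (S.ε (.inr (.inl e))) = (f₂ : E₂ → ℤ) e := by intro e; simp [f]
  have hf3 : ∀ p, f (S.ε (.inr (.inr p))) = S.τ p * v p := by intro p; simp [f]
  have he1 : extendAt S.e₁ (fun e => f (S.ε (.inl e)))
      (S.σ₁ * (S.τ 2 * f (S.ε (.inr (.inr 2))) - S.τ 1 * f (S.ε (.inr (.inr 1))))) = f₁ := by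
    simp only [hf1, hf3, hτ, v1, v2]
    rw [show c + X + Y - (c + Y) = X by ring, hσ₁, extendAt_eq_self]
  have he2 : extendAt S.e₂ (fun e => f (S.ε (.inr (.inl e))))
      (S.σ₂ * (S.τ 1 * f (S.ε (.inr (.inr 1))) - S.τ 0 * f (S.ε (.inr (.inr 0))))) = f₂ := by
    simp only [hf2, hf3, hτ, v1, v0]
    rw [show c + Y - c = Y by ring, hσ₂, extendAt_eq_self]
  have hmem : f ∈ L := by
    rw [S.mem_iff]
    refine ⟨?_, he1 ▸ f₁.2, he2 ▸ f₂.2⟩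
    simp only [hf3, hτ, v0, v1, v2, v3]
    ring
  exact ⟨⟨f, hmem⟩, Subtype.ext he1, Subtype.ext he2, by
    rw [coord, show ((⟨f, hmem⟩ : L) : E → ℤ) = f from rfl, hf3, hτ, v0]⟩

/-- The two components determine the height only modulo 2, and every value of this parity occurs,
since `S.coord f 0` is free. -/
theorem height_eq (S : Gluing L L₁ L₂) (f : L) : S.height f () =
    2 * S.coord f 0 + S.σ₁ * (S.fst f : E₁ → ℤ) S.e₁ + S.σ₂ * (S.snd f : E₂ → ℤ) S.e₂ := by
  have hσ₁ : ∀ x, S.σ₁ * (S.σ₁ * x) = x := fun x => by rw [← mul_assoc, S.σ₁_mul_self, one_mul]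
  have hσ₂ : ∀ x, S.σ₂ * (S.σ₂ * x) = x := fun x => by rw [← mul_assoc, S.σ₂_mul_self, one_mul]
  have h1 : (S.fst f : E₁ → ℤ) S.e₁ = S.σ₁ * (S.coord f 2 - S.coord f 1) := by
    rw [coe_fst, extendAt_self]
  have h2 : (S.snd f : E₂ → ℤ) S.e₂ = S.σ₂ * (S.coord f 1 - S.coord f 0) := by
    rw [coe_snd, extendAt_self]
  rw [h1, h2, hσ₁, hσ₂]
  change S.coord f 0 + S.coord f 2 = _
  ring

variable [Fintype E] [Fintype E₁] [Fintype E₂]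

/-- If `a₁ + a₃ = a₀ + a₂`, then `a₀² + a₁² + a₂² + a₃² = (a₂ - a₁)² + (a₁ - a₀)² + (a₀ + a₂)²`. The
first two squares are the new coordinates of the components and the third is the height. -/
theorem dotProduct_eq (S : Gluing L L₁ L₂) (f g : L) : (f : E → ℤ) ⬝ᵥ g =
    (S.fst f : E₁ → ℤ) ⬝ᵥ S.fst g + (S.snd f : E₂ → ℤ) ⬝ᵥ S.snd g + S.height f ⬝ᵥ S.height g := by
  classical
  have key : ∀ p, (f : E → ℤ) (S.ε (.inr (.inr p))) * (g : E → ℤ) (S.ε (.inr (.inr p))) =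
      S.coord f p * S.coord g p := by
    intro p
    rw [coord, coord, mul_mul_mul_comm, S.τ_mul_self, one_mul]
  have h1 : (S.fst f : E₁ → ℤ) ⬝ᵥ S.fst g =
      ∑ e, (f : E → ℤ) (S.ε (.inl e)) * (g : E → ℤ) (S.ε (.inl e)) +
      (S.coord f 2 - S.coord f 1) * (S.coord g 2 - S.coord g 1) := by
    simp only [dotProduct, sum_eq_sum_ne_add S.e₁, coe_fst, extendAt_coe, extendAt_self]
    rw [mul_mul_mul_comm S.σ₁, S.σ₁_mul_self, one_mul]
  have h2 : (S.snd f : E₂ → ℤ) ⬝ᵥ S.snd g =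
      ∑ e, (f : E → ℤ) (S.ε (.inr (.inl e))) * (g : E → ℤ) (S.ε (.inr (.inl e))) +
      (S.coord f 1 - S.coord f 0) * (S.coord g 1 - S.coord g 0) := by
    simp only [dotProduct, sum_eq_sum_ne_add S.e₂, coe_snd, extendAt_coe, extendAt_self]
    rw [mul_mul_mul_comm S.σ₂, S.σ₂_mul_self, one_mul]
  have h3 : S.height f ⬝ᵥ S.height g =
      (S.coord f 0 + S.coord f 2) * (S.coord g 0 + S.coord g 2) := by
    simp [dotProduct, height]
  have hf : S.coord f 1 + S.coord f 3 = S.coord f 0 + S.coord f 2 := ((S.mem_iff f).1 f.2).1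
  have hg : S.coord g 1 + S.coord g 3 = S.coord g 0 + S.coord g 2 := ((S.mem_iff g).1 g.2).1
  have hf3 : S.coord f 3 = S.coord f 0 + S.coord f 2 - S.coord f 1 := by linarith
  have hg3 : S.coord g 3 = S.coord g 0 + S.coord g 2 - S.coord g 1 := by linarith
  rw [h1, h2, h3, dotProduct, ← S.ε.sum_comp, Fintype.sum_sum_type, Fintype.sum_sum_type,
    ZMod.sum_univ_four]
  simp only [key, hf3, hg3]
  ring

theorem isTilingSubgroup (S : Gluing L L₁ L₂) (h₁ : IsTilingSubgroup L₁) (h₂ : IsTilingSubgroup L₂) :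
    IsTilingSubgroup L := by
  refine isTilingSubgroup_of_sum h₁ h₂ S.fst S.snd S.height ?_ ?_ S.dotProduct_eq
  · intro f₁ f₂ x
    obtain ⟨f, hf1, hf2, hf3⟩ := S.exists_of_fst_snd f₁ f₂
      -- Rounding so that the height, which has prescribed parity, falls into `{x, x + 1}`. Two
      -- consecutive integers contain exactly one of each parity, which also gives uniqueness.
      ((x () + 1 - S.σ₁ * (f₁ : E₁ → ℤ) S.e₁ - S.σ₂ * (f₂ : E₂ → ℤ) S.e₂) / 2)
    refine ⟨f, hf1, hf2, fun i => ?_⟩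
    have := S.height_eq f
    rw [hf1, hf2, hf3] at this
    change S.height f () = x () ∨ S.height f () = x () + 1
    omega
  · intro x f g h1 h2 hf hg
    ext i
    have h3 := S.height_eq f
    have h4 := S.height_eq g
    rw [h1, h2] at h3
    have h5 := hf ()
    have h6 := hg ()
    change S.height f () = S.height g ()
    omega

/-- The 4-cycle itself has trivial components and height 2, hence norm 4, so it is mapped to some
`±2 eᵢ`. The `i`-th coordinate is then the height up to sign. Forgetting it leaves a tiling by the
orthogonal sum of the components. -/
theorem isTilingSubgroup_fst_snd (S : Gluing L L₁ L₂) (h : IsTilingSubgroup L) :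
    IsTilingSubgroup L₁ ∧ IsTilingSubgroup L₂ := by
  classical
  obtain ⟨ι, _, φ, hφ, ht⟩ := isTilingSubgroup_iff.1 h
  obtain ⟨v, hv1, hv2, hv3⟩ := S.exists_of_fst_snd 0 0 1
  have hv : S.height v () = 2 := by
    rw [S.height_eq, hv1, hv2, hv3]
    simp
  have hvf : ∀ f : L, φ v ⬝ᵥ φ f = 2 * S.height f () := by
    intro f
    rw [hφ, S.dotProduct_eq, hv1, hv2]
    simp [dotProduct, hv]
  obtain ⟨i, hi⟩ := ht.exists_eq_single_two ⟨v, rfl⟩ (by rw [hvf, hv]; norm_num)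
  have hsq : ∀ f g : L, φ f i * φ g i = S.height f ⬝ᵥ S.height g := by
    intro f g
    have hf := hvf f
    have hg := hvf g
    have h1 : S.height f ⬝ᵥ S.height g = S.height f () * S.height g () := by simp [dotProduct]
    rw [h1]
    rcases hi with hi | hi <;>
    · rw [hi] at hf hg
      simp only [neg_dotProduct, single_dotProduct] at hf hg
      first
        | rw [show φ f i = S.height f () by linarith, show φ g i = S.height g () by linarith]
        | rw [show φ f i = - S.height f () by linarith, show φ g i = - S.height g () by linarith]
          ring
  have hi2 : Pi.single i (2 : ℤ) ∈ φ.range := by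
    rcases hi with hi | hi
    · exact ⟨v, hi⟩
    · exact ⟨-v, by rw [map_neg, hi, neg_neg]⟩
  have ht' := ht.map_forget hi2
  rw [← AddMonoidHom.range_comp] at ht'
  have hform : ∀ a b : L, ((IsCubeTiling.forget i).comp φ) a ⬝ᵥ ((IsCubeTiling.forget i).comp φ) b =
      (S.fst a : E₁ → ℤ) ⬝ᵥ S.fst b + (S.snd a : E₂ → ℤ) ⬝ᵥ S.snd b := by
    intro a b
    have h1 := hφ a b
    rw [S.dotProduct_eq, dotProduct, sum_eq_sum_ne_add i, hsq] at h1
    exact add_right_cancel h1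
  have hsurj : ∀ f₁ f₂, ∃ a, S.fst a = f₁ ∧ S.snd a = f₂ := by
    intro f₁ f₂
    obtain ⟨f, h1, h2, -⟩ := S.exists_of_fst_snd f₁ f₂ 0
    exact ⟨f, h1, h2⟩
  refine ⟨IsCubeTiling.isTilingSubgroup_of_orthogonal ht' S.fst S.snd hsurj hform,
    IsCubeTiling.isTilingSubgroup_of_orthogonal ht' S.snd S.fst (fun f₂ f₁ => ?_) fun a b => ?_⟩
  · obtain ⟨a, h1, h2⟩ := hsurj f₁ f₂
    exact ⟨a, h2, h1⟩
  · rw [hform, add_comm]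

end Gluing

namespace IsTilingSubgroup

variable {E : Type} [Fintype E] {L : AddSubgroup (E → ℤ)}

theorem four_le (h : IsTilingSubgroup L) {f : E → ℤ} (hf : f ∈ L) (h0 : f ≠ 0) : 4 ≤ f ⬝ᵥ f := by
  obtain ⟨ι, _, φ, hφ, ht⟩ := isTilingSubgroup_iff.1 h
  have h1 := hφ ⟨f, hf⟩ ⟨f, hf⟩
  have h2 := ht.four_le_dotProduct_self (y := φ ⟨f, hf⟩) ⟨_, rfl⟩ fun h3 =>
    h0 (congrArg Subtype.val (eq_zero_of_dotProduct_map_eq hφ h3))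
  exact h2.trans h1.le

/-- A nonzero tiling lattice contains a vector of norm four that has even products with all vectors
of the lattice. -/
theorem exists_norm_four (h : IsTilingSubgroup L) {g : E → ℤ} (hg : g ∈ L) (h0 : g ≠ 0) :
    ∃ v ∈ L, v ⬝ᵥ v = 4 ∧ ∀ f ∈ L, 2 ∣ v ⬝ᵥ f := by
  classical
  obtain ⟨ι, _, φ, hφ, ht⟩ := isTilingSubgroup_iff.1 h
  have : Nonempty ι := by
    by_contra hι
    rw [not_nonempty_iff] at hι
    exact h0 (congrArg Subtype.val (eq_zero_of_dotProduct_map_eq hφ (a := ⟨g, hg⟩)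
      (funext fun i => isEmptyElim i)))
  obtain ⟨i, v, hv⟩ := ht.exists_single_two_mem
  refine ⟨v, v.2, ?_, fun f hf => ?_⟩
  · rw [← hφ, hv, single_dotProduct, Pi.single_eq_same]
    norm_num
  · have := hφ v ⟨f, hf⟩
    rw [hv, single_dotProduct] at this
    exact ⟨_, this.symm⟩

end IsTilingSubgroup

/-! ### Flow lattices of graphs and 4-cycles that are cuts -/

section Graph

variable {V E : Type} {t h : E → V}

-- Conservation at a vertex is the case of an indicator function. The vertex set may be infinite,
-- but only the ends of edges enter.
open Classical in
theorem mem_flowLattice_iff [Fintype E] {f : E → ℤ} :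
    f ∈ FlowLattice t h ↔ ∀ u : V → ℤ, ∑ e, f e * (u (h e) - u (t e)) = 0 := by
  constructor
  · intro hf u
    let s : Finset V := Finset.univ.image h ∪ Finset.univ.image t
    have key : ∀ g : E → V, (∀ e, g e ∈ s) →
        ∑ e, f e * u (g e) = ∑ v ∈ s, (∑ e with g e = v, f e) * u v := by
      intro g hg
      rw [← Finset.sum_fiberwise_of_maps_to (s := Finset.univ) (t := s) (g := g) fun e _ => hg e]
      refine Finset.sum_congr rfl fun v _ => ?_
      rw [Finset.sum_mul]
      refine Finset.sum_congr rfl fun e he => ?_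
      rw [(Finset.mem_filter.1 he).2]
    have h1 := key h fun e => Finset.mem_union_left _ (Finset.mem_image_of_mem _ (Finset.mem_univ e))
    have h2 := key t fun e => Finset.mem_union_right _ (Finset.mem_image_of_mem _ (Finset.mem_univ e))
    simp only [mul_sub, Finset.sum_sub_distrib]
    rw [h1, h2, ← Finset.sum_sub_distrib]
    refine Finset.sum_eq_zero fun v _ => ?_
    rw [← sub_mul, hf v, zero_mul]
  · intro hf v
    have := hf fun w => if w = v then 1 else 0
    simpa [mul_sub, Finset.sum_filter] using this

/-- A 4-cycle `w 0, w 1, w 2, w 3` in a graph whose edges are the edges of a cut. -/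
structure Square (t h : E → V) where
  side : V → Prop
  w : ZMod 4 → V
  x : ZMod 4 → E
  x_injective : Function.Injective x
  ends : ∀ i, (t (x i) = w i ∧ h (x i) = w (i + 1)) ∨ (t (x i) = w (i + 1) ∧ h (x i) = w i)
  side_w : ∀ i, side (w i) ↔ IsOver i
  w_ne : ∀ i, w i ≠ w (i + 2)
  cut : ∀ e, (side (t e) ↔ side (h e)) ∨ ∃ i, e = x i

theorem isOver_add_one (i : ZMod 4) : IsOver (i + 1) ↔ ¬ IsOver i := by
  revert i; decide

namespace Square

/-- Exchange the two sides of the cut. -/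
def flip (q : Square t h) : Square t h where
  side v := ¬ q.side v
  w i := q.w (i + 1)
  x i := q.x (i + 1)
  x_injective := q.x_injective.comp (add_left_injective 1)
  ends i := q.ends (i + 1)
  side_w i := by rw [q.side_w, isOver_add_one, not_not]
  w_ne i := by rw [add_right_comm]; exact q.w_ne (i + 1)
  cut e := (q.cut e).imp not_congr fun ⟨i, hi⟩ => ⟨i - 1, by rw [hi, sub_add_cancel]⟩

/-- The edges on the even side of the cut. -/
abbrev EvenEdge (q : Square t h) : Type := {e : E // ¬ q.side (t e) ∧ ¬ q.side (h e)}

/-- The graph on the even side of the cut has one new edge from `w 2` to `w 0`. -/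
def tail (q : Square t h) : Option q.EvenEdge → V
  | none => q.w 2
  | some e => t e

/-- The second end of an edge in the graph on the even side of the cut. -/
def head (q : Square t h) : Option q.EvenEdge → V
  | none => q.w 0
  | some e => h e

open Classical in
/-- The orientation of the edges of the 4-cycle. -/
noncomputable def sign (q : Square t h) (i : ZMod 4) : ℤ := if t (q.x i) = q.w i then 1 else -1

theorem sign_mul_self (q : Square t h) (i : ZMod 4) : q.sign i * q.sign i = 1 := by
  rw [sign]
  split_ifs <;> rfl

theorem w_ne_succ (q : Square t h) (i : ZMod 4) : q.w i ≠ q.w (i + 1) := by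
  intro hi
  have h1 := q.side_w (i + 1)
  rw [← hi, q.side_w, isOver_add_one] at h1
  exact iff_not_self h1

theorem mul_sub_ends (q : Square t h) (u : V → ℤ) (i : ZMod 4) (a : ℤ) :
    a * (u (h (q.x i)) - u (t (q.x i))) = q.sign i * a * (u (q.w (i + 1)) - u (q.w i)) := by
  rw [sign]
  rcases q.ends i with ⟨h1, h2⟩ | ⟨h1, h2⟩
  · rw [if_pos h1, h1, h2]
    ring
  · rw [if_neg, h1, h2]
    · ring
    · rw [h1]
      exact (q.w_ne_succ i).symm

theorem not_side_iff (q : Square t h) (i : ZMod 4) :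
    ¬ (q.side (t (q.x i)) ↔ q.side (h (q.x i))) := by
  have h1 := q.side_w (i + 1)
  rw [isOver_add_one, ← q.side_w] at h1
  rcases q.ends i with ⟨h2, h3⟩ | ⟨h2, h3⟩ <;> rw [h2, h3] <;> tauto

/-- The edge of the graph that belongs to an edge of the even graph other than the new one. -/
def ofNeNone (q : Square t h) (e : {e : Option q.EvenEdge // e ≠ none}) : E :=
  (e.1.get (Option.ne_none_iff_isSome.1 e.2)).1

/-- The edges of the graph are the edges of the 4-cycle and those of the two sides. -/
def toEdge (q : Square t h) :
    {e : Option q.EvenEdge // e ≠ none} ⊕ ({e : Option q.flip.EvenEdge // e ≠ none} ⊕ ZMod 4) → E :=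
  Sum.elim q.ofNeNone (Sum.elim q.flip.ofNeNone q.x)

theorem toEdge_bijective (q : Square t h) : Function.Bijective q.toEdge := by
  have h1 : ∀ e, ¬ q.side (t (q.ofNeNone e)) ∧ ¬ q.side (h (q.ofNeNone e)) := fun e =>
    (e.1.get (Option.ne_none_iff_isSome.1 e.2)).2
  have h2 : ∀ e, ¬ ¬ q.side (t (q.flip.ofNeNone e)) ∧ ¬ ¬ q.side (h (q.flip.ofNeNone e)) := fun e =>
    (e.1.get (Option.ne_none_iff_isSome.1 e.2)).2
  have hinj : ∀ q' : Square t h, Function.Injective q'.ofNeNone := by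
    rintro q' ⟨_ | a, ha⟩ ⟨_ | b, hb⟩ hab
    · rfl
    · exact absurd rfl ha
    · exact absurd rfl hb
    · exact Subtype.ext (congrArg some (Subtype.ext hab))
  constructor
  · rintro (a | a | a) (b | b | b) hab
    · exact congrArg _ (hinj q hab)
    · have h3 := h1 a
      rw [show q.ofNeNone a = q.flip.ofNeNone b from hab] at h3
      exact absurd h3.1 (h2 b).1
    · have h3 := h1 a
      rw [show q.ofNeNone a = q.x b from hab] at h3
      exact absurd (iff_of_false h3.1 h3.2) (q.not_side_iff b)
    · have h3 := h2 a
      rw [show q.flip.ofNeNone a = q.ofNeNone b from hab] at h3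
      exact absurd (h1 b).1 h3.1
    · exact congrArg _ (congrArg _ (hinj q.flip hab))
    · have h3 := h2 a
      rw [show q.flip.ofNeNone a = q.x b from hab] at h3
      exact absurd (iff_of_true (not_not.1 h3.1) (not_not.1 h3.2)) (q.not_side_iff b)
    · have h3 := h1 b
      rw [show q.ofNeNone b = q.x a from hab.symm] at h3
      exact absurd (iff_of_false h3.1 h3.2) (q.not_side_iff a)
    · have h3 := h2 b
      rw [show q.flip.ofNeNone b = q.x a from hab.symm] at h3
      exact absurd (iff_of_true (not_not.1 h3.1) (not_not.1 h3.2)) (q.not_side_iff a)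
    · exact congrArg _ (congrArg _ (q.x_injective hab))
  · intro e
    rcases q.cut e with he | ⟨i, rfl⟩
    · by_cases hs : q.side (t e)
      · exact ⟨.inr (.inl ⟨some ⟨e, not_not.2 hs, not_not.2 (he.1 hs)⟩, by simp⟩), rfl⟩
      · exact ⟨.inl ⟨some ⟨e, hs, fun h' => hs (he.2 h')⟩, by simp⟩, rfl⟩
    · exact ⟨.inr (.inr i), rfl⟩

variable [Fintype E]

open Classical in
theorem sum_option_extendAt (q : Square t h) (f : E → ℤ) (X : ℤ) (u : V → ℤ) :
    ∑ e, extendAt none (fun e => f (q.ofNeNone e)) X e * (u (q.head e) - u (q.tail e)) =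
      X * (u (q.w 0) - u (q.w 2)) +
        ∑ e : {e // e ≠ none}, f (q.ofNeNone e) * (u (h (q.ofNeNone e)) - u (t (q.ofNeNone e))) := by
  rw [sum_eq_sum_ne_add none, add_comm, extendAt_self]
  congr 1
  refine Finset.sum_congr (by ext; simp) fun e _ => ?_
  rw [extendAt_coe]
  obtain ⟨_ | e, he⟩ := e
  · exact absurd rfl he
  · rfl

open Classical in
/-- The flow lattice of a graph with a 4-cycle that is a cut is glued from the flow lattices of the
graphs on the two sides of the cut. -/
noncomputable def gluing (q : Square t h) : Gluing (FlowLattice t h) (FlowLattice q.tail q.head)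
    (FlowLattice q.flip.tail q.flip.head) where
  e₁ := none
  e₂ := none
  ε := Equiv.ofBijective q.toEdge q.toEdge_bijective
  τ := q.sign
  τ_mul_self := q.sign_mul_self
  σ₁ := 1
  σ₁_mul_self := rfl
  σ₂ := -1
  σ₂_mul_self := rfl
  mem_iff f := by
    -- Pairing with a potential splits into the even side, the odd side and the 4-cycle.
    have hsum : ∀ u : V → ℤ, ∑ e, f e * (u (h e) - u (t e)) =
        ∑ e : {e // e ≠ none}, f (q.ofNeNone e) * (u (h (q.ofNeNone e)) - u (t (q.ofNeNone e))) +
        (∑ e : {e // e ≠ none}, f (q.flip.ofNeNone e) *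
          (u (h (q.flip.ofNeNone e)) - u (t (q.flip.ofNeNone e))) +
        (q.sign 0 * f (q.x 0) * (u (q.w 1) - u (q.w 0)) +
         q.sign 1 * f (q.x 1) * (u (q.w 2) - u (q.w 1)) +
         q.sign 2 * f (q.x 2) * (u (q.w 3) - u (q.w 2)) +
         q.sign 3 * f (q.x 3) * (u (q.w 0) - u (q.w 3)))) := by
      intro u
      rw [← (Equiv.ofBijective q.toEdge q.toEdge_bijective).sum_comp, Fintype.sum_sum_type,
        Fintype.sum_sum_type, ZMod.sum_univ_four]
      congr 2
      change f (q.x 0) * (u (h (q.x 0)) - u (t (q.x 0))) +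
        f (q.x 1) * (u (h (q.x 1)) - u (t (q.x 1))) + f (q.x 2) * (u (h (q.x 2)) - u (t (q.x 2))) +
        f (q.x 3) * (u (h (q.x 3)) - u (t (q.x 3))) = _
      simp only [q.mul_sub_ends]
      rfl
    have hw0 : ¬ q.side (q.w 0) := by rw [q.side_w]; decide
    have hw1 : q.side (q.w 1) := by rw [q.side_w]; decide
    have hw2 : ¬ q.side (q.w 2) := by rw [q.side_w]; decide
    have hw3 : q.side (q.w 3) := by rw [q.side_w]; decide
    have ho1 : ∀ e, ¬ q.side (t (q.ofNeNone e)) ∧ ¬ q.side (h (q.ofNeNone e)) := fun e =>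
      (e.1.get (Option.ne_none_iff_isSome.1 e.2)).2
    have ho2 : ∀ e, ¬ ¬ q.side (t (q.flip.ofNeNone e)) ∧ ¬ ¬ q.side (h (q.flip.ofNeNone e)) :=
      fun e => (e.1.get (Option.ne_none_iff_isSome.1 e.2)).2
    simp only [not_not] at ho2
    have hf0 : q.flip.w 0 = q.w 1 := rfl
    have hf2 : q.flip.w 2 = q.w 3 := rfl
    have hx : ∀ p, Equiv.ofBijective q.toEdge q.toEdge_bijective (.inr (.inr p)) = q.x p :=
      fun p => rfl
    have hl : ∀ e, Equiv.ofBijective q.toEdge q.toEdge_bijective (.inl e) = q.ofNeNone e :=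
      fun p => rfl
    have hr : ∀ e, Equiv.ofBijective q.toEdge q.toEdge_bijective (.inr (.inl e)) =
      q.flip.ofNeNone e := fun p => rfl
    simp only [hx, hl, hr, mem_flowLattice_iff, sum_option_extendAt, hf0, hf2]
    constructor
    · intro hf
      refine ⟨?_, fun u => ?_, fun u => ?_⟩
      · have h1 := (hsum fun v => if q.side v then 1 else 0).symm.trans (hf fun v => if q.side v then 1 else 0)
        simp only [ho1, ho2, hw0, hw1, hw2, hw3, if_true, if_false, sub_self, mul_zero,
          Finset.sum_const_zero] at h1
        linarith
      · have h1 := (hsum fun v => if q.side v then 0 else u v).symm.trans (hf fun v => if q.side v then 0 else u v)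
        have h2 := (hsum fun v => if q.side v then 1 else 0).symm.trans (hf fun v => if q.side v then 1 else 0)
        simp only [ho1, ho2, hw0, hw1, hw2, hw3, if_true, if_false, sub_self, mul_zero,
          Finset.sum_const_zero] at h1 h2
        linear_combination h1 + u (q.w 0) * h2
      · have h1 := (hsum fun v => if q.side v then u v else 0).symm.trans (hf fun v => if q.side v then u v else 0)
        have h2 := (hsum fun v => if q.side v then 1 else 0).symm.trans (hf fun v => if q.side v then 1 else 0)
        simp only [ho1, ho2, hw0, hw1, hw2, hw3, if_true, if_false, sub_self, mul_zero,
          Finset.sum_const_zero] at h1 h2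
        linear_combination h1 - u (q.w 3) * h2
    · rintro ⟨h1, h2, h3⟩ u
      rw [hsum]
      linear_combination h2 u + h3 u + (u (q.w 0) - u (q.w 3)) * h1

end Square

end Graph

theorem ZMod.forall_four {P : ZMod 4 → Prop} : (∀ i, P i) ↔ P 0 ∧ P 1 ∧ P 2 ∧ P 3 := by
  refine ⟨fun h => ⟨h 0, h 1, h 2, h 3⟩, fun ⟨h0, h1, h2, h3⟩ i => ?_⟩
  match i with
  | 0 => exact h0
  | 1 => exact h1
  | 2 => exact h2
  | 3 => exact h3

theorem ZMod.eq_of_succ {α : Type*} {g : ZMod 4 → α} (h0 : g 0 = g 1) (h1 : g 1 = g 2)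
    (h2 : g 2 = g 3) (i j : ZMod 4) : g i = g j := by
  have h : ∀ i, g i = g 0 :=
    ZMod.forall_four.2 ⟨rfl, h0.symm, (h0.trans h1).symm, (h0.trans (h1.trans h2)).symm⟩
  rw [h i, h j]

section Graph

variable {V E : Type} {t h : E → V}

/-- Here `z` and `o` are the two ends of an edge. The coincidences of ends make `e₀, e₃, e₂, e₁` a
closed walk, and the two inequalities make it a 4-cycle. -/
theorem nonempty_square_of_edges (side : V → Prop) (z o : E → V)
    (hends : ∀ e, (t e = z e ∧ h e = o e) ∨ (t e = o e ∧ h e = z e)) {e₀ e₁ e₂ e₃ : E}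
    (hz01 : z e₁ = z e₀) (hz23 : z e₃ = z e₂) (ho03 : o e₃ = o e₀) (ho12 : o e₂ = o e₁)
    (hz02 : z e₀ ≠ z e₂) (ho01 : o e₀ ≠ o e₁) (sz0 : ¬ side (z e₀)) (sz2 : ¬ side (z e₂))
    (so0 : side (o e₀)) (so1 : side (o e₁))
    (hcut : ∀ e, (side (t e) ↔ side (h e)) ∨ e = e₀ ∨ e = e₁ ∨ e = e₂ ∨ e = e₃) :
    Nonempty (Square t h) := by
  have hne01 : e₀ ≠ e₁ := by rintro rfl; exact ho01 rfl
  have hne02 : e₀ ≠ e₂ := by rintro rfl; exact hz02 rfl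
  have hne13 : e₁ ≠ e₃ := by rintro rfl; exact hz02 (hz01.symm.trans hz23)
  have hne03 : e₀ ≠ e₃ := by rintro rfl; exact hz02 hz23
  have hne21 : e₂ ≠ e₁ := by rintro rfl; exact hz02 hz01.symm
  have hne23 : e₂ ≠ e₃ := by rintro rfl; exact ho01 (ho03.symm.trans ho12)
  refine ⟨{
    side := side
    w := ![z e₀, o e₀, z e₂, o e₁]
    x := ![e₀, e₃, e₂, e₁]
    x_injective := ?_
    ends := ?_
    side_w := ?_
    w_ne := ?_
    cut := ?_ }⟩
  · have : ∀ i j : ZMod 4, (![e₀, e₃, e₂, e₁] : Fin 4 → E) i = (![e₀, e₃, e₂, e₁] : Fin 4 → E) j →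
        i = j := by
      rw [ZMod.forall_four]
      refine ⟨?_, ?_, ?_, ?_⟩ <;> rw [ZMod.forall_four]
      · exact ⟨fun _ => rfl, fun h => absurd h hne03, fun h => absurd h hne02,
          fun h => absurd h hne01⟩
      · exact ⟨fun h => absurd h hne03.symm, fun _ => rfl, fun h => absurd h hne23.symm,
          fun h => absurd h hne13.symm⟩
      · exact ⟨fun h => absurd h hne02.symm, fun h => absurd h hne23, fun _ => rfl,
          fun h => absurd h hne21⟩
      · exact ⟨fun h => absurd h hne01.symm, fun h => absurd h hne13, fun h => absurd h hne21.symm,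
          fun _ => rfl⟩
    exact this
  · rw [ZMod.forall_four]
    change ((t e₀ = z e₀ ∧ h e₀ = o e₀) ∨ (t e₀ = o e₀ ∧ h e₀ = z e₀)) ∧
      ((t e₃ = o e₀ ∧ h e₃ = z e₂) ∨ (t e₃ = z e₂ ∧ h e₃ = o e₀)) ∧
      ((t e₂ = z e₂ ∧ h e₂ = o e₁) ∨ (t e₂ = o e₁ ∧ h e₂ = z e₂)) ∧
      ((t e₁ = o e₁ ∧ h e₁ = z e₀) ∨ (t e₁ = z e₀ ∧ h e₁ = o e₁))
    refine ⟨hends _, ?_, ?_, ?_⟩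
    · rw [← ho03, ← hz23]
      exact (hends _).symm
    · rw [← ho12]
      exact hends _
    · rw [← hz01]
      exact (hends _).symm
  · rw [ZMod.forall_four]
    exact ⟨iff_of_false sz0 (by decide), iff_of_true so0 (by decide),
      iff_of_false sz2 (by decide), iff_of_true so1 (by decide)⟩
  · rw [ZMod.forall_four]
    exact ⟨hz02, ho01, hz02.symm, ho01.symm⟩
  · intro e
    rcases hcut e with h1 | h1 | h1 | h1 | h1
    · exact .inl h1
    · exact .inr ⟨0, h1⟩
    · exact .inr ⟨3, h1⟩
    · exact .inr ⟨2, h1⟩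
    · exact .inr ⟨1, h1⟩

variable [Fintype E]

/-- A function with even differences to the values of a linear form on chains. -/
theorem exists_side {v : E → ℤ} (heven : ∀ f ∈ FlowLattice t h, 2 ∣ v ⬝ᵥ f) :
    ∃ side : V → Prop, ∀ e, Odd (v e) ↔ ¬ (side (t e) ↔ side (h e)) := by
  classical
  let IsChain (z : E → ℤ) (r r' : V) : Prop :=
    ∀ u : V → ℤ, ∑ e, z e * (u (h e) - u (t e)) = u r' - u r
  let S : Setoid V := {
    r := fun r r' => ∃ z, IsChain z r r'
    iseqv := by
      refine ⟨fun r => ⟨0, fun u => by simp⟩, ?_, ?_⟩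
      · rintro r r' ⟨z, hz⟩
        refine ⟨-z, fun u => ?_⟩
        simp only [Pi.neg_apply, neg_mul, Finset.sum_neg_distrib, hz u]
        ring
      · rintro r r' r'' ⟨z, hz⟩ ⟨z', hz'⟩
        refine ⟨z + z', fun u => ?_⟩
        simp only [Pi.add_apply, add_mul, Finset.sum_add_distrib, hz u, hz' u]
        ring }
  -- Each component of the graph gets a root. The side of a vertex is the parity of the product of
  -- `v` with a chain from the root, well defined because products with closed chains are even.
  have hroot : ∀ a, ∃ z, IsChain z (Quotient.mk S a).out a := fun a => Quotient.mk_out (s := S) a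
  choose z hz using hroot
  refine ⟨fun a => Odd (v ⬝ᵥ z a), fun e => ?_⟩
  have h1 : IsChain (Pi.single e 1) (t e) (h e) := by
    intro u
    simp [Pi.single_apply]
  have h2 : Quotient.mk S (t e) = Quotient.mk S (h e) := Quotient.sound ⟨_, h1⟩
  have h3 : z (t e) + Pi.single e 1 - z (h e) ∈ FlowLattice t h := by
    rw [mem_flowLattice_iff]
    intro u
    have h4 := hz (t e) u
    rw [h2] at h4
    have h5 := hz (h e) u
    have h6 := h1 u
    simp only [Pi.sub_apply, Pi.add_apply, sub_mul, add_mul, Finset.sum_sub_distrib,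
      Finset.sum_add_distrib, h4, h5, h6]
    ring
  have h4 := heven _ h3
  rw [dotProduct_sub, dotProduct_add, dotProduct_single, mul_one] at h4
  grind

/-- Otherwise `v = ±2e` for an edge `e`. The conditions for flows are homogeneous, so `e` would be a
flow of norm 1. -/
theorem abs_le_one_of_norm_four (hT : IsTilingSubgroup (FlowLattice t h)) {v : E → ℤ}
    (hv : v ∈ FlowLattice t h) (hn : v ⬝ᵥ v = 4) (e : E) : |v e| ≤ 1 := by
  classical
  by_contra he
  have h1 : Pi.single e (2 : ℤ) ∈ FlowLattice t h := by
    rcases eq_single_two_of_norm_four hn he with h1 | h1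
    · rwa [← h1]
    · have h2 := neg_mem hv
      rwa [h1, neg_neg] at h2
  have h2 : Pi.single e (1 : ℤ) ∈ FlowLattice t h := by
    rw [mem_flowLattice_iff] at h1 ⊢
    intro u
    have := h1 u
    simp only [Pi.single_apply, ite_mul, zero_mul, Finset.sum_ite_eq', Finset.mem_univ,
      if_true] at this ⊢
    linarith
  have h3 := hT.four_le h2 (by simp)
  rw [single_dotProduct] at h3
  simp at h3

/-- The sum makes the entries `1` and `-1` equally frequent, and the norm makes them four in all. -/
theorem exists_four_of_sum_eq_zero {a : E → ℤ} (ha : ∀ e, a e = 0 ∨ a e = 1 ∨ a e = -1)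
    (h0 : ∑ e, a e = 0) (h4 : ∑ e, a e * a e = 4) : ∃ e₀ e₁ e₂ e₃,
      (∀ e, a e = 1 ↔ e = e₀ ∨ e = e₂) ∧ (∀ e, a e = -1 ↔ e = e₁ ∨ e = e₃) ∧
      ∀ F : E → ℤ, ∑ e, a e * F e = F e₀ + F e₂ - (F e₁ + F e₃) := by
  classical
  have hsum : ∀ F : E → ℤ, ∑ e, a e * F e = ∑ e with a e = 1, F e - ∑ e with a e = -1, F e := by
    intro F
    rw [Finset.sum_filter, Finset.sum_filter, ← Finset.sum_sub_distrib]
    refine Finset.sum_congr rfl fun e _ => ?_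
    rcases ha e with h | h | h <;> simp [h]
  have hc1 : (Finset.univ.filter fun e => a e = 1).card =
      (Finset.univ.filter fun e => a e = -1).card := by
    have := hsum fun _ => 1
    simp only [mul_one, h0, Finset.sum_const, nsmul_eq_mul] at this
    omega
  have hc2 : (Finset.univ.filter fun e => a e = 1).card +
      (Finset.univ.filter fun e => a e = -1).card = 4 := by
    have h2 : ∑ e with a e = 1, a e = ∑ e with a e = 1, 1 :=
      Finset.sum_congr rfl fun e he => (Finset.mem_filter.1 he).2
    have h3 : ∑ e with a e = -1, a e = ∑ e with a e = -1, -1 :=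
      Finset.sum_congr rfl fun e he => (Finset.mem_filter.1 he).2
    rw [hsum, h2, h3] at h4
    simp only [Finset.sum_const, nsmul_eq_mul, mul_one, mul_neg] at h4
    omega
  obtain ⟨e₀, e₂, h02, hp⟩ := Finset.card_eq_two.1
    (show (Finset.univ.filter fun e => a e = 1).card = 2 by omega)
  obtain ⟨e₁, e₃, h13, hm⟩ := Finset.card_eq_two.1
    (show (Finset.univ.filter fun e => a e = -1).card = 2 by omega)
  refine ⟨e₀, e₁, e₂, e₃, fun e => ?_, fun e => ?_, fun F => ?_⟩
  · have := Finset.ext_iff.1 hp e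
    simpa using this
  · have := Finset.ext_iff.1 hm e
    simpa using this
  · rw [hsum, hp, hm, Finset.sum_pair h02, Finset.sum_pair h13]

/-- A tiling flow lattice comes from a graph without parallel edges. -/
theorem not_parallel (hT : IsTilingSubgroup (FlowLattice t h)) {e e' : E} (hne : e ≠ e')
    {s s' : ℤ} (hs : s * s = 1) (hs' : s' * s' = 1)
    (hflow : ∀ u : V → ℤ, s * (u (h e) - u (t e)) + s' * (u (h e') - u (t e')) = 0) : False := by
  classical
  have hmem : Pi.single e s + Pi.single e' s' ∈ FlowLattice t h := by
    rw [mem_flowLattice_iff]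
    intro u
    simp only [Pi.add_apply, Pi.single_apply, add_mul, ite_mul, zero_mul,
      Finset.sum_add_distrib, Finset.sum_ite_eq', Finset.mem_univ, if_true]
    exact hflow u
  have := hT.four_le hmem (fun h0 => by
    have := congrFun h0 e
    simp only [Pi.add_apply, Pi.single_eq_same, Pi.single_eq_of_ne hne, add_zero,
      Pi.zero_apply] at this
    rw [this] at hs
    norm_num at hs)
  simp only [add_dotProduct, dotProduct_add, single_dotProduct, Pi.single_eq_same,
    Pi.single_eq_of_ne hne, Pi.single_eq_of_ne hne.symm] at this
  omega

/-- A nonzero flow lattice that is a tiling lattice comes from a graph with a 4-cycle that is a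
cut. -/
theorem exists_square (hT : IsTilingSubgroup (FlowLattice t h)) {g : E → ℤ}
    (hg : g ∈ FlowLattice t h) (h0 : g ≠ 0) : Nonempty (Square t h) := by
  classical
  obtain ⟨v, hv, hn, heven⟩ := hT.exists_norm_four hg h0
  obtain ⟨side, hside⟩ := exists_side heven
  have habs : ∀ e, v e = 0 ∨ v e = 1 ∨ v e = -1 := fun e => by
    have := abs_le.1 (abs_le_one_of_norm_four hT hv hn e)
    omega
  -- All edges are redirected from `z` to `o`. On the support of `v`, which is the cut, `z` is the
  -- even and `o` the odd end, and `a` is `v` with respect to the new directions.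
  let z : E → V := fun e => if side (t e) then h e else t e
  let o : E → V := fun e => if side (t e) then t e else h e
  let a : E → ℤ := fun e => if side (t e) then -v e else v e
  have hav : ∀ e, a e = v e ∨ a e = - v e := fun e => by
    simp only [a]
    split_ifs <;> simp
  have hends : ∀ e, (t e = z e ∧ h e = o e) ∨ (t e = o e ∧ h e = z e) := by
    intro e
    by_cases hs : side (t e)
    · exact .inr ⟨(if_pos hs).symm, (if_pos hs).symm⟩
    · exact .inl ⟨(if_neg hs).symm, (if_neg hs).symm⟩
  have hterm : ∀ (u : V → ℤ) e, v e * (u (h e) - u (t e)) = a e * (u (o e) - u (z e)) := by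
    intro u e
    by_cases hs : side (t e)
    · simp only [a, o, z, if_pos hs]
      ring
    · simp only [a, o, z, if_neg hs]
  have hso : ∀ e, a e ≠ 0 → side (o e) ∧ ¬ side (z e) := by
    intro e he
    have h1 : Odd (v e) := by
      rcases habs e with h | h | h
      · have := hav e
        omega
      · simp [h]
      · simp [h]
    rw [hside] at h1
    by_cases hs : side (t e)
    · simp only [o, z, if_pos hs]
      tauto
    · simp only [o, z, if_neg hs]
      tauto
  have hcut : ∀ e, a e = 0 → (side (t e) ↔ side (h e)) := by
    intro e he
    by_contra h1
    rw [← hside] at h1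
    have h2 : v e = 0 := by
      have := hav e
      omega
    rw [h2] at h1
    simp at h1
  clear_value a z o
  have ha : ∀ e, a e = 0 ∨ a e = 1 ∨ a e = -1 := fun e => by
    have := hav e
    have := habs e
    omega
  have hflow : ∀ u : V → ℤ, ∑ e, a e * (u (o e) - u (z e)) = 0 := by
    intro u
    rw [← mem_flowLattice_iff.1 hv u]
    exact Finset.sum_congr rfl fun e _ => (hterm u e).symm
  -- Potentials supported on one side of the cut see only the ends on this side, so the signed ends
  -- cancel on each side separately.
  have hflow_o : ∀ u : V → ℤ, ∑ e, a e * u (o e) = 0 := by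
    intro u
    rw [← hflow fun r => if side r then u r else 0]
    refine Finset.sum_congr rfl fun e _ => ?_
    by_cases he : a e = 0
    · simp [he]
    · simp [hso e he]
  have hflow_z : ∀ u : V → ℤ, ∑ e, a e * u (z e) = 0 := by
    intro u
    rw [← neg_eq_zero, ← hflow fun r => if side r then 0 else u r, ← Finset.sum_neg_distrib]
    refine Finset.sum_congr rfl fun e _ => ?_
    by_cases he : a e = 0
    · simp [he]
    · simp [hso e he]
  have hv2 : ∀ e, a e ≠ 0 → v e * v e = 1 := by
    intro e he
    have := hav e
    rcases habs e with h | h | h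
    · omega
    · rw [h]; rfl
    · rw [h]; rfl
  -- Two edges of opposite sign with the same two ends would give a flow of norm 2.
  have hpar : ∀ e e', a e = 1 → a e' = -1 → z e = z e' → o e ≠ o e' := by
    intro e e' h1 h2 h3 h4
    refine not_parallel hT (e := e) (e' := e') ?_ (hv2 e (by omega)) (hv2 e' (by omega))
      fun u => ?_
    · rintro rfl
      omega
    · rw [hterm, hterm, h1, h2, h3, h4]
      ring
  obtain ⟨e₀, e₁, e₂, e₃, hp, hm, hsum⟩ := exists_four_of_sum_eq_zero ha
    (by simpa using hflow_o fun _ => 1) (by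
      rw [← hn]
      refine Finset.sum_congr rfl fun e _ => ?_
      rcases hav e with h | h <;> rw [h]
      ring)
  have hz : ∀ u : V → ℤ, u (z e₀) + u (z e₂) = u (z e₁) + u (z e₃) := by
    intro u
    have := hflow_z u
    rw [hsum] at this
    linarith
  have ho : ∀ u : V → ℤ, u (o e₀) + u (o e₂) = u (o e₁) + u (o e₃) := by
    intro u
    have := hflow_o u
    rw [hsum] at this
    linarith
  clear hsum hflow hflow_o hflow_z
  -- The pairs of even ends of positive and of negative edges agree as multisets, so `e₁` and `e₃`
  -- can be named such that `e₁` meets `e₀`. The absence of parallel edges then forces the pairing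
  -- of the odd ends.
  wlog hz01 : z e₁ = z e₀ generalizing e₁ e₃
  · refine this e₃ e₁ (fun e => by rw [hm, or_comm]) (fun u => by rw [hz, add_comm])
      (fun u => by rw [ho, add_comm]) ?_
    have := hz fun r => if r = z e₀ then 1 else 0
    by_contra h3
    simp only [if_true, hz01, h3, if_false] at this
    split_ifs at this <;> omega
  have hz23 : z e₃ = z e₂ := by
    have := hz fun r => if r = z e₂ then 1 else 0
    by_contra h3
    simp only [if_true, hz01, h3, if_false] at this
    omega
  have a0 := (hp e₀).2 (.inl rfl)
  have a2 := (hp e₂).2 (.inr rfl)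
  have a1 := (hm e₁).2 (.inl rfl)
  have a3 := (hm e₃).2 (.inr rfl)
  have ho01 : o e₀ ≠ o e₁ := hpar _ _ a0 a1 hz01.symm
  have ho03 : o e₃ = o e₀ := by
    have := ho fun r => if r = o e₀ then 1 else 0
    by_contra h3
    simp only [if_true, ho01.symm, h3, if_false] at this
    split_ifs at this <;> omega
  have ho12 : o e₂ = o e₁ := by
    have := ho fun r => if r = o e₁ then 1 else 0
    by_contra h3
    simp only [if_true, ho01, ho03, h3, if_false] at this
    omega
  have hz02 : z e₀ ≠ z e₂ := fun h1 => hpar _ _ a0 a3 (h1.trans hz23.symm) ho03.symm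
  refine nonempty_square_of_edges side z o hends hz01 hz23 ho03 ho12 hz02 ho01
    (hso e₀ (by omega)).2 (hso e₂ (by omega)).2 (hso e₀ (by omega)).1 (hso e₁ (by omega)).1
    fun e => ?_
  rcases ha e with h1 | h1 | h1
  · exact .inl (hcut e h1)
  · rw [hp] at h1
    tauto
  · rw [hm] at h1
    tauto

end Graph

/-! ### Branchings and why tiling lattices have none -/

/-- The coordinates other than `e₀` fall into two parts such that vectors of the lattice can be
split along `e₀`, in a non-trivial way. -/
structure Branching {E : Type} (L : AddSubgroup (E → ℤ)) (e₀ : E) (S : E → Prop) : Prop where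
  not_mem : ¬ S e₀
  split : ∀ f ∈ L, ∃ f' ∈ L, (∀ e, S e → f' e = f e) ∧ ∀ e, ¬ S e → e ≠ e₀ → f' e = 0
  left : ∃ p ∈ L, (∀ e, ¬ S e → e ≠ e₀ → p e = 0) ∧ p e₀ * p e₀ = 1
  right : ∃ p ∈ L, (∀ e, S e → p e = 0) ∧ p e₀ * p e₀ = 1

theorem Branching.symm {E : Type} {L : AddSubgroup (E → ℤ)} {e₀ : E} {S : E → Prop}
    (B : Branching L e₀ S) : Branching L e₀ fun e => ¬ S e ∧ e ≠ e₀ where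
  not_mem h := h.2 rfl
  split f hf := by
    obtain ⟨f', hf', h1, h2⟩ := B.split f hf
    refine ⟨f - f', sub_mem hf hf', fun e he => ?_, fun e he h0 => ?_⟩
    · rw [Pi.sub_apply, h2 e he.1 he.2, sub_zero]
    · rw [Pi.sub_apply, h1 e (by tauto), sub_self]
  left := by
    obtain ⟨p, hp, h1, h2⟩ := B.right
    exact ⟨p, hp, fun e he h0 => h1 e (by tauto), h2⟩
  right := by
    obtain ⟨p, hp, h1, h2⟩ := B.left
    exact ⟨p, hp, fun e he => h1 e he.1 he.2, h2⟩

namespace Square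

variable {V E : Type} {t h : E → V} [Fintype E]

/-- The 4-cycle has even products with all flows. -/
theorem sign_mul_add_eq (q : Square t h) {f : E → ℤ} (hf : f ∈ FlowLattice t h) :
    q.sign 1 * f (q.x 1) + q.sign 3 * f (q.x 3) = q.sign 0 * f (q.x 0) + q.sign 2 * f (q.x 2) :=
  ((q.gluing.mem_iff f).1 hf).1

theorem exists_cycle (q : Square t h) : ∃ v ∈ FlowLattice t h, (∀ i, v (q.x i) = q.sign i) ∧
    ∀ e, (∀ i, e ≠ q.x i) → v e = 0 := by
  classical
  refine ⟨fun e => ∑ i, if e = q.x i then q.sign i else 0, ?_, fun i => ?_, fun e he => ?_⟩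
  · rw [mem_flowLattice_iff]
    intro u
    simp only [Finset.sum_mul]
    rw [Finset.sum_comm]
    simp only [ite_mul, zero_mul, Finset.sum_ite_eq', Finset.mem_univ, if_true, q.mul_sub_ends,
      q.sign_mul_self, one_mul]
    rw [ZMod.sum_univ_four]
    change u (q.w 1) - u (q.w 0) + (u (q.w 2) - u (q.w 1)) + (u (q.w 3) - u (q.w 2)) +
      (u (q.w 0) - u (q.w 3)) = 0
    ring
  · simp [q.x_injective.eq_iff]
  · simp [he]

open Classical in
theorem sum_mul_of_support (q : Square t h) {f : E → ℤ} {e₀ : E} {k : ℤ}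
    (hk : ∀ e, (∀ i, e ≠ q.x i) → f e = if e = e₀ then k else 0) (hk0 : (∃ i, e₀ = q.x i) → k = 0)
    (F : E → ℤ) : ∑ e, f e * F e = ∑ i, f (q.x i) * F (q.x i) + k * F e₀ := by
  rw [← Finset.sum_filter_add_sum_filter_not Finset.univ (fun e => ∃ i, e = q.x i)]
  congr 1
  · rw [← Finset.sum_image (f := fun e => f e * F e) (fun i _ j _ hij => q.x_injective hij)]
    refine Finset.sum_congr ?_ fun _ _ => rfl
    ext e
    simp [eq_comm]
  · have h1 : ∀ e ∈ Finset.univ.filter (fun e => ¬ ∃ i, e = q.x i),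
        f e * F e = if e = e₀ then k * F e else 0 := by
      intro e he
      rw [hk e (by simpa using he)]
      split_ifs <;> simp
    rw [Finset.sum_congr rfl h1, Finset.sum_ite_eq']
    split_ifs with h2
    · rfl
    · rw [hk0 (by simpa using h2), zero_mul]

/-- A branching puts the edges of the 4-cycle on the same side. -/
theorem branching_const (q : Square t h) (hT : IsTilingSubgroup (FlowLattice t h)) {e₀ : E}
    {S : E → Prop} (B : Branching (FlowLattice t h) e₀ S) :
    (∀ i, q.x i ≠ e₀ → S (q.x i)) ∨ ∀ i, q.x i ≠ e₀ → ¬ S (q.x i) := by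
  classical
  obtain ⟨v, hv, hvx, hvo⟩ := q.exists_cycle
  obtain ⟨f, hf, hS, hnS⟩ := B.split v hv
  -- The part `f` of the 4-cycle lives on the 4-cycle and possibly on `e₀`; `k` is its value on `e₀`
  -- if this is a further edge.
  let k : ℤ := if ∃ i, e₀ = q.x i then 0 else f e₀
  have hsum := q.sum_mul_of_support (f := f) (e₀ := e₀) (k := k) (fun e he => by
    split_ifs with h1
    · subst h1
      simp only [k]
      rw [if_neg (by push Not; exact he)]
    · by_cases h2 : S e
      · rw [hS e h2, hvo e he]
      · exact hnS e h2 h1) (fun h1 => if_pos h1)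
  let g : ZMod 4 → ℤ := fun i => q.sign i * f (q.x i)
  have hg1 : ∀ i, q.x i ≠ e₀ → g i = if S (q.x i) then 1 else 0 := by
    intro i hi
    simp only [g]
    split_ifs with h1
    · rw [hS _ h1, hvx, q.sign_mul_self]
    · rw [hnS _ h1 hi, mul_zero]
  have hcut : g 1 + g 3 = g 0 + g 2 := q.sign_mul_add_eq hf
  have hconst : (∀ i j, g i = g j) → (∀ i, q.x i ≠ e₀ → S (q.x i)) ∨ ∀ i, q.x i ≠ e₀ → ¬ S (q.x i) := by
    intro hc
    by_contra! h1
    obtain ⟨⟨i, hi, hi'⟩, j, hj, hj'⟩ := h1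
    have := hc i j
    rw [hg1 i hi, hg1 j hj, if_neg hi', if_pos hj'] at this
    norm_num at this
  -- Conservation at the vertex `w (i + 1)`: the flow along the 4-cycle changes there by at most
  -- what `e₀` carries.
  have hnode : ∀ i, ∃ d, (d = 0 ∨ d = 1 ∨ d = -1) ∧ g i - g (i + 1) + k * d = 0 := by
    intro i
    let u : V → ℤ := fun r => if r = q.w (i + 1) then 1 else 0
    refine ⟨u (h e₀) - u (t e₀), ?_, ?_⟩
    · simp only [u]
      split_ifs <;> simp
    · have h1 := mem_flowLattice_iff.1 hf u
      rw [hsum] at h1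
      simp only [q.mul_sub_ends] at h1
      rw [← h1]
      congr 1
      have hu0 : u (q.w i) = 0 := if_neg (q.w_ne_succ i)
      have hu1 : u (q.w (i + 1)) = 1 := if_pos rfl
      have hu2 : u (q.w (i + 2)) = 0 := if_neg (by
        have := q.w_ne_succ (i + 1)
        rw [add_assoc] at this
        exact this.symm)
      have hu3 : u (q.w (i + 3)) = 0 := if_neg (by
        have := q.w_ne (i + 1)
        rw [add_assoc] at this
        exact this.symm)
      rw [← Equiv.sum_comp (Equiv.addLeft i), ZMod.sum_univ_four]
      simp only [Equiv.coe_addLeft, add_assoc, add_zero]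
      rw [show (1 : ZMod 4) + 1 = 2 from rfl, show (2 : ZMod 4) + 1 = 3 from rfl,
        show (3 : ZMod 4) + 1 = 0 from rfl, add_zero, hu0, hu1, hu2, hu3]
      simp only [g]
      ring
  by_cases h0 : ∃ i, e₀ = q.x i
  · have hk : k = 0 := if_pos h0
    refine hconst ?_
    have h1 : ∀ i, g i = g (i + 1) := fun i => by
      obtain ⟨d, -, hd⟩ := hnode i
      rw [hk] at hd
      linarith
    have h2 : g 0 = g 1 := h1 0
    have h3 : g 1 = g 2 := h1 1
    have h4 : g 2 = g 3 := h1 2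
    exact ZMod.eq_of_succ h2 h3 h4
  · have hg2 : ∀ i, g i = 0 ∨ g i = 1 := fun i => by
      rw [hg1 i fun h => h0 ⟨i, h.symm⟩]
      split_ifs <;> simp
    by_contra h1
    have h2 : ¬ ∀ i j, g i = g j := fun h => h1 (hconst h)
    -- A change from 0 to 1 somewhere along the 4-cycle must be carried by `e₀`.
    have h3 : k * k = 1 := by
      have h4 : ∃ i, g i ≠ g (i + 1) := by
        by_contra! h4
        refine h2 ?_
        have h2 : g 0 = g 1 := h4 0
        have h3 : g 1 = g 2 := h4 1
        have h4 : g 2 = g 3 := h4 2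
        exact ZMod.eq_of_succ h2 h3 h4
      obtain ⟨i, hi⟩ := h4
      obtain ⟨d, hd, h4⟩ := hnode i
      have h5 := hg2 i
      have h6 := hg2 (i + 1)
      have h7 : k = 1 ∨ k = -1 := by
        rcases hd with rfl | rfl | rfl <;> omega
      rcases h7 with h7 | h7 <;> rw [h7] <;> rfl
    have h4 : f ⬝ᵥ f = ∑ i, g i * g i + 1 := by
      rw [dotProduct, hsum]
      congr 1
      · refine Finset.sum_congr rfl fun i _ => ?_
        simp only [g]
        rw [mul_mul_mul_comm, q.sign_mul_self, one_mul]
      · rw [show f e₀ = k from (if_neg h0).symm, h3]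
    have hk0 : f ≠ 0 := by
      rintro rfl
      simp [k] at h3
    have h5 := hT.four_le hf hk0
    rw [h4, ZMod.sum_univ_four] at h5
    refine h2 ?_
    have hsq : ∀ i, g i * g i = g i := fun i => by rcases hg2 i with h | h <;> rw [h] <;> rfl
    simp only [hsq] at h5
    -- Since `f` has norm at least 4, at least three of the four values are 1. The cut relation `g 1
    -- + g 3 = g 0 + g 2` then makes all of them 1.
    have := hg2 0
    have := hg2 1
    have := hg2 2
    have := hg2 3
    apply ZMod.eq_of_succ <;> omega

open Classical in
theorem fst_some (q : Square t h) {f : E → ℤ} (hf : f ∈ FlowLattice t h) (e : q.EvenEdge) :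
    (q.gluing.fst ⟨f, hf⟩ : Option q.EvenEdge → ℤ) (some e) = f e := by
  rw [Gluing.coe_fst]
  exact extendAt_coe none _ _ ⟨some e, Option.some_ne_none e⟩

open Classical in
theorem fst_none (q : Square t h) {f : E → ℤ} (hf : f ∈ FlowLattice t h) :
    (q.gluing.fst ⟨f, hf⟩ : Option q.EvenEdge → ℤ) none =
      1 * (q.sign 2 * f (q.x 2) - q.sign 1 * f (q.x 1)) := by
  rw [Gluing.coe_fst]
  exact extendAt_self none _ _

open Classical in
/-- A branching at an even edge induces a branching on the even side. -/
theorem branching_even (q : Square t h) {e₀ : q.EvenEdge} {S : E → Prop}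
    (B : Branching (FlowLattice t h) (e₀ : E) S) (hS : ∀ i, S (q.x i)) :
    Branching (FlowLattice q.tail q.head) (some e₀) (fun e => ∀ e', e = some e' → S e') := by
  refine ⟨fun h1 => B.not_mem (h1 _ rfl), fun f hf => ?_, ?_, ?_⟩
  · obtain ⟨⟨g, hg'⟩, hg, -, -⟩ := q.gluing.exists_of_fst_snd ⟨f, hf⟩ 0 0
    obtain ⟨g', hg'', h1, h2⟩ := B.split g hg'
    refine ⟨q.gluing.fst ⟨g', hg''⟩, (q.gluing.fst ⟨g', hg''⟩).2, fun e he => ?_, fun e he hne => ?_⟩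
    · rw [show f = q.gluing.fst ⟨g, hg'⟩ by rw [hg]]
      cases e with
      -- The value on the new edge is a difference of two values on the 4-cycle, which lies in `S`.
      -- So the new edge belongs to the same part.
      | none => rw [fst_none, fst_none, h1 _ (hS _), h1 _ (hS _)]
      | some e => rw [fst_some, fst_some, h1 _ (he e rfl)]
    · cases e with
      | none => exact absurd (fun e' h => by cases h) he
      | some e =>
        rw [fst_some]
        refine h2 e (fun h => he ?_) fun h => hne ?_
        · rintro e' ⟨⟩
          exact h
        · rw [Subtype.ext h]
  · obtain ⟨p, hp, h1, h2⟩ := B.left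
    refine ⟨q.gluing.fst ⟨p, hp⟩, (q.gluing.fst ⟨p, hp⟩).2, fun e he hne => ?_, ?_⟩
    · cases e with
      | none => exact absurd (fun e' h => by cases h) he
      | some e =>
        rw [fst_some]
        refine h1 e (fun h => he ?_) fun h => hne ?_
        · rintro e' ⟨⟩
          exact h
        · rw [Subtype.ext h]
    · rw [fst_some]
      exact h2
  · obtain ⟨p, hp, h1, h2⟩ := B.right
    refine ⟨q.gluing.fst ⟨p, hp⟩, (q.gluing.fst ⟨p, hp⟩).2, fun e he => ?_, ?_⟩
    · cases e with
      | none =>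
        rw [fst_none]
        simp only [h1 _ (hS _)]
        ring
      | some e => rw [fst_some, h1 _ (he e rfl)]
    · rw [fst_some]
      exact h2

/-- The new edge can be represented by `x 0`, and `x 1` is left over. -/
theorem card_evenEdge_lt (q : Square t h) [Fintype (Option q.EvenEdge)] :
    Fintype.card (Option q.EvenEdge) < Fintype.card E := by
  have hx : ∀ i, ¬ (¬ q.side (t (q.x i)) ∧ ¬ q.side (h (q.x i))) := fun i h1 =>
    q.not_side_iff i (iff_of_false h1.1 h1.2)
  refine Fintype.card_lt_of_injective_of_notMem (fun e : Option q.EvenEdge =>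
    e.elim (q.x 0) (·.1)) ?_ (b := q.x 1) ?_
  · rintro (_ | a) (_ | b) hab
    · rfl
    · exact absurd b.2 (by rw [← show q.x 0 = b.1 from hab]; exact hx 0)
    · exact absurd a.2 (by rw [show a.1 = q.x 0 from hab]; exact hx 0)
    · exact congrArg some (Subtype.ext hab)
  · rintro ⟨_ | a, ha⟩
    · exact absurd (q.x_injective ha) (by decide)
    · exact absurd a.2 (by rw [show a.1 = q.x 1 from ha]; exact hx 1)

end Square

/-- A tiling flow lattice has no branching. -/
theorem not_branching {V E : Type} [Fintype E] {t h : E → V}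
    (hT : IsTilingSubgroup (FlowLattice t h)) {e₀ : E} {S : E → Prop} :
    ¬ Branching (FlowLattice t h) e₀ S := by
  classical
  induction hn : Fintype.card E using Nat.strong_induction_on generalizing E with
  | _ n ih =>
  intro B
  obtain ⟨p, hp, h1, h2⟩ := B.right
  obtain ⟨q⟩ := exists_square hT hp (by rintro rfl; simp at h2)
  -- The roles of the two parts are symmetric.
  wlog hS : ∀ i, q.x i ≠ e₀ → S (q.x i) generalizing S p
  · have h3 := (q.branching_const hT B).resolve_left hS
    obtain ⟨p', hp', h1', h2'⟩ := B.symm.right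
    exact this B.symm p' hp' h1' h2' fun i hi => ⟨h3 i hi, hi⟩
  by_cases h0 : ∃ k, q.x k = e₀
  · obtain ⟨k, rfl⟩ := h0
    -- The flow `p` avoids three edges of the 4-cycle, so the cut relation makes it vanish on the
    -- fourth one as well, which is `e₀`.
    have h3 := q.sign_mul_add_eq hp
    have h4 : ∀ i, i ≠ k → p (q.x i) = 0 := fun i hi =>
      h1 _ (hS i (q.x_injective.ne hi))
    have h5 : p (q.x k) = 0 := by
      have h6 : q.sign k * p (q.x k) = 0 := by
        revert h3 h4
        match k with
        | 0 => intro h3 h4; simpa [h4 1 (by decide), h4 2 (by decide), h4 3 (by decide)] using h3.symm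
        | 1 => intro h3 h4; simpa [h4 0 (by decide), h4 2 (by decide), h4 3 (by decide)] using h3
        | 2 => intro h3 h4; simpa [h4 0 (by decide), h4 1 (by decide), h4 3 (by decide)] using h3.symm
        | 3 => intro h3 h4; simpa [h4 0 (by decide), h4 1 (by decide), h4 2 (by decide)] using h3
      have h7 := congrArg (q.sign k * ·) h6
      simpa [← mul_assoc, q.sign_mul_self] using h7
    rw [h5] at h2
    norm_num at h2
  · push Not at h0
    have hS' : ∀ i, S (q.x i) := fun i => hS i (h0 i)
    -- If `e₀` is not on the 4-cycle, it lies on one side of the cut, and the smaller graph on this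
    -- side inherits the branching.
    have hcut := (q.cut e₀).resolve_right fun ⟨i, hi⟩ => h0 i hi.symm
    by_cases hs : q.side (t e₀)
    · exact ih _ (hn ▸ q.flip.card_evenEdge_lt) (q.flip.gluing.isTilingSubgroup_fst_snd hT).1 rfl
        (q.flip.branching_even (e₀ := ⟨e₀, not_not.2 hs, not_not.2 (hcut.1 hs)⟩) B
          fun i => hS' (i + 1))
    · exact ih _ (hn ▸ q.card_evenEdge_lt) (q.gluing.isTilingSubgroup_fst_snd hT).1 rfl
        (q.branching_even (e₀ := ⟨e₀, hs, fun h => hs (hcut.2 h)⟩) B hS')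

/-! ### Invariant functions on corners, duality of black and white, Euler's inequality -/

namespace DiagramCode

variable {C : DiagramCode} {α : Type*}

/-- The region at a corner. -/
def rg (h : C.HalfEdge) : C.Region := Quot.mk _ h

/-- The corner on the right hand side of a half-edge. -/
def right (h : C.HalfEdge) : C.HalfEdge := (h.1, h.2 - 1)

/-- A function on the corners that is constant on every region. -/
def IsInvariant (θ : C.HalfEdge → α) : Prop := ∀ h, θ (right (C.opp h)) = θ h

theorem isInvariant_rg : IsInvariant (rg (C := C)) := fun h =>
  (Quot.sound (r := fun h k : C.HalfEdge => k = C.nextCorner h) (a := h) rfl).symm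

theorem IsInvariant.exists_region {θ : C.HalfEdge → α} (hθ : IsInvariant θ) :
    ∃ F : C.Region → α, ∀ h, F (rg h) = θ h :=
  ⟨Quot.lift θ fun h _ hk => hk ▸ (hθ h).symm, fun _ => rfl⟩

theorem IsInvariant.eq_of_rg_eq {θ : C.HalfEdge → α} (hθ : IsInvariant θ) {h k : C.HalfEdge}
    (hk : rg h = rg k) : θ h = θ k := by
  obtain ⟨F, hF⟩ := hθ.exists_region
  rw [← hF, ← hF, hk]

theorem IsInvariant.comp {β : Type*} {θ : C.HalfEdge → α} (hθ : IsInvariant θ) (g : α → β) :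
    IsInvariant fun h => g (θ h) := fun h => congrArg g (hθ h)

theorem isInvariant_of_region (F : C.Region → α) : IsInvariant fun h : C.HalfEdge => F (rg h) :=
  isInvariant_rg.comp F

/-- Indicator functions of regions separate regions. Having only to test values in `ZMod 2` lets
parity arguments identify regions. -/
theorem rg_eq_iff {h k : C.HalfEdge} :
    rg h = rg k ↔ ∀ θ : C.HalfEdge → ZMod 2, IsInvariant θ → θ h = θ k := by
  classical
  refine ⟨fun hk θ hθ => hθ.eq_of_rg_eq hk, fun H => ?_⟩
  have := H _ (isInvariant_of_region fun r => if r = rg k then 1 else 0)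
  by_contra hne
  simp [hne] at this

theorem rg_surjective : Function.Surjective (rg (C := C)) := Quot.exists_rep

instance : Finite C.Region := Finite.of_surjective _ rg_surjective

/-- Different edges are adjacent to different pairs of regions. -/
def SeparatesEdges (C : DiagramCode) : Prop :=
  ∀ h k : C.HalfEdge, rg h = rg k → rg (right h) = rg (right k) → h = k

/-- Any two crossings lie in the same connected component. -/
def IsConnected (C : DiagramCode) : Prop :=
  ∀ P : C.Crossing → Prop, (∀ h : C.HalfEdge, P h.1 → P (C.opp h).1) → ∀ x y, P x → P y

/-- The code of an alternating diagram, which may be disconnected. -/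
structure IsAlternating (C : DiagramCode) : Prop where
  opp_opp : ∀ h, C.opp (C.opp h) = h
  alternating : ∀ h, IsOver (C.opp h).2 ↔ ¬ IsOver h.2

theorem isOver_sub_one (i : ZMod 4) : IsOver (i - 1) ↔ ¬ IsOver i := by
  revert i; decide

theorem IsInvariant.isOver_iff (hA : C.IsAlternating) {h k : C.HalfEdge} (hk : rg h = rg k) :
    IsOver h.2 ↔ IsOver k.2 := by
  have : IsInvariant fun h : C.HalfEdge => IsOver h.2 := fun h => by
    change IsOver ((C.opp h).2 - 1) = IsOver h.2
    rw [isOver_sub_one, hA.alternating, not_not]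
  exact (this.eq_of_rg_eq hk).to_iff

/-- The black corner next to a half-edge. -/
def blackCorner (h : C.HalfEdge) : C.HalfEdge := if IsOver h.2 then h else right h

/-- The white corner next to a half-edge. -/
def whiteCorner (h : C.HalfEdge) : C.HalfEdge := if IsOver h.2 then right h else h

theorem IsInvariant.right_eq (hA : C.IsAlternating) {θ : C.HalfEdge → α} (hθ : IsInvariant θ)
    (h : C.HalfEdge) : θ (right h) = θ (C.opp h) := by
  have := hθ (C.opp h)
  rwa [hA.opp_opp] at this

theorem IsInvariant.blackCorner_opp (hA : C.IsAlternating) {θ : C.HalfEdge → α}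
    (hθ : IsInvariant θ) (h : C.HalfEdge) : θ (blackCorner (C.opp h)) = θ (blackCorner h) := by
  have := hA.alternating h
  by_cases ho : IsOver h.2
  · rw [blackCorner, if_neg (by tauto), blackCorner, if_pos ho, hθ]
  · rw [blackCorner, if_pos (this.2 ho), blackCorner, if_neg ho, hθ.right_eq hA]

theorem IsInvariant.whiteCorner_opp (hA : C.IsAlternating) {θ : C.HalfEdge → α}
    (hθ : IsInvariant θ) (h : C.HalfEdge) : θ (whiteCorner (C.opp h)) = θ (whiteCorner h) := by
  have := hA.alternating h
  by_cases ho : IsOver h.2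
  · rw [whiteCorner, if_neg (by tauto), whiteCorner, if_pos ho, hθ.right_eq hA]
  · rw [whiteCorner, if_pos (this.2 ho), whiteCorner, if_neg ho, hθ]

theorem sum_halfEdge {M : Type*} [AddCommMonoid M] (ζ : C.HalfEdge → M) :
    ∑ h, ζ h = ∑ x, (ζ (x, 0) + ζ (x, 1) + ζ (x, 2) + ζ (x, 3)) := by
  rw [Fintype.sum_prod_type]
  exact Finset.sum_congr rfl fun x _ => ZMod.sum_univ_four _

/-- Every edge has an over-end and an under-end, whose contributions cancel. -/
theorem sum_sign_eq_zero {K : Type*} [CommRing K] (hA : C.IsAlternating) {ζ : C.HalfEdge → K}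
    (hζ : ∀ h, ζ (C.opp h) = ζ h) :
    ∑ x, (-ζ (x, 0) + ζ (x, 1) - ζ (x, 2) + ζ (x, 3)) = 0 := by
  have h1 : ∑ h : C.HalfEdge, (if IsOver h.2 then ζ h else -ζ h) = 0 := by
    refine Finset.sum_involution (fun h _ => C.opp h) (fun h _ => ?_) (fun h _ _ heq => ?_)
      (fun _ _ => Finset.mem_univ _) fun h _ => hA.opp_opp h
    · have := hA.alternating h
      by_cases ho : IsOver h.2
      · rw [if_pos ho, if_neg (by tauto), hζ, add_neg_cancel]
      · rw [if_neg ho, if_pos (this.2 ho), hζ, neg_add_cancel]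
    · have := hA.alternating h
      rw [heq] at this
      exact iff_not_self this
  rw [sum_halfEdge] at h1
  rw [← h1]
  refine Finset.sum_congr rfl fun x _ => ?_
  rw [if_neg (show ¬ IsOver 0 by decide), if_pos (show IsOver 1 by decide),
    if_neg (show ¬ IsOver 2 by decide), if_pos (show IsOver 3 by decide)]
  ring

/-- The difference of a function at the black corners of a crossing. -/
def blackDiff {K : Type*} [Sub K] (θ : C.HalfEdge → K) (x : C.Crossing) : K := θ (x, 3) - θ (x, 1)

/-- The difference of a function at the white corners of a crossing. -/
def whiteDiff {K : Type*} [Sub K] (θ : C.HalfEdge → K) (x : C.Crossing) : K := θ (x, 0) - θ (x, 2)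

theorem corners (x : C.Crossing) :
    blackCorner (C := C) (x, 0) = (x, 3) ∧ blackCorner (C := C) (x, 1) = (x, 1) ∧
    blackCorner (C := C) (x, 2) = (x, 1) ∧ blackCorner (C := C) (x, 3) = (x, 3) ∧
    whiteCorner (C := C) (x, 0) = (x, 0) ∧ whiteCorner (C := C) (x, 1) = (x, 0) ∧
    whiteCorner (C := C) (x, 2) = (x, 2) ∧ whiteCorner (C := C) (x, 3) = (x, 2) :=
  ⟨rfl, rfl, rfl, rfl, rfl, rfl, rfl, rfl⟩

/-- The product of the values at the black and the white corner next to a half-edge is the same at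
both ends of the edge. Its alternating sum at a crossing is minus the product of the two
differences. Planarity plays no role here. -/
theorem blackDiff_dotProduct_whiteDiff {K : Type*} [CommRing K] (hA : C.IsAlternating)
    {θ θ' : C.HalfEdge → K} (hθ : IsInvariant θ) (hθ' : IsInvariant θ') :
    blackDiff θ ⬝ᵥ whiteDiff θ' = 0 := by
  rw [← neg_eq_zero, ← sum_sign_eq_zero hA
    (ζ := fun h => θ (blackCorner h) * θ' (whiteCorner h))
    fun h => by rw [hθ.blackCorner_opp hA, hθ'.whiteCorner_opp hA], dotProduct,
    ← Finset.sum_neg_distrib]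
  refine Finset.sum_congr rfl fun x _ => ?_
  obtain ⟨b0, b1, b2, b3, w0, w1, w2, w3⟩ := corners x
  simp only [b0, b1, b2, b3, w0, w1, w2, w3, blackDiff, whiteDiff]
  ring

/-- In a connected diagram, an invariant function without differences is constant on the black
corners and on the white corners. -/
theorem IsInvariant.eq_of_diff_eq_zero {K : Type*} [AddGroup K] (hA : C.IsAlternating)
    (hC : C.IsConnected) {θ : C.HalfEdge → K} (hθ : IsInvariant θ) (hb : ∀ x, blackDiff θ x = 0)
    (hw : ∀ x, whiteDiff θ x = 0) (x y : C.Crossing) :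
    θ (x, 1) = θ (y, 1) ∧ θ (x, 0) = θ (y, 0) := by
  have h3 : ∀ y i, θ (blackCorner (y, i)) = θ (y, 1) ∧ θ (whiteCorner (y, i)) = θ (y, 0) := by
    intro y
    obtain ⟨b0, b1, b2, b3, w0, w1, w2, w3⟩ := corners y
    rw [ZMod.forall_four, b0, b1, b2, b3, w0, w1, w2, w3, sub_eq_zero.1 (hb y),
      sub_eq_zero.1 (hw y)]
    simp
  refine hC (fun y => θ (x, 1) = θ (y, 1) ∧ θ (x, 0) = θ (y, 0)) (fun h ⟨h1, h2⟩ => ?_) x y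
    ⟨rfl, rfl⟩
  exact ⟨h1.trans ((h3 h.1 h.2).1.symm.trans
      ((hθ.blackCorner_opp hA h).symm.trans (h3 _ (C.opp h).2).1)),
    h2.trans ((h3 h.1 h.2).2.symm.trans
      ((hθ.whiteCorner_opp hA h).symm.trans (h3 _ (C.opp h).2).2))⟩

section Euler

open Module

/-- The differences of a function on the regions along the black regions. -/
def blackDiffₗ (C : DiagramCode) : (C.Region → ℚ) →ₗ[ℚ] (C.Crossing → ℚ) where
  toFun F := blackDiff fun h => F (rg h)
  map_add' F G := funext fun x => by simp only [blackDiff, Pi.add_apply]; ring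
  map_smul' c F := funext fun x => by simp [blackDiff, mul_sub]

/-- The differences of a function on the regions along the white regions. -/
def whiteDiffₗ (C : DiagramCode) : (C.Region → ℚ) →ₗ[ℚ] (C.Crossing → ℚ) where
  toFun F := whiteDiff fun h => F (rg h)
  map_add' F G := funext fun x => by simp only [whiteDiff, Pi.add_apply]; ring
  map_smul' c F := funext fun x => by simp [whiteDiff, mul_sub]

/-- A function on the regions with vanishing differences is determined by its values on one black
and one white region, by connectedness. -/
theorem card_region_le_finrank (hA : C.IsAlternating) (hC : C.IsConnected) (x₀ : C.Crossing) :
    Nat.card C.Region ≤ finrank ℚ C.blackDiffₗ.range + finrank ℚ C.whiteDiffₗ.range + 2 := by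
  have := Fintype.ofFinite C.Region
  let T := C.blackDiffₗ.rangeRestrict.prod C.whiteDiffₗ.rangeRestrict
  have h1 := T.finrank_range_add_finrank_ker
  have h2 : finrank ℚ T.range ≤ finrank ℚ C.blackDiffₗ.range + finrank ℚ C.whiteDiffₗ.range := by
    rw [← finrank_prod]
    exact Submodule.finrank_le _
  have h3 : finrank ℚ T.ker ≤ 2 := by
    let S : T.ker →ₗ[ℚ] ℚ × ℚ :=
      ((LinearMap.proj (rg (x₀, 1))).prod (LinearMap.proj (rg (x₀, 0)))).comp T.ker.subtype
    have hS : Function.Injective S := by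
      rw [← LinearMap.ker_eq_bot, LinearMap.ker_eq_bot']
      rintro ⟨F, hF⟩ h0
      have hb : C.blackDiffₗ F = 0 := congrArg (fun p => (p.1 : C.Crossing → ℚ)) hF
      have hw : C.whiteDiffₗ F = 0 := congrArg (fun p => (p.2 : C.Crossing → ℚ)) hF
      have h01 : F (rg (x₀, 1)) = 0 := congrArg Prod.fst h0
      have h00 : F (rg (x₀, 0)) = 0 := congrArg Prod.snd h0
      ext r
      obtain ⟨⟨x, i⟩, rfl⟩ := rg_surjective r
      have h4 := (isInvariant_of_region F).eq_of_diff_eq_zero hA hC (congrFun hb) (congrFun hw) x₀ x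
      rw [h01, h00] at h4
      have h5 : ∀ i, F (rg (x, i)) = 0 := by
        rw [ZMod.forall_four]
        have h6 : F (rg (x, 3)) - F (rg (x, 1)) = 0 := congrFun hb x
        have h7 : F (rg (x, 0)) - F (rg (x, 2)) = 0 := congrFun hw x
        refine ⟨h4.2.symm, h4.1.symm, ?_, ?_⟩
        · linarith [h4.2]
        · linarith [h4.1]
      exact h5 i
    have := LinearMap.finrank_le_finrank_of_injective hS
    simpa using this
  rw [finrank_fintype_fun_eq_card] at h1
  rw [Nat.card_eq_fintype_card]
  omega

/-- A black difference that is also a white one is orthogonal to itself. -/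
theorem disjoint_range_diff (hA : C.IsAlternating) :
    Disjoint C.blackDiffₗ.range C.whiteDiffₗ.range := by
  rw [Submodule.disjoint_def]
  rintro f ⟨F, rfl⟩ ⟨G, hG⟩
  have := blackDiff_dotProduct_whiteDiff hA (isInvariant_of_region F) (isInvariant_of_region G)
  change C.blackDiffₗ F ⬝ᵥ C.whiteDiffₗ G = 0 at this
  rwa [hG, dotProduct_self_eq_zero] at this

/-- Euler's inequality. -/
theorem card_region_le (hA : C.IsAlternating) (hC : C.IsConnected) (x₀ : C.Crossing) :
    Nat.card C.Region ≤ Fintype.card C.Crossing + 2 := by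
  have h1 := card_region_le_finrank hA hC x₀
  have h2 := Submodule.finrank_add_finrank_le_of_disjoint (disjoint_range_diff hA)
  rw [finrank_fintype_fun_eq_card] at h2
  omega

/-- On the sphere, a function on the crossings that is orthogonal to all black differences is a
white difference. -/
theorem exists_whiteDiff_rat (hA : C.IsAlternating) (hC : C.IsConnected) (x₀ : C.Crossing)
    (hp : Nat.card C.Region = Fintype.card C.Crossing + 2) {f : C.Crossing → ℚ}
    (hf : ∀ F, f ⬝ᵥ C.blackDiffₗ F = 0) : ∃ G, C.whiteDiffₗ G = f := by
  have h1 := card_region_le_finrank hA hC x₀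
  have h2 := disjoint_range_diff hA
  -- In the equality case of Euler's inequality the two orthogonal ranges fill the whole space.
  have h3 : C.blackDiffₗ.range ⊔ C.whiteDiffₗ.range = ⊤ := by
    apply Submodule.eq_top_of_finrank_eq
    have h4 := Submodule.finrank_sup_add_finrank_inf_eq C.blackDiffₗ.range C.whiteDiffₗ.range
    rw [h2.eq_bot, finrank_bot] at h4
    have h5 := Submodule.finrank_le (C.blackDiffₗ.range ⊔ C.whiteDiffₗ.range)
    rw [finrank_fintype_fun_eq_card] at h5 ⊢
    omega
  obtain ⟨_, ⟨F, rfl⟩, _, ⟨G, rfl⟩, hFG⟩ := Submodule.mem_sup.1 (h3 ▸ Submodule.mem_top (x := f))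
  have h4 := hf F
  rw [← hFG, add_dotProduct, dotProduct_comm (C.whiteDiffₗ G)] at h4
  have h5 : C.blackDiffₗ F ⬝ᵥ C.whiteDiffₗ G = 0 :=
    blackDiff_dotProduct_whiteDiff hA (isInvariant_of_region F) (isInvariant_of_region G)
  rw [h5, add_zero, dotProduct_self_eq_zero] at h4
  exact ⟨G, by rw [← hFG, h4, zero_add]⟩

end Euler

/-- The lattice of integer flows on the black Tait graph, in terms of invariant functions. -/
def flows (C : DiagramCode) : AddSubgroup (C.Crossing → ℤ) where
  carrier := {f | ∀ θ : C.HalfEdge → ℤ, IsInvariant θ → f ⬝ᵥ blackDiff θ = 0}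
  zero_mem' := fun θ _ => zero_dotProduct _
  add_mem' := fun ha hb θ hθ => by rw [add_dotProduct, ha θ hθ, hb θ hθ, add_zero]
  neg_mem' := fun ha θ hθ => by rw [neg_dotProduct, ha θ hθ, neg_zero]

theorem whiteDiff_mem_flows (hA : C.IsAlternating) {θ : C.HalfEdge → ℤ} (hθ : IsInvariant θ) :
    whiteDiff θ ∈ C.flows := fun θ' hθ' => by
  rw [dotProduct_comm, blackDiff_dotProduct_whiteDiff hA hθ' hθ]

/-- Every cycle bounds on the sphere. The rational potential has integral differences across every
crossing, so by connectedness all its white values are congruent modulo 1. -/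
theorem exists_whiteDiff (hA : C.IsAlternating) (hC : C.IsConnected)
    (hp : Nonempty C.Crossing → Nat.card C.Region = Fintype.card C.Crossing + 2) {f : C.Crossing → ℤ}
    (hf : f ∈ C.flows) : ∃ θ : C.HalfEdge → ℤ, IsInvariant θ ∧ whiteDiff θ = f := by
  classical
  by_cases hx : Nonempty C.Crossing
  swap
  · exact ⟨fun _ => 0, fun _ => rfl, funext fun x => absurd ⟨x⟩ hx⟩
  obtain ⟨x₀⟩ := hx
  have := Fintype.ofFinite C.Region
  obtain ⟨G, hG⟩ := exists_whiteDiff_rat hA hC x₀ (hp ⟨x₀⟩) (f := fun x => f x) (by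
    intro F
    have h1 : ∀ r : C.Region, (fun x => (f x : ℚ)) ⬝ᵥ
        C.blackDiffₗ (Pi.single r 1) = 0 := by
      intro r
      have := hf _ (isInvariant_of_region (Pi.single r (1 : ℤ)))
      have h2 := congrArg (Int.cast : ℤ → ℚ) this
      rw [Int.cast_zero] at h2
      rw [← h2]
      simp only [dotProduct, blackDiffₗ, LinearMap.coe_mk, AddHom.coe_mk, blackDiff, Pi.single_apply]
      push_cast
      rfl
    rw [pi_eq_sum_univ F, map_sum, dotProduct_sum]
    refine Finset.sum_eq_zero fun r _ => ?_
    have h2 : (fun j => if r = j then (1 : ℚ) else 0) = Pi.single r 1 := by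
      ext j
      simp [Pi.single_apply, eq_comm]
    rw [map_smul, dotProduct_smul, h2, h1, smul_zero])
  let c := G (rg (x₀, 0))
  have hG' : ∀ x, G (rg (x, 0)) - G (rg (x, 2)) = f x := congrFun hG
  have hint : ∀ x, ∃ n : ℤ, G (rg (x, 0)) - c = n := by
    intro x
    have h3 : ∀ x i, (∃ n : ℤ, G (rg (whiteCorner (x, i))) - c = n) ↔
        ∃ n : ℤ, G (rg (x, 0)) - c = n := by
      intro x
      have h4 : (∃ n : ℤ, G (rg (x, 2)) - c = n) ↔ ∃ n : ℤ, G (rg (x, 0)) - c = n := by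
        constructor
        · rintro ⟨n, hn⟩
          exact ⟨n + f x, by push_cast; linarith [hG' x]⟩
        · rintro ⟨n, hn⟩
          exact ⟨n - f x, by push_cast; linarith [hG' x]⟩
      rw [ZMod.forall_four]
      exact ⟨Iff.rfl, Iff.rfl, h4, h4⟩
    refine hC (fun x => ∃ n : ℤ, G (rg (x, 0)) - c = n) (fun h hn => ?_) x₀ x ⟨0, by simp [c]⟩
    rw [← h3 _ (C.opp h).2]
    rw [← h3 _ h.2] at hn
    rwa [(isInvariant_of_region G).whiteCorner_opp hA h]
  have hint' : ∀ h : C.HalfEdge, ¬ IsOver h.2 → ((⌊G (rg h) - c⌋ : ℤ) : ℚ) = G (rg h) - c := by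
    rintro ⟨x, i⟩ hi
    have h5 : ∃ n : ℤ, G (rg (x, i)) - c = n := by
      obtain ⟨n, hn⟩ := hint x
      have key : ∀ i : ZMod 4, ¬ IsOver i → i = 0 ∨ i = 2 := by decide
      have := key i hi
      rcases this with rfl | rfl
      · exact ⟨n, hn⟩
      · exact ⟨n - f x, by push_cast; linarith [hG' x]⟩
    obtain ⟨n, hn⟩ := h5
    rw [hn, Int.floor_intCast]
  -- The floor changes nothing at white corners. Black corners do not enter into white differences
  -- and get the value zero.
  refine ⟨fun h => if IsOver h.2 then 0 else ⌊G (rg h) - c⌋, fun h => ?_, funext fun x => ?_⟩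
  · have h6 := hA.alternating h
    have h7 : IsOver (right (C.opp h)).2 ↔ IsOver h.2 := by
      rw [right, isOver_sub_one, h6, not_not]
    simp only [h7, isInvariant_of_region G h]
  · have h8 := hint' (x, 0) (show ¬ IsOver 0 by decide)
    have h9 := hint' (x, 2) (show ¬ IsOver 2 by decide)
    rw [whiteDiff, if_neg (show ¬ IsOver 0 by decide), if_neg (show ¬ IsOver 2 by decide)]
    have h10 := hG' x
    have h11 : ((⌊G (rg (x, 0)) - c⌋ - ⌊G (rg (x, 2)) - c⌋ : ℤ) : ℚ) = f x := by
      push_cast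
      linarith
    exact_mod_cast h11

end DiagramCode

namespace AltDiagram

open DiagramCode

theorem isAlternating (D : AltDiagram) : D.toDiagramCode.IsAlternating := ⟨D.opp_opp, D.alternating⟩

theorem isConnected (D : AltDiagram) : D.toDiagramCode.IsConnected := by
  intro P hP x y hx
  induction D.connected x y with
  | refl => exact hx
  | tail _ h ih =>
    obtain ⟨i, j, hij⟩ := h
    have := hP _ (show P (_, i).1 from ih)
    rwa [hij] at this

theorem chessboardLattice_eq (D : AltDiagram) : D.chessboardLattice = D.flows := by
  classical
  ext f
  rw [chessboardLattice, mem_flowLattice_iff]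
  constructor
  · intro hf θ hθ
    obtain ⟨F, hF⟩ := hθ.exists_region
    rw [← hf fun r => F r.1]
    refine Finset.sum_congr rfl fun x _ => ?_
    rw [blackDiff, ← hF, ← hF]
    rfl
  · intro hf u
    rw [← hf _ (isInvariant_of_region fun r => if h : D.IsBlack r then u ⟨r, h⟩ else 0)]
    refine Finset.sum_congr rfl fun x _ => ?_
    rw [blackDiff, dif_pos (show D.IsBlack (rg (x, 3)) from Or.inr rfl),
      dif_pos (show D.IsBlack (rg (x, 1)) from Or.inl rfl)]
    rfl

theorem hasTwoCubeTilingLattice_iff (D : AltDiagram) :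
    D.HasTwoCubeTilingLattice ↔ IsTilingSubgroup D.flows := by
  rw [← chessboardLattice_eq]
  rfl

/-- A diagram from a connected alternating code on the sphere. -/
def ofCode (C : DiagramCode) (hA : C.IsAlternating) (hC : C.IsConnected)
    (hp : Nonempty C.Crossing → Nat.card C.Region = Fintype.card C.Crossing + 2) : AltDiagram where
  toDiagramCode := C
  opp_opp := hA.opp_opp
  opp_ne h heq := by
    have := hA.alternating h
    rw [heq] at this
    exact iff_not_self this
  connected x y := hC (fun y => Relation.ReflTransGen C.Adj x y)
    (fun h hx => hx.tail ⟨h.2, (C.opp h).2, rfl⟩) x y .refl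
  planar := hp
  alternating := hA.alternating

end AltDiagram

/-- The form of a tiling lattice determines that it is one. -/
theorem IsTilingSubgroup.of_surjective {E E' : Type} [Fintype E] [Fintype E']
    {L : AddSubgroup (E → ℤ)} {L' : AddSubgroup (E' → ℤ)} (h : IsTilingSubgroup L) (π : L' →+ L)
    (hπ : Function.Surjective π)
    (hform : ∀ a b, (π a : E → ℤ) ⬝ᵥ π b = (a : E' → ℤ) ⬝ᵥ b) : IsTilingSubgroup L' := by
  obtain ⟨ι, _, φ, hφ, ht⟩ := isTilingSubgroup_iff.1 h
  refine isTilingSubgroup_iff.2 ⟨ι, _, φ.comp π, fun a b => (hφ _ _).trans (hform a b), ?_⟩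
  rwa [AddMonoidHom.range_comp, AddMonoidHom.range_eq_top.2 hπ, ← AddMonoidHom.range_eq_map]

theorem isTilingSubgroup_sum_iff {E₁ E₂ : Type} [Fintype E₁] [Fintype E₂]
    {L : AddSubgroup (E₁ ⊕ E₂ → ℤ)} {L₁ : AddSubgroup (E₁ → ℤ)} {L₂ : AddSubgroup (E₂ → ℤ)}
    (hL : ∀ f, f ∈ L ↔ (fun e => f (.inl e)) ∈ L₁ ∧ (fun e => f (.inr e)) ∈ L₂) :
    IsTilingSubgroup L ↔ IsTilingSubgroup L₁ ∧ IsTilingSubgroup L₂ := by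
  let π₁ : L →+ L₁ := AddMonoidHom.mk' (fun f => ⟨_, ((hL f).1 f.2).1⟩) fun _ _ => rfl
  let π₂ : L →+ L₂ := AddMonoidHom.mk' (fun f => ⟨_, ((hL f).1 f.2).2⟩) fun _ _ => rfl
  have hsurj : ∀ f₁ f₂, ∃ f, π₁ f = f₁ ∧ π₂ f = f₂ := fun f₁ f₂ =>
    ⟨⟨Sum.elim f₁.1 f₂.1, (hL _).2 ⟨f₁.2, f₂.2⟩⟩, rfl, rfl⟩
  have hform : ∀ a b : L, (a : E₁ ⊕ E₂ → ℤ) ⬝ᵥ b =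
      (π₁ a : E₁ → ℤ) ⬝ᵥ π₁ b + (π₂ a : E₂ → ℤ) ⬝ᵥ π₂ b := fun a b => Fintype.sum_sum_type _
  constructor
  · intro h
    obtain ⟨ι, _, φ, hφ, ht⟩ := isTilingSubgroup_iff.1 h
    exact ⟨ht.isTilingSubgroup_of_orthogonal π₁ π₂ hsurj fun a b => (hφ a b).trans (hform a b),
      ht.isTilingSubgroup_of_orthogonal π₂ π₁
        (fun f₂ f₁ => (hsurj f₁ f₂).imp fun _ h => ⟨h.2, h.1⟩)
        fun a b => ((hφ a b).trans (hform a b)).trans (add_comm _ _)⟩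
  · rintro ⟨h₁, h₂⟩
    refine isTilingSubgroup_of_sum h₁ h₂ π₁ π₂ (0 : L →+ (Empty → ℤ)) (fun f₁ f₂ x => ?_)
      (fun _ _ _ _ _ _ _ => funext fun i => i.elim) fun a b => ?_
    · obtain ⟨f, h1, h2⟩ := hsurj f₁ f₂
      exact ⟨f, h1, h2, fun i => i.elim⟩
    · rw [hform]
      simp

/-! ### Morphisms and isomorphisms of codes -/

namespace DiagramCode

variable {C C' C₁ C₂ : DiagramCode} {α : Type*}

/-- A map of half-edges that respects edges and regions. -/
structure IsMorphism (F : C.HalfEdge → C'.HalfEdge) : Prop where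
  opp : ∀ h, C'.opp (F h) = F (C.opp h)
  rg_right : ∀ h, rg (right (F h)) = rg (F (right h))

namespace IsMorphism

variable {F : C.HalfEdge → C'.HalfEdge}

theorem isInvariant_rg (hF : IsMorphism F) : IsInvariant fun h => rg (F h) := fun h => by
  change rg (F (right (C.opp h))) = rg (F h)
  rw [← hF.rg_right, ← hF.opp]
  exact DiagramCode.isInvariant_rg (F h)

theorem rg_eq (hF : IsMorphism F) {h k : C.HalfEdge} (hk : rg h = rg k) : rg (F h) = rg (F k) :=
  hF.isInvariant_rg.eq_of_rg_eq hk

theorem comp (hF : IsMorphism F) {θ : C'.HalfEdge → α} (hθ : IsInvariant θ) :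
    IsInvariant fun h => θ (F h) := fun h => hθ.eq_of_rg_eq (hF.isInvariant_rg h)

theorem separatesEdges (hF : IsMorphism F) (hinj : Function.Injective F)
    (h : C'.SeparatesEdges) : C.SeparatesEdges := fun a b h1 h2 => hinj (h _ _ (hF.rg_eq h1) (by
  rw [hF.rg_right, hF.rg_right]
  exact hF.rg_eq h2))

end IsMorphism

namespace Iso

theorem symm (h : C.Iso C') : C'.Iso C := by
  obtain ⟨f, r, hr, hopp⟩ := h
  refine ⟨f.symm, fun y => -r (f.symm y), fun y => ?_, fun y i => ?_⟩
  · have key : ∀ a : ZMod 4, a = 0 ∨ a = 2 → -a = 0 ∨ -a = 2 := by decide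
    exact key _ (hr _)
  · obtain ⟨x, rfl⟩ := f.surjective y
    rw [f.symm_apply_apply]
    have h1 := hopp x (i + -r x)
    rw [neg_add_cancel_right] at h1
    rw [h1]
    simp

/-- The map of half-edges that belongs to an isomorphism. -/
def map (f : C.Crossing ≃ C'.Crossing) (r : C.Crossing → ZMod 4) (h : C.HalfEdge) : C'.HalfEdge :=
  (f h.1, h.2 + r h.1)

theorem map_bijective (f : C.Crossing ≃ C'.Crossing) (r : C.Crossing → ZMod 4) :
    Function.Bijective (map f r) := by
  constructor
  · rintro ⟨x, i⟩ ⟨y, j⟩ hxy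
    obtain ⟨h1, h2⟩ := Prod.ext_iff.1 hxy
    obtain rfl := f.injective h1
    exact congrArg (Prod.mk x) (add_right_cancel h2)
  · rintro ⟨y, j⟩
    refine ⟨(f.symm y, j - r (f.symm y)), Prod.ext (f.apply_symm_apply y) ?_⟩
    exact sub_add_cancel _ _

theorem right_map (f : C.Crossing ≃ C'.Crossing) (r : C.Crossing → ZMod 4) (h : C.HalfEdge) :
    right (map f r h) = map f r (right h) :=
  Prod.ext rfl (show h.2 + r h.1 - 1 = h.2 - 1 + r h.1 by ring)

theorem isMorphism {f : C.Crossing ≃ C'.Crossing} {r : C.Crossing → ZMod 4}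
    (h : ∀ x i, C'.opp (f x, i + r x) = (f (C.opp (x, i)).1, (C.opp (x, i)).2 + r (C.opp (x, i)).1)) :
    IsMorphism (map f r) where
  opp k := h k.1 k.2
  rg_right k := by rw [right_map]

theorem exists_comp {f : C.Crossing ≃ C'.Crossing} {r : C.Crossing → ZMod 4}
    (h : IsMorphism (map f r)) {θ : C.HalfEdge → α} (hθ : IsInvariant θ) :
    ∃ θ' : C'.HalfEdge → α, IsInvariant θ' ∧ ∀ k, θ' (map f r k) = θ k := by
  let e := Equiv.ofBijective _ (map_bijective f r)
  have he : ∀ k, e.symm (map f r k) = k := e.symm_apply_apply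
  refine ⟨fun k => θ (e.symm k), fun k => ?_, fun k => congrArg θ (he k)⟩
  obtain ⟨k, rfl⟩ := e.surjective k
  change θ (e.symm (right (C'.opp (map f r k)))) = θ (e.symm (map f r k))
  rw [h.opp, right_map, he, he]
  exact hθ k

theorem separatesEdges (h : C.Iso C') (hC : C'.SeparatesEdges) : C.SeparatesEdges := by
  obtain ⟨f, r, -, hopp⟩ := h
  exact (isMorphism hopp).separatesEdges (map_bijective f r).1 hC

theorem exists_region_eq (h : C.Iso C') {x : C.Crossing} {i : ZMod 4}
    (hx : C.region x i = C.region x (i + 2)) : ∃ y i, C'.region y i = C'.region y (i + 2) := by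
  obtain ⟨f, r, -, hopp⟩ := h
  refine ⟨f x, i + r x, ?_⟩
  rw [add_right_comm]
  exact (isMorphism hopp).rg_eq hx

/-- An isomorphism may turn a crossing by two steps, which exchanges its two black corners and
changes the sign of this coordinate. -/
theorem isTilingSubgroup (h : C.Iso C') (hC : IsTilingSubgroup C'.flows) :
    IsTilingSubgroup C.flows := by
  obtain ⟨f, r, hr, hopp⟩ := h
  have hm := isMorphism hopp
  let s : C.Crossing → ℤ := fun x => if r x = 0 then 1 else -1
  have hs : ∀ x, s x * s x = 1 := fun x => by simp only [s]; split_ifs <;> rfl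
  have hdiff : ∀ (θ : C'.HalfEdge → ℤ) x,
      blackDiff (fun k => θ (map f r k)) x = s x * blackDiff θ (f x) := by
    intro θ x
    simp only [blackDiff, map, s]
    rcases hr x with h | h <;> rw [h]
    · simp
    · rw [if_neg (by decide), show (3 + 2 : ZMod 4) = 1 from rfl, show (1 + 2 : ZMod 4) = 3 from rfl]
      ring
  let T : (C.Crossing → ℤ) → C'.Crossing → ℤ := fun g y => s (f.symm y) * g (f.symm y)
  have hT : ∀ g θ, T g ⬝ᵥ blackDiff θ = g ⬝ᵥ blackDiff fun k => θ (map f r k) := by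
    intro g θ
    rw [dotProduct, ← f.sum_comp]
    refine Finset.sum_congr rfl fun x _ => ?_
    rw [hdiff]
    simp only [T, f.symm_apply_apply]
    ring
  have hmem : ∀ g, T g ∈ C'.flows ↔ g ∈ C.flows := by
    intro g
    constructor
    · intro hg θ hθ
      obtain ⟨θ', h1, h2⟩ := exists_comp hm hθ
      rw [← hg θ' h1, hT]
      simp only [h2]
    · intro hg θ hθ
      rw [hT]
      exact hg _ (hm.comp hθ)
  refine hC.of_surjective (AddMonoidHom.mk' (fun g : C.flows => ⟨T g, (hmem g).2 g.2⟩) fun a b =>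
    Subtype.ext (funext fun y => mul_add _ _ _)) ?_ fun a b => ?_
  · rintro ⟨g, hg⟩
    have h1 : T (fun x => s x * g (f x)) = g := by
      ext y
      simp only [T, f.apply_symm_apply]
      rw [← mul_assoc, hs, one_mul]
    have h2 : T (fun x => s x * g (f x)) ∈ C'.flows := by rwa [h1]
    exact ⟨⟨fun x => s x * g (f x), (hmem _).1 h2⟩, Subtype.ext h1⟩
  · change T a ⬝ᵥ T b = _
    rw [dotProduct, ← f.sum_comp]
    refine Finset.sum_congr rfl fun x _ => ?_
    simp only [T, f.symm_apply_apply]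
    rw [mul_mul_mul_comm, hs, one_mul]

theorem card_region (h : C.Iso C') : Nat.card C.Region = Nat.card C'.Region := by
  have key : ∀ {C C' : DiagramCode}, C.Iso C' → Nat.card C'.Region ≤ Nat.card C.Region := by
    rintro C C' ⟨f, r, -, hopp⟩
    have hm := isMorphism hopp
    obtain ⟨F, hF⟩ := hm.isInvariant_rg.exists_region
    refine Nat.card_le_card_of_surjective F fun y => ?_
    obtain ⟨k, rfl⟩ := rg_surjective y
    obtain ⟨h, rfl⟩ := (map_bijective f r).2 k
    exact ⟨rg h, hF h⟩
  exact le_antisymm (key h.symm) (key h)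

end Iso

/-! ### Connected sums -/

section Splice

/-- A function that is equivariant for a permutation with the possible exception of one point has no
exception. -/
theorem eq_of_forall_ne {H : Type*} [Fintype H] {N : H → H} (hN : Function.Bijective N)
    {g : H → α} {a : H} (hg : ∀ x, x ≠ a → g (N x) = g x) : g (N a) = g a := by
  classical
  let F : H → ℕ := fun x => if g x = g a then 1 else 0
  have h1 : ∑ x, F (N x) = ∑ x, F x := hN.sum_comp F
  rw [← Finset.add_sum_erase _ _ (Finset.mem_univ a),
    ← Finset.add_sum_erase _ (fun x => F x) (Finset.mem_univ a),
    Finset.sum_congr rfl fun x hx => show F (N x) = F x by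
      simp only [F, hg x (Finset.ne_of_mem_erase hx)]] at h1
  have h2 := add_right_cancel h1
  by_contra h3
  simp [F, h3] at h2

theorem right_bijective : Function.Bijective (right (C := C)) := by
  refine Function.bijective_iff_has_inverse.2 ⟨fun h => (h.1, h.2 + 1), fun h => ?_, fun h => ?_⟩ <;>
  · apply Prod.ext
    · rfl
    · simp [right]

theorem IsAlternating.next_bijective (hA : C.IsAlternating) :
    Function.Bijective fun h => right (C.opp h) :=
  right_bijective.comp (Function.Involutive.bijective hA.opp_opp)

theorem IsAlternating.isOver_next (hA : C.IsAlternating) (h : C.HalfEdge) :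
    IsOver (right (C.opp h)).2 ↔ IsOver h.2 := by
  change IsOver ((C.opp h).2 - 1) ↔ _
  rw [isOver_sub_one, hA.alternating, not_not]

/-- A function that is constant on the black and on the white corners. -/
def checker (b w : α) (h : C.HalfEdge) : α := if IsOver h.2 then b else w

theorem IsAlternating.isInvariant_checker (hA : C.IsAlternating) (b w : α) :
    IsInvariant (checker (C := C) b w) := fun h => by
  simp only [checker, hA.isOver_next]

/-- Going to the next corner preserves the color. The exceptions `a` and `C.opp a` have different
colors, so each color has a single exception, and `eq_of_forall_ne` removes it. -/
theorem IsInvariant.of_ne_opp (hA : C.IsAlternating) {a : C.HalfEdge} (ha : IsOver a.2)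
    {θ : C.HalfEdge → α} (hθ : ∀ h, h ≠ a → h ≠ C.opp a → θ (right (C.opp h)) = θ h) :
    IsInvariant θ := by
  have ha' : ¬ IsOver (C.opp a).2 := by rw [hA.alternating]; exact not_not.2 ha
  have hb : ∀ h, h ≠ a → (if IsOver (right (C.opp h)).2 then some (θ (right (C.opp h))) else none) =
      if IsOver h.2 then some (θ h) else none := by
    intro h hh
    simp only [hA.isOver_next]
    by_cases ho : IsOver h.2
    · rw [if_pos ho, if_pos ho, hθ h hh]
      rintro rfl
      exact ha' ho
    · rw [if_neg ho, if_neg ho]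
  have hw : ∀ h, h ≠ C.opp a →
      (if IsOver (right (C.opp h)).2 then none else some (θ (right (C.opp h)))) =
      if IsOver h.2 then none else some (θ h) := by
    intro h hh
    simp only [hA.isOver_next]
    by_cases ho : IsOver h.2
    · rw [if_pos ho, if_pos ho]
    · rw [if_neg ho, if_neg ho, hθ h _ hh]
      rintro rfl
      exact ho ha
  intro h
  by_cases h1 : h = a
  · subst h1
    have := eq_of_forall_ne (g := fun h : C.HalfEdge => if IsOver h.2 then some (θ h) else none)
      hA.next_bijective hb
    simpa only [hA.isOver_next, if_pos ha, Option.some.injEq] using this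
  by_cases h2 : h = C.opp a
  · subst h2
    have := eq_of_forall_ne (g := fun h : C.HalfEdge => if IsOver h.2 then none else some (θ h))
      hA.next_bijective hw
    simpa only [hA.isOver_next, if_neg ha', Option.some.injEq] using this
  · exact hθ h h1 h2

/-- The half-edges of the first summand. -/
def spliceLeft {h₁ : C₁.HalfEdge} {h₂ : C₂.HalfEdge} (h : C₁.HalfEdge) :
    (C₁.splice C₂ h₁ h₂).HalfEdge := (.inl h.1, h.2)

/-- The half-edges of the second summand. -/
def spliceRight {h₁ : C₁.HalfEdge} {h₂ : C₂.HalfEdge} (h : C₂.HalfEdge) :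
    (C₁.splice C₂ h₁ h₂).HalfEdge := (.inr h.1, h.2)

variable {h₁ : C₁.HalfEdge} {h₂ : C₂.HalfEdge}

theorem splice_cases {P : (C₁.splice C₂ h₁ h₂).HalfEdge → Prop} (hl : ∀ h, P (spliceLeft h))
    (hr : ∀ h, P (spliceRight h)) : ∀ h, P h := by
  rintro ⟨x | x, i⟩
  · exact hl (x, i)
  · exact hr (x, i)

theorem splice_opp_left (h : C₁.HalfEdge) : (C₁.splice C₂ h₁ h₂).opp (spliceLeft h) =
    if h = h₁ then spliceRight (C₂.opp h₂) else if h = C₁.opp h₁ then spliceRight h₂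
    else spliceLeft (C₁.opp h) := rfl

theorem splice_opp_right (h : C₂.HalfEdge) : (C₁.splice C₂ h₁ h₂).opp (spliceRight h) =
    if h = h₂ then spliceLeft (C₁.opp h₁) else if h = C₂.opp h₂ then spliceLeft h₁
    else spliceRight (C₂.opp h) := rfl

/-- Splicing alters the two chosen edges only, so it merely identifies the regions on the two sides
of these edges. -/
theorem isInvariant_splice_iff (hA₁ : C₁.IsAlternating) (hA₂ : C₂.IsAlternating)
    (ho₁ : IsOver h₁.2) (ho₂ : IsOver h₂.2) {θ : (C₁.splice C₂ h₁ h₂).HalfEdge → α} :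
    IsInvariant θ ↔ IsInvariant (fun h => θ (spliceLeft h)) ∧ IsInvariant (fun h => θ (spliceRight h)) ∧
      θ (spliceLeft h₁) = θ (spliceRight h₂) ∧
      θ (spliceLeft (right h₁)) = θ (spliceRight (right h₂)) := by
  have hne₁ : C₁.opp h₁ ≠ h₁ := fun h => iff_not_self (h ▸ hA₁.alternating h₁)
  have hne₂ : C₂.opp h₂ ≠ h₂ := fun h => iff_not_self (h ▸ hA₂.alternating h₂)
  constructor
  · intro hθ
    have hl : IsInvariant fun h => θ (spliceLeft h) := by
      refine IsInvariant.of_ne_opp hA₁ ho₁ fun h h1 h2 => ?_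
      have := hθ (spliceLeft h)
      rwa [splice_opp_left, if_neg h1, if_neg h2] at this
    have hr : IsInvariant fun h => θ (spliceRight h) := by
      refine IsInvariant.of_ne_opp hA₂ ho₂ fun h h1 h2 => ?_
      have := hθ (spliceRight h)
      rwa [splice_opp_right, if_neg h1, if_neg h2] at this
    refine ⟨hl, hr, ?_, ?_⟩
    · have h3 := hθ (spliceLeft h₁)
      rw [splice_opp_left, if_pos rfl] at h3
      exact h3.symm.trans (hr h₂)
    · have h3 := hθ (spliceLeft (C₁.opp h₁))
      rw [splice_opp_left, if_neg hne₁, if_pos rfl] at h3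
      exact (hl.right_eq hA₁ h₁).trans h3.symm
  · rintro ⟨hl, hr, h3, h4⟩
    refine splice_cases (fun h => ?_) fun h => ?_
    · rw [splice_opp_left]
      split_ifs with h1 h2
      · subst h1
        exact (hr h₂).trans h3.symm
      · subst h2
        exact h4.symm.trans (hl.right_eq hA₁ h₁)
      · exact hl h
    · rw [splice_opp_right]
      split_ifs with h1 h2
      · subst h1
        exact (hl h₁).trans h3
      · subst h2
        exact h4.trans (hr.right_eq hA₂ h₂)
      · exact hr h

/-- An invariant function on a connected sum from its two parts. -/
theorem exists_invariant_splice (hA₁ : C₁.IsAlternating) (hA₂ : C₂.IsAlternating)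
    (ho₁ : IsOver h₁.2) (ho₂ : IsOver h₂.2) {θ₁ : C₁.HalfEdge → α} {θ₂ : C₂.HalfEdge → α}
    (hθ₁ : IsInvariant θ₁) (hθ₂ : IsInvariant θ₂) (hb : θ₁ h₁ = θ₂ h₂)
    (hw : θ₁ (right h₁) = θ₂ (right h₂)) : ∃ θ : (C₁.splice C₂ h₁ h₂).HalfEdge → α,
      IsInvariant θ ∧ (∀ h, θ (spliceLeft h) = θ₁ h) ∧ ∀ h, θ (spliceRight h) = θ₂ h :=
  ⟨fun h => Sum.elim (fun x => θ₁ (x, h.2)) (fun x => θ₂ (x, h.2)) h.1,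
    (isInvariant_splice_iff hA₁ hA₂ ho₁ ho₂).2 ⟨hθ₁, hθ₂, hb, hw⟩, fun _ => rfl, fun _ => rfl⟩

theorem isOver_right {h : C.HalfEdge} : IsOver (right h).2 ↔ ¬ IsOver h.2 := isOver_sub_one h.2

theorem exists_invariant_splice_left (hA₁ : C₁.IsAlternating) (hA₂ : C₂.IsAlternating)
    (ho₁ : IsOver h₁.2) (ho₂ : IsOver h₂.2) {θ₁ : C₁.HalfEdge → α} (hθ₁ : IsInvariant θ₁) :
    ∃ θ : (C₁.splice C₂ h₁ h₂).HalfEdge → α, IsInvariant θ ∧ (∀ h, θ (spliceLeft h) = θ₁ h) ∧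
      ∀ h, θ (spliceRight h) = checker (θ₁ h₁) (θ₁ (right h₁)) h :=
  exists_invariant_splice hA₁ hA₂ ho₁ ho₂ hθ₁ (hA₂.isInvariant_checker _ _) (if_pos ho₂).symm
    (if_neg fun h => isOver_right.1 h ho₂).symm

theorem exists_invariant_splice_right (hA₁ : C₁.IsAlternating) (hA₂ : C₂.IsAlternating)
    (ho₁ : IsOver h₁.2) (ho₂ : IsOver h₂.2) {θ₂ : C₂.HalfEdge → α} (hθ₂ : IsInvariant θ₂) :
    ∃ θ : (C₁.splice C₂ h₁ h₂).HalfEdge → α, IsInvariant θ ∧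
      (∀ h, θ (spliceLeft h) = checker (θ₂ h₂) (θ₂ (right h₂)) h) ∧
      ∀ h, θ (spliceRight h) = θ₂ h :=
  exists_invariant_splice hA₁ hA₂ ho₁ ho₂ (hA₁.isInvariant_checker _ _) hθ₂ (if_pos ho₁)
    (if_neg fun h => isOver_right.1 h ho₁)

/-- An invariant function on one summand extends to the other one by constants on black and on
white, which have no differences. So the flow conditions are those of the two summands. -/
theorem isTilingSubgroup_splice_iff (hA₁ : C₁.IsAlternating) (hA₂ : C₂.IsAlternating)
    (ho₁ : IsOver h₁.2) (ho₂ : IsOver h₂.2) : IsTilingSubgroup (C₁.splice C₂ h₁ h₂).flows ↔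
      IsTilingSubgroup C₁.flows ∧ IsTilingSubgroup C₂.flows := by
  have hsum : ∀ (f : (C₁.splice C₂ h₁ h₂).Crossing → ℤ) (θ : (C₁.splice C₂ h₁ h₂).HalfEdge → ℤ),
      f ⬝ᵥ blackDiff θ = (fun x => f (.inl x)) ⬝ᵥ blackDiff (fun h => θ (spliceLeft h)) +
        (fun x => f (.inr x)) ⬝ᵥ blackDiff (fun h => θ (spliceRight h)) := fun f θ =>
    Fintype.sum_sum_type _
  refine isTilingSubgroup_sum_iff fun f => ⟨fun hf => ⟨fun θ hθ => ?_, fun θ hθ => ?_⟩, ?_⟩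
  · obtain ⟨θ', h1, h2, h3⟩ := exists_invariant_splice_left hA₁ hA₂ ho₁ ho₂ hθ
    have h4 := (hsum f θ').symm.trans (hf θ' h1)
    simp only [h2, h3] at h4
    rw [← h4, eq_comm, add_eq_left]
    exact Finset.sum_eq_zero fun x _ => mul_eq_zero_of_right _ (sub_self (θ h₁))
  · obtain ⟨θ', h1, h2, h3⟩ := exists_invariant_splice_right hA₁ hA₂ ho₁ ho₂ hθ
    have h4 := (hsum f θ').symm.trans (hf θ' h1)
    simp only [h2, h3] at h4
    rw [← h4, eq_comm, add_eq_right]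
    exact Finset.sum_eq_zero fun x _ => mul_eq_zero_of_right _ (sub_self (θ h₂))
  · rintro ⟨hf₁, hf₂⟩ θ hθ
    obtain ⟨h1, h2, -, -⟩ := (isInvariant_splice_iff hA₁ hA₂ ho₁ ho₂).1 hθ
    exact (hsum f θ).trans (by rw [hf₁ _ h1, hf₂ _ h2, add_zero])

theorem rg_spliceLeft_iff (hA₁ : C₁.IsAlternating) (hA₂ : C₂.IsAlternating)
    (ho₁ : IsOver h₁.2) (ho₂ : IsOver h₂.2) {h k : C₁.HalfEdge} :
    rg (spliceLeft h : (C₁.splice C₂ h₁ h₂).HalfEdge) = rg (spliceLeft k) ↔ rg h = rg k := by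
  constructor
  · intro hk
    obtain ⟨θ, h1, h2, -⟩ := exists_invariant_splice_left hA₁ hA₂ ho₁ ho₂ isInvariant_rg
    rw [← h2, ← h2]
    exact h1.eq_of_rg_eq hk
  · exact ((isInvariant_splice_iff hA₁ hA₂ ho₁ ho₂).1 isInvariant_rg).1.eq_of_rg_eq

theorem rg_spliceRight_iff (hA₁ : C₁.IsAlternating) (hA₂ : C₂.IsAlternating)
    (ho₁ : IsOver h₁.2) (ho₂ : IsOver h₂.2) {h k : C₂.HalfEdge} :
    rg (spliceRight h : (C₁.splice C₂ h₁ h₂).HalfEdge) = rg (spliceRight k) ↔ rg h = rg k := by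
  constructor
  · intro hk
    obtain ⟨θ, h1, -, h2⟩ := exists_invariant_splice_right hA₁ hA₂ ho₁ ho₂ isInvariant_rg
    rw [← h2, ← h2]
    exact h1.eq_of_rg_eq hk
  · exact ((isInvariant_splice_iff hA₁ hA₂ ho₁ ho₂).1 isInvariant_rg).2.1.eq_of_rg_eq

/-- The two edges that connect the summands lie between the same two regions. -/
theorem not_separatesEdges_splice (hA₁ : C₁.IsAlternating) (hA₂ : C₂.IsAlternating)
    (ho₁ : IsOver h₁.2) (ho₂ : IsOver h₂.2) : ¬ (C₁.splice C₂ h₁ h₂).SeparatesEdges := by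
  intro h
  obtain ⟨-, -, h3, h4⟩ := (isInvariant_splice_iff hA₁ hA₂ ho₁ ho₂).1
    (isInvariant_rg (C := C₁.splice C₂ h₁ h₂))
  have h5 := congrArg Prod.fst (h _ _ h3 h4)
  exact Sum.inl_ne_inr h5

theorem rg_ne_rg_right (hA : C.IsAlternating) (h : C.HalfEdge) : rg h ≠ rg (right h) := fun hk => by
  have := IsInvariant.isOver_iff hA hk
  rw [isOver_right] at this
  exact iff_not_self this

/-- All but two regions of the second summand are counted anew. The inequality suffices, since
Euler's inequality for the summands gives the other direction. -/
theorem card_region_splice (hA₁ : C₁.IsAlternating) (hA₂ : C₂.IsAlternating)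
    (ho₁ : IsOver h₁.2) (ho₂ : IsOver h₂.2) :
    Nat.card (C₁.splice C₂ h₁ h₂).Region + 2 ≤ Nat.card C₁.Region + Nat.card C₂.Region := by
  classical
  have := Fintype.ofFinite C₁.Region
  have := Fintype.ofFinite C₂.Region
  have := Fintype.ofFinite (C₁.splice C₂ h₁ h₂).Region
  obtain ⟨h1, h2, h3, h4⟩ := (isInvariant_splice_iff hA₁ hA₂ ho₁ ho₂).1
    (isInvariant_rg (C := C₁.splice C₂ h₁ h₂))
  obtain ⟨F₁, hF₁⟩ := h1.exists_region
  obtain ⟨F₂, hF₂⟩ := h2.exists_region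
  let S : Finset C₂.Region := Finset.univ \ {rg h₂, rg (right h₂)}
  have hS : S.card + 2 = Fintype.card C₂.Region := by
    rw [← Finset.card_pair (rg_ne_rg_right hA₂ h₂),
      Finset.card_sdiff_add_card_eq_card (Finset.subset_univ _), Finset.card_univ]
  have hle : Fintype.card (C₁.splice C₂ h₁ h₂).Region ≤ Fintype.card (C₁.Region ⊕ S) := by
    refine Fintype.card_le_of_surjective (Sum.elim F₁ fun r => F₂ r.1) fun r => ?_
    obtain ⟨k, rfl⟩ := rg_surjective r
    revert k
    refine splice_cases (fun k => ⟨.inl (rg k), hF₁ k⟩) fun k => ?_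
    by_cases hk : rg k ∈ S
    · exact ⟨.inr ⟨rg k, hk⟩, hF₂ k⟩
    · have hk' : rg k = rg h₂ ∨ rg k = rg (right h₂) := by simpa [S, imp_iff_not_or, or_comm] using hk
      rcases hk' with hk | hk
      · exact ⟨.inl (rg h₁), (hF₁ _).trans (h3.trans ((hF₂ _).symm.trans (hk ▸ hF₂ k)))⟩
      · exact ⟨.inl (rg (right h₁)), (hF₁ _).trans (h4.trans ((hF₂ _).symm.trans (hk ▸ hF₂ k)))⟩
  rw [Fintype.card_sum, Fintype.card_coe] at hle
  simp only [Nat.card_eq_fintype_card]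
  omega

end Splice

end DiagramCode

/-! ### Compositions -/

namespace DiagramCode

variable {C C₁ C₂ : DiagramCode} {α : Type*}

section Compose

variable {c₁ : C₁.Crossing} {c₂ : C₂.Crossing} {s : ZMod 4}

/-- A half-edge at a new crossing of a composition. -/
def circle (p i : ZMod 4) : (C₁.compose C₂ c₁ c₂ s).HalfEdge := (.inr (.inr p), i)

/-- A half-edge at a crossing of the first tangle of a composition. -/
def innerLeft (x : {x // x ≠ c₁}) (i : ZMod 4) : (C₁.compose C₂ c₁ c₂ s).HalfEdge := (.inl x, i)

/-- A half-edge at a crossing of the second tangle of a composition. -/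
def innerRight (x : {x // x ≠ c₂}) (i : ZMod 4) : (C₁.compose C₂ c₁ c₂ s).HalfEdge :=
  (.inr (.inl x), i)

/-- The half-edges of the first diagram in a composition. -/
def leftMap (h : C₁.HalfEdge) : (C₁.compose C₂ c₁ c₂ s).HalfEdge := composeLeft C₁ C₂ c₁ c₂ h

/-- The half-edges of the second diagram in a composition. -/
def rightMap (h : C₂.HalfEdge) : (C₁.compose C₂ c₁ c₂ s).HalfEdge := composeRight C₁ C₂ c₁ c₂ s h

theorem leftMap_self (p : ZMod 4) :
    (leftMap (c₁, p) : (C₁.compose C₂ c₁ c₂ s).HalfEdge) = circle p p := dif_pos rfl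

theorem leftMap_ne (x : {x // x ≠ c₁}) (p : ZMod 4) :
    (leftMap (x.1, p) : (C₁.compose C₂ c₁ c₂ s).HalfEdge) = innerLeft x p := dif_neg x.2

theorem rightMap_self (q : ZMod 4) :
    (rightMap (c₂, q) : (C₁.compose C₂ c₁ c₂ s).HalfEdge) = circle (s - q) (s - q + 2) :=
  dif_pos rfl

theorem rightMap_ne (x : {x // x ≠ c₂}) (p : ZMod 4) :
    (rightMap (x.1, p) : (C₁.compose C₂ c₁ c₂ s).HalfEdge) = innerRight x p := dif_neg x.2

theorem right_circle (p i : ZMod 4) :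
    right (circle p i : (C₁.compose C₂ c₁ c₂ s).HalfEdge) = circle p (i - 1) := rfl

theorem right_innerLeft (x : {x // x ≠ c₁}) (i : ZMod 4) :
    right (innerLeft x i : (C₁.compose C₂ c₁ c₂ s).HalfEdge) = innerLeft x (i - 1) := rfl

theorem right_innerRight (x : {x // x ≠ c₂}) (i : ZMod 4) :
    right (innerRight x i : (C₁.compose C₂ c₁ c₂ s).HalfEdge) = innerRight x (i - 1) := rfl

theorem right_mk (x : C.Crossing) (i : ZMod 4) : right ((x, i) : C.HalfEdge) = (x, i - 1) := rfl

theorem leftMap_injective :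
    Function.Injective (leftMap : C₁.HalfEdge → (C₁.compose C₂ c₁ c₂ s).HalfEdge) := by
  let G : (C₁.compose C₂ c₁ c₂ s).HalfEdge → C₁.HalfEdge := fun h =>
    (Sum.elim (·.1) (fun _ => c₁) (show ComposeCrossing C₁ C₂ c₁ c₂ from h.1), h.2)
  refine Function.LeftInverse.injective (g := G) ?_
  rintro ⟨x, i⟩
  by_cases hx : x = c₁
  · subst hx
    rw [leftMap_self]
    rfl
  · rw [leftMap_ne ⟨x, hx⟩]
    rfl

theorem rightMap_injective :
    Function.Injective (rightMap : C₂.HalfEdge → (C₁.compose C₂ c₁ c₂ s).HalfEdge) := by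
  let G : (C₁.compose C₂ c₁ c₂ s).HalfEdge → C₂.HalfEdge := fun h =>
    Sum.elim (fun _ => (c₂, 0)) (Sum.elim (fun x => (x.1, h.2)) fun p => (c₂, s - p))
      (show ComposeCrossing C₁ C₂ c₁ c₂ from h.1)
  refine Function.LeftInverse.injective (g := G) ?_
  rintro ⟨x, i⟩
  by_cases hx : x = c₂
  · subst hx
    rw [rightMap_self]
    exact congrArg (Prod.mk x) (sub_sub_cancel s i)
  · rw [rightMap_ne ⟨x, hx⟩]
    rfl

theorem opp_leftMap (h : C₁.HalfEdge) :
    (C₁.compose C₂ c₁ c₂ s).opp (leftMap h) = leftMap (C₁.opp h) := by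
  obtain ⟨x, i⟩ := h
  by_cases hx : x = c₁
  · subst hx
    rw [leftMap_self]
    exact if_pos rfl
  · rw [leftMap_ne ⟨x, hx⟩]
    rfl

theorem opp_circle_next (p : ZMod 4) :
    (C₁.compose C₂ c₁ c₂ s).opp (circle p (p + 1)) = circle (p + 1) p := by
  have h1 : ∀ p : ZMod 4, p + 1 ≠ p := by decide
  exact (if_neg (h1 p)).trans (if_pos rfl)

theorem opp_circle_prev (p : ZMod 4) :
    (C₁.compose C₂ c₁ c₂ s).opp (circle p (p - 1)) = circle (p - 1) p := by
  have h1 : ∀ p : ZMod 4, p - 1 ≠ p := by decide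
  have h2 : ∀ p : ZMod 4, p - 1 ≠ p + 1 := by decide
  have h3 : ∀ p : ZMod 4, p - 1 ≠ p + 2 := by decide
  exact (if_neg (h1 p)).trans ((if_neg (h2 p)).trans (if_neg (h3 p)))

theorem opp_rightMap (h : C₂.HalfEdge) :
    (C₁.compose C₂ c₁ c₂ s).opp (rightMap h) = rightMap (C₂.opp h) := by
  obtain ⟨x, i⟩ := h
  by_cases hx : x = c₂
  · subst hx
    rw [rightMap_self]
    have h1 : ∀ p : ZMod 4, p + 2 ≠ p := by decide
    have h2 : ∀ p : ZMod 4, p + 2 ≠ p + 1 := by decide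
    refine (if_neg (h1 _)).trans ((if_neg (h2 _)).trans ((if_pos rfl).trans ?_))
    rw [sub_sub_cancel]
    rfl
  · rw [rightMap_ne ⟨x, hx⟩]
    rfl

theorem compose_cases_crossing {P : (C₁.compose C₂ c₁ c₂ s).HalfEdge → Prop}
    (hl : ∀ x i, P (innerLeft x i)) (hr : ∀ x i, P (innerRight x i)) (hn : ∀ p i, P (circle p i)) :
    ∀ h, P h := by
  rintro ⟨x | x | p, i⟩
  · exact hl x i
  · exact hr x i
  · exact hn p i

theorem compose_cases {P : (C₁.compose C₂ c₁ c₂ s).HalfEdge → Prop}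
    (hl : ∀ h, P (leftMap h)) (hr : ∀ h, P (rightMap h))
    (hn : ∀ p, P (circle p (p + 1))) (hp : ∀ p, P (circle p (p - 1))) : ∀ h, P h := by
  refine compose_cases_crossing (fun x i => ?_) (fun x i => ?_) fun p i => ?_
  · rw [← leftMap_ne]
    exact hl _
  · rw [← rightMap_ne]
    exact hr _
  · have key : ∀ p i : ZMod 4, i = p ∨ i = p + 1 ∨ i = p + 2 ∨ i = p - 1 := by decide
    rcases key p i with rfl | rfl | rfl | rfl
    · rw [← leftMap_self]
      exact hl _
    · exact hn p
    · have := hr (c₂, s - p)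
      rwa [rightMap_self, sub_sub_cancel] at this
    · exact hp p

variable {θ : (C₁.compose C₂ c₁ c₂ s).HalfEdge → α}

theorem IsInvariant.circle_prev (hθ : IsInvariant θ) (p : ZMod 4) :
    θ (circle p (p - 1)) = θ (leftMap (c₁, p - 1)) := by
  rw [← hθ, opp_circle_prev, leftMap_self, right_circle]

theorem IsInvariant.circle_next (hθ : IsInvariant θ) (p : ZMod 4) :
    θ (circle p (p + 1)) = θ (rightMap (c₂, s - (p + 1))) := by
  have key : ∀ p : ZMod 4, p - 1 = p + 1 + 2 := by decide
  rw [← hθ, opp_circle_next, rightMap_self, sub_sub_cancel, ← key, right_circle]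

theorem isMorphism_leftMap :
    IsMorphism (leftMap : C₁.HalfEdge → (C₁.compose C₂ c₁ c₂ s).HalfEdge) where
  opp := opp_leftMap
  rg_right := by
    rintro ⟨x, i⟩
    by_cases hx : x = c₁
    · subst hx
      rw [leftMap_self]
      exact isInvariant_rg.circle_prev i
    · rw [leftMap_ne ⟨x, hx⟩, right_mk x, leftMap_ne ⟨x, hx⟩, right_innerLeft]

theorem isMorphism_rightMap :
    IsMorphism (rightMap : C₂.HalfEdge → (C₁.compose C₂ c₁ c₂ s).HalfEdge) where
  opp := opp_rightMap
  rg_right := by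
    rintro ⟨x, i⟩
    by_cases hx : x = c₂
    · subst hx
      rw [rightMap_self, right_circle, show s - i + 2 - 1 = s - i + 1 by ring, right_mk x]
      refine (isInvariant_rg.circle_next (s - i)).trans ?_
      rw [show s - (s - i + 1) = i - 1 by ring]
    · rw [rightMap_ne ⟨x, hx⟩, right_mk x, rightMap_ne ⟨x, hx⟩, right_innerRight]

/-- An invariant function on a composition from its two parts. -/
theorem exists_invariant_compose (c₁ : C₁.Crossing) (c₂ : C₂.Crossing) (s : ZMod 4)
    {θ₁ : C₁.HalfEdge → α} {θ₂ : C₂.HalfEdge → α} (h₁ : IsInvariant θ₁) (h₂ : IsInvariant θ₂) :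
    ∃ θ : (C₁.compose C₂ c₁ c₂ s).HalfEdge → α, IsInvariant θ ∧
      (∀ h, θ (leftMap h) = θ₁ h) ∧ ∀ h, θ (rightMap h) = θ₂ h := by
  let g : ZMod 4 → ZMod 4 → α := fun p i => if i = p then θ₁ (c₁, p)
    else if i = p + 1 then θ₂ (c₂, s - (p + 1)) else if i = p + 2 then θ₂ (c₂, s - p)
    else θ₁ (c₁, p - 1)
  have g0 : ∀ p, g p p = θ₁ (c₁, p) := fun p => if_pos rfl
  have k1 : ∀ p : ZMod 4, p + 1 ≠ p := by decide
  have k2 : ∀ p : ZMod 4, p + 2 ≠ p := by decide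
  have k3 : ∀ p : ZMod 4, p + 2 ≠ p + 1 := by decide
  have k4 : ∀ p : ZMod 4, p - 1 ≠ p := by decide
  have k5 : ∀ p : ZMod 4, p - 1 ≠ p + 1 := by decide
  have k6 : ∀ p : ZMod 4, p - 1 ≠ p + 2 := by decide
  have g1 : ∀ p, g p (p + 1) = θ₂ (c₂, s - (p + 1)) := fun p => (if_neg (k1 p)).trans (if_pos rfl)
  have g2 : ∀ p, g p (p + 2) = θ₂ (c₂, s - p) := fun p =>
    (if_neg (k2 p)).trans ((if_neg (k3 p)).trans (if_pos rfl))
  have g3 : ∀ p, g p (p - 1) = θ₁ (c₁, p - 1) := fun p =>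
    (if_neg (k4 p)).trans ((if_neg (k5 p)).trans (if_neg (k6 p)))
  clear_value g
  let θ : (C₁.compose C₂ c₁ c₂ s).HalfEdge → α := fun h => Sum.elim (fun x => θ₁ (x.1, h.2))
    (Sum.elim (fun x => θ₂ (x.1, h.2)) fun p => g p h.2)
      (show ComposeCrossing C₁ C₂ c₁ c₂ from h.1)
  have hil : ∀ x i, θ (innerLeft x i) = θ₁ (x.1, i) := fun _ _ => rfl
  have hir : ∀ x i, θ (innerRight x i) = θ₂ (x.1, i) := fun _ _ => rfl
  have hc : ∀ p i, θ (circle p i) = g p i := fun _ _ => rfl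
  clear_value θ
  have hl : ∀ h, θ (leftMap h) = θ₁ h := by
    rintro ⟨x, i⟩
    by_cases hx : x = c₁
    · subst hx
      rw [leftMap_self, hc, g0]
    · rw [leftMap_ne ⟨x, hx⟩, hil]
  have hr : ∀ h, θ (rightMap h) = θ₂ h := by
    rintro ⟨x, i⟩
    by_cases hx : x = c₂
    · subst hx
      rw [rightMap_self, hc, g2, sub_sub_cancel]
    · rw [rightMap_ne ⟨x, hx⟩, hir]
  have hlr : ∀ h, θ (right (leftMap h)) = θ₁ (right h) := by
    rintro ⟨x, i⟩
    by_cases hx : x = c₁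
    · subst hx
      rw [leftMap_self, right_circle, hc, g3, right_mk]
    · rw [leftMap_ne ⟨x, hx⟩, right_innerLeft, hil, right_mk]
  have hrr : ∀ h, θ (right (rightMap h)) = θ₂ (right h) := by
    rintro ⟨x, i⟩
    by_cases hx : x = c₂
    · subst hx
      rw [rightMap_self, right_circle, hc, show s - i + 2 - 1 = s - i + 1 by ring, g1,
        show s - (s - i + 1) = i - 1 by ring, right_mk]
    · rw [rightMap_ne ⟨x, hx⟩, right_innerRight, hir, right_mk]
  refine ⟨θ, ?_, hl, hr⟩
  refine compose_cases (fun h => ?_) (fun h => ?_) (fun p => ?_) fun p => ?_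
  · rw [opp_leftMap, hlr, hl]
    exact h₁ h
  · rw [opp_rightMap, hrr, hr]
    exact h₂ h
  · have key : ∀ p : ZMod 4, p - 1 = p + 1 + 2 := by decide
    rw [opp_circle_next, right_circle, hc, hc, g1, key, g2]
  · rw [opp_circle_prev, right_circle, hc, hc, g3, g0]

/-- Every corner at the new circle belongs to a region of one of the two diagrams. -/
theorem card_region_compose :
    Nat.card (C₁.compose C₂ c₁ c₂ s).Region ≤ Nat.card C₁.Region + Nat.card C₂.Region := by
  obtain ⟨F₁, hF₁⟩ :=
    (isMorphism_leftMap (C₁ := C₁) (C₂ := C₂) (c₁ := c₁) (c₂ := c₂) (s := s)).isInvariant_rg.exists_region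
  obtain ⟨F₂, hF₂⟩ :=
    (isMorphism_rightMap (C₁ := C₁) (C₂ := C₂) (c₁ := c₁) (c₂ := c₂) (s := s)).isInvariant_rg.exists_region
  rw [← Nat.card_sum]
  refine Nat.card_le_card_of_surjective (Sum.elim F₁ F₂) fun r => ?_
  obtain ⟨k, rfl⟩ := rg_surjective r
  revert k
  refine compose_cases (fun h => ⟨.inl (rg h), hF₁ h⟩) (fun h => ⟨.inr (rg h), hF₂ h⟩)
    (fun p => ⟨.inr (rg (c₂, s - (p + 1))), ?_⟩) fun p => ⟨.inl (rg (c₁, p - 1)), ?_⟩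
  · rw [isInvariant_rg.circle_next]
    exact hF₂ _
  · rw [isInvariant_rg.circle_prev]
    exact hF₁ _

theorem rg_leftMap_iff {h k : C₁.HalfEdge} :
    (rg (leftMap h : (C₁.compose C₂ c₁ c₂ s).HalfEdge) = rg (leftMap k)) ↔
      rg h = rg k := by
  refine ⟨fun hk => rg_eq_iff.2 fun θ₁ hθ₁ => ?_, isMorphism_leftMap.rg_eq⟩
  obtain ⟨θ, h1, h2, -⟩ := exists_invariant_compose c₁ c₂ s hθ₁
    (show IsInvariant fun _ : C₂.HalfEdge => 0 from fun _ => rfl)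
  rw [← h2, ← h2]
  exact h1.eq_of_rg_eq hk

theorem rg_rightMap_iff {h k : C₂.HalfEdge} :
    (rg (rightMap h : (C₁.compose C₂ c₁ c₂ s).HalfEdge) =
      rg (rightMap k)) ↔ rg h = rg k := by
  refine ⟨fun hk => rg_eq_iff.2 fun θ₁ hθ₁ => ?_, isMorphism_rightMap.rg_eq⟩
  obtain ⟨θ, h1, -, h2⟩ := exists_invariant_compose c₁ c₂ s
    (show IsInvariant fun _ : C₁.HalfEdge => (0 : ZMod 2) from fun _ => rfl) hθ₁
  rw [← h2, ← h2]
  exact h1.eq_of_rg_eq hk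

theorem rg_leftMap_ne (h : C₁.HalfEdge) (k : C₂.HalfEdge) :
    (rg (leftMap h : (C₁.compose C₂ c₁ c₂ s).HalfEdge) ≠
      rg (rightMap k)) := by
  intro hk
  obtain ⟨θ, h1, h2, h3⟩ := exists_invariant_compose c₁ c₂ s
    (show IsInvariant fun _ : C₁.HalfEdge => true from fun _ => rfl)
    (show IsInvariant fun _ : C₂.HalfEdge => false from fun _ => rfl)
  have h4 := h1.eq_of_rg_eq hk
  rw [h2, h3] at h4
  exact Bool.noConfusion h4

theorem separatesEdges_of_compose (h : (C₁.compose C₂ c₁ c₂ s).SeparatesEdges) :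
    C₁.SeparatesEdges ∧ C₂.SeparatesEdges :=
  ⟨isMorphism_leftMap.separatesEdges leftMap_injective h,
    isMorphism_rightMap.separatesEdges rightMap_injective h⟩

/-- An edge from one of the diagrams keeps the two regions it had there, while an edge of the circle
has a region of each diagram on its sides. Two edges of the circle could agree only if both pairs of
corners coincide. Since opposite black corners at `c₁` and `c₂` are in different regions,
coincidences concern opposite white corners. -/
theorem separatesEdges_compose (hA₁ : C₁.IsAlternating) (hA₂ : C₂.IsAlternating)
    (hs : s = 0 ∨ s = 2) (h₁ : C₁.SeparatesEdges) (h₂ : C₂.SeparatesEdges)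
    (hn₁ : rg (c₁, 1) ≠ rg (c₁, 3)) (hn₂ : rg (c₂, 1) ≠ rg (c₂, 3)) :
    (C₁.compose C₂ c₁ c₂ s).SeparatesEdges := by
  have hpar : ∀ {C : DiagramCode} {c : C.Crossing}, C.IsAlternating → rg (c, 1) ≠ rg (c, 3) →
      ∀ i j, rg (c, i) = rg (c, j) → i = j ∨ (j = i + 2 ∧ ¬ IsOver i) := by
    intro C c hA hn i j hij
    have h1 := IsInvariant.isOver_iff hA hij
    have key : ∀ i j : ZMod 4, (IsOver i ↔ IsOver j) → i = j ∨ (j = i + 2 ∧ ¬ IsOver i) ∨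
      (i = 1 ∧ j = 3) ∨ (i = 3 ∧ j = 1) := by decide
    rcases key i j h1 with h | h | ⟨rfl, rfl⟩ | ⟨rfl, rfl⟩
    · exact .inl h
    · exact .inr h
    · exact absurd hij hn
    · exact absurd hij.symm hn
  have hL : ∀ h, rg (right (leftMap h : (C₁.compose C₂ c₁ c₂ s).HalfEdge)) =
    rg (leftMap (right h)) := isMorphism_leftMap.rg_right
  have hR : ∀ h, rg (right (rightMap h : (C₁.compose C₂ c₁ c₂ s).HalfEdge)) =
    rg (rightMap (right h)) := isMorphism_rightMap.rg_right
  have hn : ∀ p, rg ((circle p (p + 1)) : (C₁.compose C₂ c₁ c₂ s).HalfEdge) =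
      rg (rightMap (c₂, s - (p + 1))) := isInvariant_rg.circle_next
  have hn' : ∀ p, rg (right ((circle p (p + 1)) : (C₁.compose C₂ c₁ c₂ s).HalfEdge)) =
      rg (leftMap (c₁, p)) := fun p => by
    rw [right_circle, leftMap_self, add_sub_cancel_right]
  have hp : ∀ p, rg ((circle p (p - 1)) : (C₁.compose C₂ c₁ c₂ s).HalfEdge) =
      rg (leftMap (c₁, p - 1)) := isInvariant_rg.circle_prev
  have hp' : ∀ p, rg (right ((circle p (p - 1)) : (C₁.compose C₂ c₁ c₂ s).HalfEdge)) =
      rg (rightMap (c₂, s - p)) := fun p => by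
    have key : ∀ p : ZMod 4, p - 1 - 1 = p + 2 := by decide
    rw [right_circle, rightMap_self, sub_sub_cancel, key]
  have hne := rg_leftMap_ne (C₁ := C₁) (C₂ := C₂) (c₁ := c₁) (c₂ := c₂) (s := s)
  have hne' := fun k h => (hne h k).symm
  -- The corners of `C₁` and `C₂` on the two sides of an edge of the circle have different colors,
  -- so they cannot both be white.
  have key1 : ∀ s p q : ZMod 4, s = 0 ∨ s = 2 → ¬ IsOver p → ¬ IsOver (s - (p + 1)) → p = q := by
    decide
  have key2 : ∀ s p q : ZMod 4, s = 0 ∨ s = 2 → ¬ IsOver (p - 1) → ¬ IsOver (s - p) → p = q := by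
    decide
  refine compose_cases (fun h => ?_) (fun h => ?_) (fun p => ?_) fun p => ?_ <;>
    refine compose_cases (fun k => ?_) (fun k => ?_) (fun q => ?_) fun q => ?_ <;>
    simp only [hL, hR, hn, hn', hp, hp', rg_leftMap_iff, rg_rightMap_iff] <;> intro a b
  · rw [h₁ h k a b]
  · exact absurd a (hne _ _)
  · exact absurd a (hne _ _)
  · exact absurd b (hne _ _)
  · exact absurd a (hne' _ _)
  · rw [h₂ h k a b]
  · exact absurd b (hne' _ _)
  · exact absurd a (hne' _ _)
  · exact absurd a (hne' _ _)
  · exact absurd b (hne _ _)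
  · rcases hpar hA₁ hn₁ _ _ b with rfl | ⟨rfl, hb⟩
    · rfl
    · rcases hpar hA₂ hn₂ _ _ a with ha | ⟨-, ha⟩
      · rw [← add_right_cancel (sub_right_injective ha)]
      · rw [← key1 s p (p + 2) hs hb ha]
  · exact absurd a (hne' _ _)
  · exact absurd b (hne' _ _)
  · exact absurd a (hne _ _)
  · exact absurd a (hne _ _)
  · rcases hpar hA₁ hn₁ _ _ a with ha | ⟨-, ha⟩
    · rw [sub_left_injective ha]
    · rcases hpar hA₂ hn₂ _ _ b with hb | ⟨-, hb⟩
      · rw [sub_right_injective hb]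
      · rw [key2 s p q hs ha hb]

end Compose

/-- The flow lattice of a composition. -/
noncomputable def composeGluing (hA₁ : C₁.IsAlternating) (hA₂ : C₂.IsAlternating)
    (c₁ : C₁.Crossing) (c₂ : C₂.Crossing) {s : ZMod 4} (hs : s = 0 ∨ s = 2) :
    Gluing (C₁.compose C₂ c₁ c₂ s).flows C₁.flows C₂.flows where
  e₁ := c₁
  e₂ := c₂
  -- The coordinate `p` of the 4-cycle belongs to the new crossing `3 - p`. The signs account for
  -- the direction of the Tait edge at this crossing.
  ε := Equiv.sumCongr (Equiv.refl _) (Equiv.sumCongr (Equiv.refl _) (Equiv.subLeft 3))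
  τ p := if p = 0 ∨ p = 1 then -1 else 1
  τ_mul_self := by decide
  σ₁ := 1
  σ₁_mul_self := rfl
  σ₂ := if s = 0 then 1 else -1
  σ₂_mul_self := by split_ifs <;> rfl
  mem_iff f := by
    let g : ZMod 4 → ℤ := fun p => f (.inr (.inr p))
    change _ ↔ -1 * g 2 + 1 * g 0 = -1 * g 3 + 1 * g 1 ∧ extendAt c₁ (fun e => f (.inl e))
      (1 * (1 * g 1 - -1 * g 2)) ∈ C₁.flows ∧ extendAt c₂ (fun e => f (.inr (.inl e)))
      ((if s = 0 then 1 else -1) * (-1 * g 2 - -1 * g 3)) ∈ C₂.flows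
    have hext : ∀ {C : DiagramCode} {c : C.Crossing} (a : {x // x ≠ c} → ℤ) (X : ℤ)
        (θ : C.HalfEdge → ℤ), extendAt c a X ⬝ᵥ blackDiff θ =
          ∑ x, a x * blackDiff θ x.1 + X * blackDiff θ c := by
      intro C c a X θ
      rw [dotProduct, sum_eq_sum_ne_add c, extendAt_self]
      congr 1
      refine Finset.sum_congr (by ext; simp) fun x _ => ?_
      rw [extendAt_coe]
    have k1 : ∀ s : ZMod 4, s - (2 + 1) = s + 1 := by decide
    have k2 : ∀ s : ZMod 4, s - 3 = s + 1 := by decide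
    -- At each new crossing, one black corner belongs to a region of `C₁` and the other to one of
    -- `C₂`. Collecting them by regions leaves the four terms at the corners `3`, `1` of `c₁` and `s
    -- ∓ 1` of `c₂`.
    have hsum : ∀ θ : (C₁.compose C₂ c₁ c₂ s).HalfEdge → ℤ, IsInvariant θ →
        ∀ (θ₁ : C₁.HalfEdge → ℤ) (θ₂ : C₂.HalfEdge → ℤ),
        (∀ h, θ (leftMap h) = θ₁ h) →
        (∀ h, θ (rightMap h) = θ₂ h) → f ⬝ᵥ blackDiff θ =
          ∑ x : {x // x ≠ c₁}, f (.inl x) * blackDiff θ₁ x.1 +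
          (∑ x : {x // x ≠ c₂}, f (.inr (.inl x)) * blackDiff θ₂ x.1 +
          (θ₁ (c₁, 3) * (g 0 + g 3) - θ₁ (c₁, 1) * (g 1 + g 2) + θ₂ (c₂, s - 1) * (g 1 - g 0) +
            θ₂ (c₂, s + 1) * (g 2 - g 3))) := by
      intro θ hθ θ₁ θ₂ e1 e2
      have hn := fun p => (hθ.circle_next p).trans (e2 _)
      have hp := fun p => (hθ.circle_prev p).trans (e1 _)
      have hl : ∀ p, θ (circle p p) = θ₁ (c₁, p) := fun p => by
        rw [← e1, leftMap_self]
      have hr : ∀ p, θ (circle p (p + 2)) = θ₂ (c₂, s - p) := fun p => by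
        rw [← e2, rightMap_self, sub_sub_cancel]
      refine (Fintype.sum_sum_type _).trans (congrArg₂ (· + ·) ?_
        ((Fintype.sum_sum_type _).trans (congrArg₂ (· + ·) ?_ ((ZMod.sum_univ_four _).trans ?_))))
      · refine Finset.sum_congr rfl fun x _ => ?_
        change f (.inl x) * (θ (innerLeft x 3) - θ (innerLeft x 1)) =
          f (.inl x) * (θ₁ (x.1, 3) - θ₁ (x.1, 1))
        rw [← e1, ← e1, leftMap_ne, leftMap_ne]
      · refine Finset.sum_congr rfl fun x _ => ?_
        change f (.inr (.inl x)) * (θ (innerRight x 3) - θ (innerRight x 1)) =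
          f (.inr (.inl x)) * (θ₂ (x.1, 3) - θ₂ (x.1, 1))
        rw [← e2, ← e2, rightMap_ne, rightMap_ne]
      · have a0 : θ (circle 0 3) = θ₁ (c₁, 3) := hp 0
        have a1 : θ (circle 0 1) = θ₂ (c₂, s - 1) := hn 0
        have a2 : θ (circle 1 3) = θ₂ (c₂, s - 1) := hr 1
        have a3 : θ (circle 1 1) = θ₁ (c₁, 1) := hl 1
        have a4 : θ (circle 2 3) = θ₂ (c₂, s + 1) := (hn 2).trans (by
          rw [k1])
        have a5 : θ (circle 2 1) = θ₁ (c₁, 1) := hp 2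
        have a6 : θ (circle 3 3) = θ₁ (c₁, 3) := hl 3
        have a7 : θ (circle 3 1) = θ₂ (c₂, s + 1) := (hr 3).trans (by
          rw [k2])
        change g 0 * (θ (circle 0 3) - θ (circle 0 1)) + g 1 * (θ (circle 1 3) - θ (circle 1 1)) +
          g 2 * (θ (circle 2 3) - θ (circle 2 1)) + g 3 * (θ (circle 3 3) - θ (circle 3 1)) = _
        rw [a0, a1, a2, a3, a4, a5, a6, a7]
        ring
    -- The value of `s` decides which black corner of `c₂` is number `s - 1`, hence the sign of the
    -- new coordinate.
    have hY : ∀ θ₂ : C₂.HalfEdge → ℤ, g 0 + g 3 = g 1 + g 2 →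
        (if s = 0 then 1 else -1) * (-1 * g 2 - -1 * g 3) * blackDiff θ₂ c₂ =
        θ₂ (c₂, s - 1) * (g 1 - g 0) + θ₂ (c₂, s + 1) * (g 2 - g 3) := by
      intro θ₂ h
      have h' : g 0 = g 1 + g 2 - g 3 := by linarith
      rcases hs with rfl | rfl
      · rw [if_pos rfl, blackDiff, zero_add, show (0 : ZMod 4) - 1 = 3 from rfl, h']
        ring
      · rw [if_neg (by decide), blackDiff, show (2 : ZMod 4) - 1 = 1 from rfl,
          show (2 : ZMod 4) + 1 = 3 from rfl, h']
        ring
    constructor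
    · intro hf
      -- The test function is 1 on the black regions of `C₁` and 0 elsewhere: the circle is a cut of
      -- the Tait graph.
      have hX : g 0 + g 3 = g 1 + g 2 := by
        obtain ⟨θ, a1, a2, a3⟩ := exists_invariant_compose c₁ c₂ s
          (hA₁.isInvariant_checker (1 : ℤ) 0) (hA₂.isInvariant_checker (0 : ℤ) 0)
        have b1 : ∀ x : C₁.Crossing, blackDiff (checker (C := C₁) (1 : ℤ) 0) x = 0 := fun x => rfl
        have b2 : ∀ x : C₂.Crossing, blackDiff (checker (C := C₂) (0 : ℤ) 0) x = 0 := fun x => rfl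
        have b3 : checker (C := C₁) (1 : ℤ) 0 (c₁, 3) = 1 := rfl
        have b4 : checker (C := C₁) (1 : ℤ) 0 (c₁, 1) = 1 := rfl
        have b5 : ∀ p, checker (C := C₂) (0 : ℤ) 0 (c₂, p) = 0 := fun p => ite_self _
        have := (hsum θ a1 _ _ a2 a3).symm.trans (hf θ a1)
        simp only [b1, b2, b3, b4, b5, mul_zero, Finset.sum_const_zero] at this
        linarith
      refine ⟨by linarith, fun θ₁ hθ₁ => ?_, fun θ₂ hθ₂ => ?_⟩
      · obtain ⟨θ, a1, a2, a3⟩ := exists_invariant_compose c₁ c₂ s hθ₁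
          (show IsInvariant fun _ : C₂.HalfEdge => (0 : ℤ) from fun _ => rfl)
        have b2 : ∀ x : C₂.Crossing, blackDiff (fun _ : C₂.HalfEdge => (0 : ℤ)) x = 0 := fun x => rfl
        have := (hsum θ a1 _ _ a2 a3).symm.trans (hf θ a1)
        simp only [b2, mul_zero, Finset.sum_const_zero] at this
        rw [hext, ← this, hX, blackDiff]
        ring
      · obtain ⟨θ, a1, a2, a3⟩ := exists_invariant_compose c₁ c₂ s
          (show IsInvariant fun _ : C₁.HalfEdge => (0 : ℤ) from fun _ => rfl) hθ₂
        have b2 : ∀ x : C₁.Crossing, blackDiff (fun _ : C₁.HalfEdge => (0 : ℤ)) x = 0 := fun x => rfl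
        have := (hsum θ a1 _ _ a2 a3).symm.trans (hf θ a1)
        simp only [b2, mul_zero, Finset.sum_const_zero] at this
        rw [hext, ← this, hY _ hX]
        ring
    · rintro ⟨hX, hf₁, hf₂⟩ θ hθ
      have hX' : g 0 + g 3 = g 1 + g 2 := by linarith
      have b1 := hf₁ _ (isMorphism_leftMap.comp hθ)
      have b2 := hf₂ _ (isMorphism_rightMap.comp hθ)
      rw [hext] at b1 b2
      rw [hY _ hX'] at b2
      refine (hsum θ hθ _ _ (fun _ => rfl) fun _ => rfl).trans ?_
      rw [hX']
      rw [blackDiff] at b1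
      linear_combination b1 + b2

/-- The Tait graph of a tiling lattice has no loops. -/
theorem rg_ne_of_isTilingSubgroup (hT : IsTilingSubgroup C.flows) (x : C.Crossing) :
    rg (x, 1) ≠ rg (x, 3) := by
  intro hx
  have h1 : Pi.single x 1 ∈ C.flows := fun θ hθ => by
    rw [single_dotProduct, blackDiff, hθ.eq_of_rg_eq hx, sub_self, mul_zero]
  have h2 := hT.four_le h1 (by simp)
  simp at h2

end DiagramCode

/-! ### Surgery on two edges between the same regions -/

/-- A transposition of two elements of the same cycle splits the cycle. -/
theorem Equiv.Perm.SameCycle.exists_split {H : Type*} [Finite H] [DecidableEq H] {N : Equiv.Perm H}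
    {h k : H} (hne : h ≠ k) (hs : N.SameCycle h k) :
    ∃ S : H → Prop, S k ∧ ¬ S h ∧ ∀ x, S (N (Equiv.swap h k x)) ↔ S x := by
  classical
  have hex : ∃ m, 0 < m ∧ (N ^ m) h = k := by
    obtain ⟨i, h1, -, h2⟩ := hs.exists_pow_eq''
    exact ⟨i, h1, h2⟩
  let m := Nat.find hex
  obtain ⟨hm, hmk⟩ := Nat.find_spec hex
  have hmin : ∀ j, 0 < j → (N ^ j) h = k → m ≤ j := fun j h1 h2 => Nat.find_min' hex ⟨h1, h2⟩
  change 0 < m at hm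
  change (N ^ m) h = k at hmk
  -- The arc from the successor of `h` to `k`. The transposition sends the successor step of its
  -- last element `k` back to its beginning.
  let S : H → Prop := fun x => ∃ j, 0 < j ∧ j ≤ m ∧ (N ^ j) h = x
  have hSh : ¬ S h := by
    rintro ⟨j, h1, h2, h3⟩
    rcases h2.lt_or_eq with h4 | h4
    · have h5 : (N ^ (m - j)) h = k := by
        rw [← hmk, ← Nat.sub_add_cancel h2, pow_add, Equiv.Perm.mul_apply, h3,
          Nat.sub_add_cancel h2]
      have := hmin (m - j) (by omega) h5
      omega
    · rw [h4, hmk] at h3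
      exact hne h3.symm
  have hmap : ∀ x, S x → S (N (Equiv.swap h k x)) := by
    rintro x ⟨j, h1, h2, rfl⟩
    by_cases h3 : (N ^ j) h = k
    · rw [h3, Equiv.swap_apply_right]
      exact ⟨1, one_pos, hm, by rw [pow_one]⟩
    · rw [Equiv.swap_apply_of_ne_of_ne (fun h4 => hSh ⟨j, h1, h2, h4⟩) h3]
      have h4 : j ≠ m := fun h => h3 (h ▸ hmk)
      exact ⟨j + 1, by omega, by omega, by rw [pow_succ', Equiv.Perm.mul_apply]⟩
  refine ⟨S, ⟨m, hm, le_rfl, hmk⟩, hSh, fun x => ⟨fun hx => ?_, hmap x⟩⟩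
  let T : {x // S x} → {x // S x} := fun x => ⟨_, hmap x.1 x.2⟩
  have hT : Function.Injective T := fun a b hab => Subtype.ext
    ((Equiv.swap h k).injective (N.injective (congrArg Subtype.val hab)))
  obtain ⟨y, hy⟩ := Finite.injective_iff_surjective.1 hT ⟨_, hx⟩
  have := (Equiv.swap h k).injective (N.injective (congrArg Subtype.val hy))
  exact this ▸ y.2

namespace DiagramCode

variable {C : DiagramCode} {α : Type*}

/-- The code with the same crossings and other edges. -/
def reconnect (C : DiagramCode) (opp' : C.Crossing × ZMod 4 → C.Crossing × ZMod 4) :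
    DiagramCode where
  Crossing := C.Crossing
  opp := opp'

open Classical in
/-- The part of a code on a union of connected components. -/
noncomputable def restrict (C : DiagramCode) (P : C.Crossing → Prop)
    (hP : ∀ h : C.HalfEdge, P h.1 → P (C.opp h).1) : DiagramCode where
  Crossing := {x // P x}
  fintype := inferInstance
  decEq := inferInstance
  opp h := (⟨(C.opp (h.1.1, h.2)).1, hP (h.1.1, h.2) h.1.2⟩, (C.opp (h.1.1, h.2)).2)

/-- The half-edges of a part. -/
def restrictMap {P : C.Crossing → Prop} {hP : ∀ h : C.HalfEdge, P h.1 → P (C.opp h).1}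
    (h : (C.restrict P hP).HalfEdge) : C.HalfEdge := (h.1.1, h.2)

theorem restrictMap_opp {P : C.Crossing → Prop} {hP : ∀ h : C.HalfEdge, P h.1 → P (C.opp h).1}
    (h : (C.restrict P hP).HalfEdge) :
    restrictMap ((C.restrict P hP).opp h) = C.opp (restrictMap h) := rfl

theorem restrictMap_injective {P : C.Crossing → Prop}
    {hP : ∀ h : C.HalfEdge, P h.1 → P (C.opp h).1} :
    Function.Injective (restrictMap (P := P) (hP := hP)) := fun _ _ h =>
  Prod.ext (Subtype.ext (congrArg Prod.fst h)) (congrArg Prod.snd h :)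

theorem IsAlternating.restrict (hA : C.IsAlternating) {P : C.Crossing → Prop}
    (hP : ∀ h : C.HalfEdge, P h.1 → P (C.opp h).1) : (C.restrict P hP).IsAlternating where
  opp_opp h := restrictMap_injective (by
    rw [restrictMap_opp, restrictMap_opp, hA.opp_opp])
  alternating h := hA.alternating (restrictMap h)

section Surgery

variable {h k : C.HalfEdge}

/-- The edges of `h` and `k` exchange their ends. -/
def surgery (C : DiagramCode) (h k : C.HalfEdge) (z : C.HalfEdge) : C.HalfEdge :=
  Equiv.swap h k (C.opp (Equiv.swap h k z))

theorem surgery_comm : C.surgery h k = C.surgery k h := by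
  funext z
  simp only [surgery, Equiv.swap_comm]

theorem isOver_swap (hh : IsOver h.2) (hk : IsOver k.2) (z : C.HalfEdge) :
    IsOver (Equiv.swap h k z).2 ↔ IsOver z.2 := by
  rcases Equiv.swap_apply_eq_iff.1 (rfl : Equiv.swap h k z = _) with h1
  by_cases h2 : z = h
  · subst h2
    rw [Equiv.swap_apply_left]
    exact iff_of_true hk hh
  by_cases h3 : z = k
  · subst h3
    rw [Equiv.swap_apply_right]
    exact iff_of_true hh hk
  rw [Equiv.swap_apply_of_ne_of_ne h2 h3]

theorem IsAlternating.surgery (hA : C.IsAlternating) (hh : IsOver h.2) (hk : IsOver k.2) :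
    (C.reconnect (C.surgery h k)).IsAlternating where
  opp_opp := by
    have key : ∀ z : C.HalfEdge, C.surgery h k (C.surgery h k z) = z := fun z => by
      rw [DiagramCode.surgery, DiagramCode.surgery, Equiv.swap_apply_self, hA.opp_opp,
        Equiv.swap_apply_self]
    exact key
  alternating := by
    have key : ∀ z : C.HalfEdge, IsOver (C.surgery h k z).2 ↔ ¬ IsOver z.2 := fun z => by
      rw [DiagramCode.surgery, isOver_swap hh hk, hA.alternating, isOver_swap hh hk]
    exact key

theorem swap_of_not_isOver (hh : IsOver h.2) (hk : IsOver k.2) {z : C.HalfEdge}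
    (hz : ¬ IsOver z.2) : Equiv.swap h k z = z :=
  Equiv.swap_apply_of_ne_of_ne (fun h1 => hz (h1 ▸ hh)) fun h1 => hz (h1 ▸ hk)

theorem surgery_of_isOver (hA : C.IsAlternating) (hh : IsOver h.2) (hk : IsOver k.2)
    {z : C.HalfEdge} (hz : IsOver z.2) : C.surgery h k z = C.opp (Equiv.swap h k z) :=
  swap_of_not_isOver hh hk (by rwa [hA.alternating, isOver_swap hh hk, not_not])

theorem IsInvariant.surgery {θ : C.HalfEdge → α} (hθ : IsInvariant θ) (h1 : θ h = θ k) (h2 : θ (right h) = θ (right k)) :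
    IsInvariant (C := C.reconnect (C.surgery h k)) θ := by
  have hs : ∀ z, θ (Equiv.swap h k z) = θ z ∧ θ (right (Equiv.swap h k z)) = θ (right z) := by
    intro z
    by_cases h3 : z = h
    · subst h3
      rw [Equiv.swap_apply_left]
      exact ⟨h1.symm, h2.symm⟩
    by_cases h4 : z = k
    · subst h4
      rw [Equiv.swap_apply_right]
      exact ⟨h1, h2⟩
    rw [Equiv.swap_apply_of_ne_of_ne h3 h4]
    exact ⟨rfl, rfl⟩
  have key : ∀ z : C.HalfEdge, θ (right (C.surgery h k z)) = θ z := fun z => by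
    rw [DiagramCode.surgery, (hs _).2, hθ, (hs _).1]
  exact key

/-- Edges between the same two regions can be cut and reconnected such that the number of regions
grows. -/
theorem card_region_surgery (hA : C.IsAlternating) (hh : IsOver h.2) (hk : IsOver k.2)
    (hne : h ≠ k) (h1 : rg h = rg k) (h2 : rg (right h) = rg (right k)) :
    Nat.card C.Region < Nat.card (C.reconnect (C.surgery h k)).Region := by
  have hA' := hA.surgery hh hk
  -- Old regions are unions of new ones, so `F` maps the new regions onto the old ones; it remains
  -- to find two with the same image.
  obtain ⟨F, hF⟩ := (isInvariant_rg.surgery h1 h2).exists_region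
  let N : Equiv.Perm C.HalfEdge := Equiv.ofBijective _ hA.next_bijective
  have hN : ∀ z, N z = right (C.opp z) := fun _ => rfl
  have hsame : N.SameCycle h k := by
    have h3 : IsInvariant fun z => N.SameCycle h z := fun z =>
      propext (Equiv.Perm.sameCycle_apply_right (f := N) (x := h) (y := z))
    have h4 := h3.eq_of_rg_eq h1
    exact h4.mp (Equiv.Perm.SameCycle.refl N h)
  obtain ⟨S, hSk, hSh, hS⟩ := hsame.exists_split hne
  -- On black corners the new successor is the old one after the transposition of `h` and `k`. So
  -- the arc `S` is a union of new cycles there, and it separates `h` from `k`.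
  have hinv : IsInvariant (C := C.reconnect (C.surgery h k)) fun z => IsOver z.2 ∧ S z := by
    have key : ∀ z : C.HalfEdge,
        (IsOver (right (C.surgery h k z)).2 ∧ S (right (C.surgery h k z)) ↔ IsOver z.2 ∧ S z) := by
      intro z
      have h3 : IsOver (right (C.surgery h k z)).2 ↔ IsOver z.2 := hA'.isOver_next z
      rw [h3]
      refine and_congr_right fun h4 => ?_
      rw [← hS z, hN, surgery_of_isOver hA hh hk h4]
    exact fun z => propext (key z)
  by_contra hle
  have hsurj : Function.Surjective F := fun r => by
    obtain ⟨z, rfl⟩ := rg_surjective r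
    exact ⟨_, hF z⟩
  have hinj : Function.Injective F :=
    (Function.Surjective.bijective_of_nat_card_le hsurj (not_lt.1 hle)).1
  have h3 : rg (C := C.reconnect (C.surgery h k)) h = rg (C := C.reconnect (C.surgery h k)) k :=
    hinj ((hF h).trans (h1.trans (hF k).symm))
  exact hSh ((hinv.eq_of_rg_eq h3).mpr ⟨hk, hSk⟩).2

theorem opp_eq_surgery (z : C.HalfEdge) :
    C.opp z = Equiv.swap h k (C.surgery h k (Equiv.swap h k z)) := by
  rw [surgery, Equiv.swap_apply_self, Equiv.swap_apply_self]

/-- A part of the code after the surgery is connected. -/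
theorem isConnected_restrict_surgery (hA : C.IsAlternating) (hC : C.IsConnected)
    (hh : IsOver h.2) (hk : IsOver k.2) {opp' : C.HalfEdge → C.HalfEdge}
    (ho : opp' = C.surgery h k) {P : C.Crossing → Prop} (hPh : P h.1) (hPk : ¬ P k.1)
    (hP : ∀ z : C.HalfEdge, P z.1 → P (opp' z).1) :
    ((C.reconnect opp').restrict P hP).IsConnected := by
  subst ho
  have hA' := hA.surgery hh hk
  have hP' : ∀ z : C.HalfEdge, P (C.surgery h k z).1 ↔ P z.1 := fun z =>
    ⟨fun h1 => by
      have := hP _ h1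
      rwa [show C.surgery h k (C.surgery h k z) = z from hA'.opp_opp z] at this, hP z⟩
  intro Q hQ x y hx
  -- All crossings outside of the part are treated like the crossing of `h`. Undoing the surgery
  -- then preserves `Q'`, and connectedness of `C` applies.
  let Q' : C.Crossing → Prop := fun x => (∃ hx : P x, Q ⟨x, hx⟩) ∨ (¬ P x ∧ Q ⟨h.1, hPh⟩)
  have hQopp : ∀ z : C.HalfEdge, Q' z.1 → Q' (C.surgery h k z).1 := by
    rintro z (⟨hz, hq⟩ | ⟨hz, hq⟩)
    · exact .inl ⟨hP z hz, hQ (⟨z.1, hz⟩, z.2) hq⟩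
    · exact .inr ⟨by rwa [hP'], hq⟩
  have hQswap : ∀ z : C.HalfEdge, Q' z.1 → Q' (Equiv.swap h k z).1 := by
    intro z hz
    by_cases h3 : z = h
    · subst h3
      rw [Equiv.swap_apply_left]
      rcases hz with ⟨h4, h5⟩ | h4
      · exact .inr ⟨hPk, h5⟩
      · exact absurd hPh h4.1
    by_cases h4 : z = k
    · subst h4
      rw [Equiv.swap_apply_right]
      rcases hz with ⟨h5, h6⟩ | h5
      · exact absurd h5 hPk
      · exact .inl ⟨hPh, h5.2⟩
    rwa [Equiv.swap_apply_of_ne_of_ne h3 h4]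
  have hQ'' := hC Q' (fun z hz => by
    rw [opp_eq_surgery (h := h) (k := k) z]
    exact hQswap _ (hQopp _ (hQswap _ hz))) x.1 y.1 (.inl ⟨x.2, hx⟩)
  rcases hQ'' with ⟨_, h3⟩ | h3
  · exact h3
  · exact absurd y.2 h3.1

open Classical in
/-- The code is a connected sum of the two parts after the surgery. -/
theorem iso_splice_surgery (hA : C.IsAlternating) (hh : IsOver h.2) (hk : IsOver k.2)
    {P : C.Crossing → Prop} (hPh : P h.1) (hPk : ¬ P k.1)
    (hP₁ : ∀ z : C.HalfEdge, P z.1 → P (C.surgery h k z).1)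
    (hP₂ : ∀ z : C.HalfEdge, ¬ P z.1 → ¬ P (C.surgery h k z).1) :
    C.Iso (((C.reconnect (C.surgery h k)).restrict P hP₁).splice
      ((C.reconnect (C.surgery h k)).restrict (fun x => ¬ P x) hP₂) (⟨h.1, hPh⟩, h.2)
      (⟨k.1, hPk⟩, k.2)) := by
  set C₁ := (C.reconnect (C.surgery h k)).restrict P hP₁
  set C₂ := (C.reconnect (C.surgery h k)).restrict (fun x => ¬ P x) hP₂
  let h₁ : C₁.HalfEdge := (⟨h.1, hPh⟩, h.2)
  let h₂ : C₂.HalfEdge := (⟨k.1, hPk⟩, k.2)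
  change C.Iso (C₁.splice C₂ h₁ h₂)
  let m₁ : C₁.HalfEdge → C.HalfEdge := restrictMap
  let m₂ : C₂.HalfEdge → C.HalfEdge := restrictMap
  have hm₁ : Function.Injective m₁ := restrictMap_injective
  have hm₂ : Function.Injective m₂ := restrictMap_injective
  have hmopp₁ : ∀ z, m₁ (C₁.opp z) = C.surgery h k (m₁ z) := restrictMap_opp
  have hmopp₂ : ∀ z, m₂ (C₂.opp z) = C.surgery h k (m₂ z) := restrictMap_opp
  have hh₁ : m₁ h₁ = h := rfl
  have hh₂ : m₂ h₂ = k := rfl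
  have hPm₁ : ∀ z, P (m₁ z).1 := fun z => z.1.2
  have hPm₂ : ∀ z, ¬ P (m₂ z).1 := fun z => z.1.2
  let e : (C₁.splice C₂ h₁ h₂).Crossing ≃ C.Crossing := Equiv.sumCompl P
  let M : (C₁.splice C₂ h₁ h₂).HalfEdge → C.HalfEdge := fun z => (e z.1, z.2)
  have hMl : ∀ z, M (spliceLeft z) = m₁ z := fun _ => rfl
  have hMr : ∀ z, M (spliceRight z) = m₂ z := fun _ => rfl
  have hsh : C.surgery h k h = C.opp k := by
    rw [surgery_of_isOver hA hh hk hh, Equiv.swap_apply_left]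
  have hsk : C.surgery h k k = C.opp h := by
    rw [surgery_of_isOver hA hh hk hk, Equiv.swap_apply_right]
  have hother : ∀ z, z ≠ h → z ≠ k → z ≠ C.opp h → z ≠ C.opp k → C.surgery h k z = C.opp z := by
    intro z h1 h2 h3 h4
    rw [surgery, Equiv.swap_apply_of_ne_of_ne h1 h2, Equiv.swap_apply_of_ne_of_ne]
    · exact fun h5 => h3 (by rw [← h5, hA.opp_opp])
    · exact fun h5 => h4 (by rw [← h5, hA.opp_opp])
  have key : ∀ z, C.opp (M z) = M ((C₁.splice C₂ h₁ h₂).opp z) := by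
    refine splice_cases (fun z => ?_) fun z => ?_
    · rw [splice_opp_left, hMl]
      split_ifs with h1 h2
      · rw [hMr, hmopp₂, hh₂, hsk, h1, hh₁]
      · rw [hMr, hh₂, h2, hmopp₁, hh₁, hsh, hA.opp_opp]
      · rw [hMl, hmopp₁, hother]
        · exact fun h3 => h1 (hm₁ h3)
        · exact fun h3 => hPk (h3 ▸ hPm₁ z)
        · intro h3
          refine hPm₂ (C₂.opp h₂) ?_
          have h4 := hmopp₂ h₂
          rw [hh₂, hsk, ← h3] at h4
          exact h4 ▸ hPm₁ z
        · intro h3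
          exact h2 (hm₁ (by rw [h3, hmopp₁, hh₁, hsh]))
    · rw [splice_opp_right, hMr]
      split_ifs with h1 h2
      · rw [hMl, hmopp₁, hh₁, hsh, h1, hh₂]
      · rw [hMl, hh₁, h2, hmopp₂, hh₂, hsk, hA.opp_opp]
      · rw [hMr, hmopp₂, hother]
        · exact fun h3 => hPm₂ z (h3 ▸ hPh)
        · exact fun h3 => h1 (hm₂ h3)
        · intro h3
          exact h2 (hm₂ (by rw [h3, hmopp₂, hh₂, hsk]))
        · intro h3
          refine hPm₂ z ?_
          have h4 := hmopp₁ h₁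
          rw [hh₁, hsh] at h4
          exact h3 ▸ h4 ▸ hPm₁ (C₁.opp h₁)
  refine Iso.symm ⟨e, fun _ => 0, fun _ => .inl rfl, fun x i => ?_⟩
  rw [add_zero, add_zero]
  exact key (x, i)

end Surgery

end DiagramCode

namespace AltDiagram

open DiagramCode

/-- A diagram in which two edges are adjacent to the same two regions is a connected sum. -/
theorem exists_iso_splice (D : AltDiagram) (hD : ¬ D.SeparatesEdges) :
    ∃ (D₁ D₂ : AltDiagram) (h₁ : D₁.HalfEdge) (h₂ : D₂.HalfEdge), IsOver h₁.2 ∧ IsOver h₂.2 ∧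
      D.toDiagramCode.Iso (D₁.splice D₂.toDiagramCode h₁ h₂) ∧
      Fintype.card D₁.Crossing < Fintype.card D.Crossing ∧
      Fintype.card D₂.Crossing < Fintype.card D.Crossing := by
  classical
  have hA := D.isAlternating
  have hC := D.isConnected
  have hex : ∃ h k : D.HalfEdge, IsOver h.2 ∧ IsOver k.2 ∧ h ≠ k ∧ rg h = rg k ∧
      rg (right h) = rg (right k) := by
    simp only [SeparatesEdges] at hD
    push Not at hD
    obtain ⟨h, k, h1, h2, hne⟩ := hD
    have h3 := IsInvariant.isOver_iff hA h1
    by_cases hh : IsOver h.2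
    · exact ⟨h, k, hh, h3.1 hh, hne, h1, h2⟩
    -- If the half-edges belong to under-strands, the other ends of their edges belong to
    -- over-strands.
    · refine ⟨D.opp h, D.opp k, (hA.alternating h).2 hh, (hA.alternating k).2 fun h4 => hh (h3.2 h4),
        fun h4 => hne ?_, ?_, ?_⟩
      · rw [← hA.opp_opp h, h4, hA.opp_opp]
      · rwa [← isInvariant_rg.right_eq hA, ← isInvariant_rg.right_eq hA]
      · rwa [isInvariant_rg h, isInvariant_rg k]
  obtain ⟨h, k, hh, hk, hne, h1, h2⟩ := hex
  have hA' := hA.surgery hh hk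
  have hcard := card_region_surgery hA hh hk hne h1 h2
  -- A connected code with the same crossings cannot have more regions than a diagram on the sphere.
  have hC' : ¬ (D.reconnect (D.surgery h k)).IsConnected := fun h3 => by
    have h4 := card_region_le hA' h3 h.1
    have h5 := D.planar ⟨h.1⟩
    have h6 : Fintype.card (D.reconnect (D.surgery h k)).Crossing = Fintype.card D.Crossing := rfl
    omega
  have hP : ∃ P : D.Crossing → Prop, (∀ z : D.HalfEdge, P (D.surgery h k z).1 ↔ P z.1) ∧
      P h.1 ∧ ¬ P k.1 := by
    unfold DiagramCode.IsConnected at hC'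
    push Not at hC'
    obtain ⟨P, hP, x, y, hx, hy⟩ := hC'
    have hP' : ∀ z : D.HalfEdge, P (D.surgery h k z).1 ↔ P z.1 := fun z =>
      ⟨fun h1 => by
        have h2 : P (D.surgery h k (D.surgery h k z)).1 := hP _ h1
        rwa [show D.surgery h k (D.surgery h k z) = z from hA'.opp_opp z] at h2, hP z⟩
    -- If `h` and `k` are on the same side of `P`, undoing the surgery does not leave `P` and the
    -- diagram itself is disconnected.
    by_cases hPh : P h.1 <;> by_cases hPk : P k.1
    · exfalso
      refine hy (hC P (fun z hz => ?_) x y hx)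
      have hsw : ∀ z : D.HalfEdge, P (Equiv.swap h k z).1 ↔ P z.1 := fun z => by
        rw [Equiv.swap_apply_def]
        split_ifs with h3 h4
        · subst h3; exact iff_of_true hPk hPh
        · subst h4; exact iff_of_true hPh hPk
        · rfl
      rwa [opp_eq_surgery (h := h) (k := k) z, hsw, hP', hsw]
    · exact ⟨P, hP', hPh, hPk⟩
    · exact ⟨fun x => ¬ P x, fun z => not_congr (hP' z), hPh, not_not.2 hPk⟩
    · exfalso
      refine hy (hC P (fun z hz => ?_) x y hx)
      have hsw : ∀ z : D.HalfEdge, P (Equiv.swap h k z).1 ↔ P z.1 := fun z => by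
        rw [Equiv.swap_apply_def]
        split_ifs with h3 h4
        · subst h3; exact iff_of_false hPk hPh
        · subst h4; exact iff_of_false hPh hPk
        · rfl
      rwa [opp_eq_surgery (h := h) (k := k) z, hsw, hP', hsw]
  obtain ⟨P, hP, hPh, hPk⟩ := hP
  have hP₁ : ∀ z : D.HalfEdge, P z.1 → P (D.surgery h k z).1 := fun z => (hP z).2
  have hP₂ : ∀ z : D.HalfEdge, ¬ P z.1 → ¬ P (D.surgery h k z).1 := fun z => (not_congr (hP z)).2
  have hiso := iso_splice_surgery hA hh hk hPh hPk hP₁ hP₂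
  have hC₁ := isConnected_restrict_surgery hA hC hh hk rfl hPh hPk hP₁
  have hC₂ := isConnected_restrict_surgery hA hC hk hh surgery_comm (P := fun x => ¬ P x) hPk
    (not_not.2 hPh) hP₂
  have hA₁ := hA'.restrict hP₁
  have hA₂ := hA'.restrict (P := fun x => ¬ P x) hP₂
  set C₁ := (D.reconnect (D.surgery h k)).restrict P hP₁
  set C₂ := (D.reconnect (D.surgery h k)).restrict (fun x => ¬ P x) hP₂
  have hcs : Fintype.card C₁.Crossing + Fintype.card C₂.Crossing = Fintype.card D.Crossing := by
    obtain ⟨f, -⟩ := hiso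
    rw [Fintype.card_congr f, ← Fintype.card_sum]
    rfl
  let x₁ : C₁.Crossing := ⟨h.1, hPh⟩
  let x₂ : C₂.Crossing := ⟨k.1, hPk⟩
  have hp₁ : 0 < Fintype.card C₁.Crossing := Fintype.card_pos_iff.2 ⟨x₁⟩
  have hp₂ : 0 < Fintype.card C₂.Crossing := Fintype.card_pos_iff.2 ⟨x₂⟩
  -- The sphere condition for the parts: `R + 2 ≤ R₁ + R₂ ≤ (c₁ + 2) + (c₂ + 2) = R + 2`, so both
  -- parts attain Euler's bound.
  have hle := card_region_splice (h₁ := (x₁, h.2)) (h₂ := (x₂, k.2)) hA₁ hA₂ hh hk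
  have hle₁ := card_region_le hA₁ hC₁ x₁
  have hle₂ := card_region_le hA₂ hC₂ x₂
  have hreg : Nat.card D.Region =
    Nat.card (C₁.splice C₂ (x₁, h.2) (x₂, k.2)).Region := hiso.card_region
  have hpl := D.planar ⟨h.1⟩
  refine ⟨ofCode C₁ hA₁ hC₁ fun _ => ?_, ofCode C₂ hA₂ hC₂ fun _ => ?_, (x₁, h.2), (x₂, k.2), hh, hk,
    hiso, ?_, ?_⟩
  · omega
  · omega
  · change Fintype.card C₁.Crossing < _
    omega
  · change Fintype.card C₂.Crossing < _
    omega

end AltDiagram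

/-! ### The four quadrants of a 4-cycle on the sphere -/

namespace AltDiagram

open DiagramCode

variable {D : AltDiagram}

theorem isOver_blackCorner (h : D.HalfEdge) : D.IsBlack (rg (blackCorner h)) := by
  change IsOver (blackCorner h).2
  rw [blackCorner]
  split_ifs with h1
  · exact h1
  · exact isOver_right.2 h1

/-- The black region next to a half-edge. -/
def black (h : D.HalfEdge) : D.BlackRegion := ⟨rg (blackCorner h), isOver_blackCorner h⟩

theorem black_opp (h : D.HalfEdge) : black (D.opp h) = black h :=
  Subtype.ext (isInvariant_rg.blackCorner_opp D.isAlternating h)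

theorem black_zero (y : D.Crossing) : black (D := D) (y, 0) = D.taitHead y := rfl

theorem black_one (y : D.Crossing) : black (D := D) (y, 1) = D.taitTail y := rfl

theorem exists_blackDiff {K : Type*} [Ring K] (B : D.BlackRegion → K) :
    ∃ θ : D.HalfEdge → K, IsInvariant θ ∧ ∀ y, blackDiff θ y = B (D.taitHead y) - B (D.taitTail y) := by
  classical
  refine ⟨fun h => if hb : D.IsBlack (rg h) then B ⟨rg h, hb⟩ else 0,
    isInvariant_of_region fun r => if hb : D.IsBlack r then B ⟨r, hb⟩ else 0, fun y => ?_⟩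
  rw [blackDiff, dif_pos (show D.IsBlack (rg (y, 3)) from Or.inr rfl),
    dif_pos (show D.IsBlack (rg (y, 1)) from Or.inl rfl)]
  rfl

/-- A function that tells the white regions on the two sides of a 4-cycle apart. -/
structure IsWhiteSide (q : Square D.taitTail D.taitHead) (g : D.HalfEdge → ZMod 2) : Prop where
  inv : IsInvariant g
  ne : ∀ i, g (q.x i, 0) ≠ g (q.x i, 2)
  eq : ∀ y, (∀ i, y ≠ q.x i) → g (y, 0) = g (y, 2)

theorem exists_isWhiteSide (q : Square D.taitTail D.taitHead) : ∃ g, IsWhiteSide q g := by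
  obtain ⟨v, hv, hvx, hv0⟩ := q.exists_cycle
  -- The 4-cycle is a flow, hence a white difference. Modulo 2, its potential tells the inside from
  -- the outside.
  obtain ⟨ψ, hψ, hψv⟩ := exists_whiteDiff D.isAlternating D.isConnected D.planar
    (D.chessboardLattice_eq ▸ hv : v ∈ D.flows)
  have hc : ∀ y, (ψ (y, 0) : ZMod 2) - ψ (y, 2) = v y := fun y => by
    rw [← hψv, whiteDiff]
    push_cast
    rfl
  refine ⟨fun h => ψ h, hψ.comp _, fun i h => ?_, fun y hy => ?_⟩
  · have h1 := hc (q.x i)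
    rw [h, sub_self, hvx] at h1
    have h2 := congrArg (Int.cast : ℤ → ZMod 2) (q.sign_mul_self i)
    rw [Int.cast_mul, ← h1, mul_zero] at h2
    revert h2
    decide
  · have h1 := hc y
    rw [hv0 y hy, Int.cast_zero] at h1
    exact sub_eq_zero.1 h1

namespace IsWhiteSide

variable {q : Square D.taitTail D.taitHead} {g φ : D.HalfEdge → ZMod 2}

theorem flip (hg : IsWhiteSide q g) : IsWhiteSide q.flip g :=
  ⟨hg.inv, fun i => hg.ne (i + 1), fun y hy => hg.eq y fun i hi =>
    hy (i - 1) (by rw [hi]; exact congrArg q.x (sub_add_cancel i 1).symm)⟩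

/-- The value of a function at the white corner on one side of the 4-cycle. -/
def val (q : Square D.taitTail D.taitHead) (g φ : D.HalfEdge → ZMod 2) (γ : ZMod 2) (i : ZMod 4) :
    ZMod 2 := if g (q.x i, 0) = γ then φ (q.x i, 0) else φ (q.x i, 2)

theorem val_eq (hg : IsWhiteSide q g) {γ : ZMod 2} {i j : ZMod 4}
    (hj : g (whiteCorner (q.x i, j)) = γ) : val q g φ γ i = φ (whiteCorner (q.x i, j)) := by
  have h1 := hg.ne i
  obtain ⟨-, -, -, -, w0, w1, w2, w3⟩ := corners (C := D.toDiagramCode) (q.x i)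
  rw [val]
  match j with
  | 0 => rw [w0] at hj ⊢; rw [if_pos hj]
  | 1 => rw [w1] at hj ⊢; rw [if_pos hj]
  | 2 => rw [w2] at hj ⊢; rw [if_neg (hj ▸ h1)]
  | 3 => rw [w3] at hj ⊢; rw [if_neg (hj ▸ h1)]

/-- A homological relation between the four crossings of the 4-cycle. -/
theorem sum_eq_zero (hg : IsWhiteSide q g) (hφ : IsInvariant φ) (γ : ZMod 2)
    (B : D.BlackRegion → ZMod 2) (H : ∀ y, (∀ i, y ≠ q.x i) → g (y, 0) = γ →
      B (D.taitTail y) = B (D.taitHead y) ∨ φ (y, 0) = φ (y, 2)) :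
    ∑ i, (B (q.w (i + 1)) - B (q.w i)) * val q g φ γ i = 0 := by
  obtain ⟨θ, hθ, hB⟩ := exists_blackDiff B
  -- The relation is orthogonality of black and white differences, with `φ` cut off to one white
  -- side. All terms off the 4-cycle vanish by hypothesis.
  have hW : IsInvariant fun h => if g h = γ then φ h else 0 := fun h => by
    simp only [hg.inv h, hφ h]
  rw [← blackDiff_dotProduct_whiteDiff D.isAlternating hθ hW, dotProduct]
  refine Fintype.sum_of_injective q.x q.x_injective _ _ (fun y hy => ?_) fun i => ?_
  · have hy' : ∀ i, y ≠ q.x i := fun i hi => hy ⟨i, hi.symm⟩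
    rw [hB, whiteDiff, ← hg.eq y hy']
    by_cases hγ : g (y, 0) = γ
    · rw [if_pos hγ, if_pos hγ]
      rcases H y hy' hγ with h1 | h1
      · rw [h1, sub_self, zero_mul]
      · rw [h1, sub_self, mul_zero]
    · rw [if_neg hγ, if_neg hγ, sub_self, mul_zero]
  · have h1 : val q g φ γ i = whiteDiff (fun h => if g h = γ then φ h else 0) (q.x i) := by
      have h2 := hg.ne i
      have h3 : ∀ a b γ s t : ZMod 2, a ≠ b → (if a = γ then s else t) =
        (if a = γ then s else 0) - if b = γ then t else 0 := by decide
      exact h3 _ _ _ _ _ h2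
    rw [h1, hB]
    rcases q.ends i with ⟨h2, h3⟩ | ⟨h2, h3⟩ <;> rw [h2, h3]
    congr 1
    have h4 : ∀ a b : ZMod 2, a - b = b - a := by decide
    exact h4 _ _

/-- There is a path on the even side of the 4-cycle, and on the side `γ` with respect to the white
regions, that connects opposite vertices of the 4-cycle. -/
def Linked (q : Square D.taitTail D.taitHead) (g : D.HalfEdge → ZMod 2) (γ : ZMod 2) : Prop :=
  ∃ z : D.Crossing → ℤ, (∀ y, z y ≠ 0 → ¬ q.side (D.taitTail y) ∧ ¬ q.side (D.taitHead y) ∧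
    g (y, 0) = γ) ∧ ∀ u : D.BlackRegion → ℤ,
      ∑ y, z y * (u (D.taitHead y) - u (D.taitTail y)) = u (q.w 2) - u (q.w 0)

theorem side_iff (q : Square D.taitTail D.taitHead) {y : D.Crossing} (hy : ∀ i, y ≠ q.x i) :
    q.side (D.taitTail y) ↔ q.side (D.taitHead y) :=
  (q.cut y).resolve_right fun ⟨i, hi⟩ => hy i hi

theorem ne_of_not_side (q : Square D.taitTail D.taitHead) {y : D.Crossing}
    (h1 : ¬ q.side (D.taitTail y)) (h2 : ¬ q.side (D.taitHead y)) (i : ZMod 4) : y ≠ q.x i := by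
  rintro rfl
  exact q.not_side_iff i (iff_of_false h1 h2)

/-- `K` consists of the vertices that paths in the quadrant reach from `w 0`. -/
theorem exists_separating {γ : ZMod 2} (hL : ¬ Linked q g γ) : ∃ K : D.BlackRegion → Prop,
    K (q.w 0) ∧ ¬ K (q.w 2) ∧ ∀ y, ¬ q.side (D.taitTail y) → ¬ q.side (D.taitHead y) →
      g (y, 0) = γ → (K (D.taitTail y) ↔ K (D.taitHead y)) := by
  classical
  let K : D.BlackRegion → Prop := fun b => ∃ z : D.Crossing → ℤ, (∀ y, z y ≠ 0 →
    ¬ q.side (D.taitTail y) ∧ ¬ q.side (D.taitHead y) ∧ g (y, 0) = γ) ∧ ∀ u : D.BlackRegion → ℤ,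
      ∑ y, z y * (u (D.taitHead y) - u (D.taitTail y)) = u b - u (q.w 0)
  have hstep : ∀ (y) (a : ℤ) (b b' : D.BlackRegion), ¬ q.side (D.taitTail y) →
      ¬ q.side (D.taitHead y) → g (y, 0) = γ →
      (∀ u : D.BlackRegion → ℤ, a * (u (D.taitHead y) - u (D.taitTail y)) = u b' - u b) →
      K b → K b' := by
    rintro y a b b' h1 h2 h3 h4 ⟨z, hz, hz'⟩
    refine ⟨z + Pi.single y a, fun y' hy' => ?_, fun u => ?_⟩
    · by_cases h5 : y' = y
      · exact h5 ▸ ⟨h1, h2, h3⟩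
      · refine hz _ ?_
        rwa [Pi.add_apply, Pi.single_eq_of_ne h5, add_zero] at hy'
    · simp only [Pi.add_apply, add_mul, Finset.sum_add_distrib, hz', Pi.single_apply, ite_mul,
        zero_mul, Finset.sum_ite_eq', Finset.mem_univ, if_true, h4]
      ring
  refine ⟨K, ⟨0, fun y h => absurd rfl h, fun u => by simp⟩, hL, fun y h1 h2 h3 => ⟨?_, ?_⟩⟩
  · exact hstep y 1 _ _ h1 h2 h3 fun u => by ring
  · exact hstep y (-1) _ _ h1 h2 h3 fun u => by ring

/-- A path between opposite vertices of the 4-cycle, closed up along two of its edges, bounds a set of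
white regions. -/
theorem Linked.exists_pattern (hg : IsWhiteSide q g) {γ : ZMod 2} (hL : Linked q g γ) :
    ∃ φ : D.HalfEdge → ZMod 2, IsInvariant φ ∧ val q g φ γ 0 = val q g φ γ 1 ∧
      val q g φ γ 2 = val q g φ γ 3 ∧ val q g φ γ 3 ≠ val q g φ γ 0 := by
  classical
  obtain ⟨z, hz, hz'⟩ := hL
  have hzx : ∀ i, z (q.x i) = 0 := fun i => by
    by_contra h
    exact q.not_side_iff i (iff_of_false (hz _ h).1 (hz _ h).2.1)
  -- The path from `w 0` to `w 2` in the quadrant, minus the path through `w 1` along the 4-cycle,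
  -- is closed.
  let f : D.Crossing → ℤ := z - Pi.single (q.x 0) (q.sign 0) - Pi.single (q.x 1) (q.sign 1)
  have hf : f ∈ D.flows := by
    rw [← chessboardLattice_eq, chessboardLattice, mem_flowLattice_iff]
    intro u
    simp only [f, Pi.sub_apply, sub_mul, Finset.sum_sub_distrib, hz', Pi.single_apply, ite_mul,
      zero_mul, Finset.sum_ite_eq', Finset.mem_univ, if_true, q.mul_sub_ends, q.sign_mul_self]
    change u (q.w 2) - u (q.w 0) - 1 * (u (q.w 1) - u (q.w 0)) - 1 * (u (q.w 2) - u (q.w 1)) = 0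
    ring
  obtain ⟨ψ, hψ, hψf⟩ := exists_whiteDiff D.isAlternating D.isConnected D.planar hf
  have hc : ∀ y, (ψ (y, 0) : ZMod 2) - ψ (y, 2) = f y := fun y => by
    rw [← hψf, whiteDiff]
    push_cast
    rfl
  let φ : D.HalfEdge → ZMod 2 := fun h => ψ h
  have hφ : IsInvariant φ := hψ.comp _
  have hφf : ∀ y, φ (y, 0) - φ (y, 2) = f y := hc
  have hfy : ∀ y, (∀ i, y ≠ q.x i) → f y = z y := fun y hy => by
    simp [f, Pi.single_eq_of_ne (hy _)]
  have hw : Function.Injective q.w := by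
    have h1 : ∀ i j : ZMod 4, i = j ∨ j = i + 1 ∨ j = i + 2 ∨ i = j + 1 := by decide
    intro i j hij
    rcases h1 i j with h | h | h | h
    · exact h
    · exact absurd (h ▸ hij) (q.w_ne_succ i)
    · exact absurd (h ▸ hij) (q.w_ne i)
    · exact absurd (h ▸ hij).symm (q.w_ne_succ j)
  -- Walking around the vertex `w (i + 1)` on the white side `γ'`, the potential does not change
  -- unless the path meets this vertex there.
  have hwalk : ∀ i γ', (∀ y, (∀ i, y ≠ q.x i) → g (y, 0) = γ' → z y ≠ 0 → q.side (q.w (i + 1))) →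
      val q g φ γ' i = val q g φ γ' (i + 1) := by
    intro i γ' h1
    have h2 := hg.sum_eq_zero hφ γ' (fun b => if b = q.w (i + 1) then 1 else 0) (fun y hy hγ => by
      by_cases h3 : z y = 0
      · right
        have := hφf y
        rw [hfy y hy, h3, Int.cast_zero] at this
        exact sub_eq_zero.1 this
      · left
        have h4 := h1 y hy hγ h3
        have h5 := hz y h3
        have h6 : D.taitTail y ≠ q.w (i + 1) := fun h => h5.1 (h ▸ h4)
        have h7 : D.taitHead y ≠ q.w (i + 1) := fun h => h5.2.1 (h ▸ h4)
        rw [if_neg h6, if_neg h7])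
    simp only [hw.eq_iff, add_left_inj] at h2
    have h3 : ∀ F : ZMod 4 → ZMod 2, ∀ i : ZMod 4,
        ∑ j, ((if j = i then 1 else 0) - if j = i + 1 then 1 else 0) * F j = F i - F (i + 1) := by
      intro F i
      simp [sub_mul, Finset.sum_sub_distrib]
    rw [h3] at h2
    exact sub_eq_zero.1 h2
  have hval : ∀ i, val q g φ γ i - val q g φ (γ + 1) i = f (q.x i) := by
    intro i
    have h1 : ∀ a b γ s t : ZMod 2, a ≠ b → (if a = γ then s else t) -
      (if a = γ + 1 then s else t) = s - t := by decide
    rw [← hφf]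
    exact h1 _ _ _ _ _ (hg.ne i)
  have hne : ∀ γ : ZMod 2, γ ≠ γ + 1 := by decide
  have hside : ∀ i : ZMod 4, IsOver i → q.side (q.w i) := fun i => (q.side_w i).2
  have h01 : val q g φ γ 0 = val q g φ γ 1 := hwalk 0 γ fun _ _ _ _ => hside 1 (by decide)
  have h23 : val q g φ γ 2 = val q g φ γ 3 := hwalk 2 γ fun _ _ _ _ => hside 3 (by decide)
  have h30 : val q g φ (γ + 1) 3 = val q g φ (γ + 1) 0 := hwalk 3 (γ + 1) fun y _ h1 h2 =>
    absurd ((hz y h2).2.2.symm.trans h1) (hne γ)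
  have hne' : ∀ i j, i ≠ j → q.x i ≠ q.x j := fun i j => q.x_injective.ne
  have hf3 : f (q.x 3) = 0 := by
    simp [f, hzx, Pi.single_eq_of_ne (hne' 3 0 (by decide)), Pi.single_eq_of_ne (hne' 3 1 (by decide))]
  have hf0 : f (q.x 0) = -q.sign 0 := by
    simp [f, hzx, Pi.single_eq_of_ne (hne' 0 1 (by decide))]
  -- On the other white side the values at `x 3` and `x 0` agree. The closed path uses `x 0` but not
  -- `x 3`, so on the side `γ` they differ.
  refine ⟨φ, hφ, h01, h23, fun h => ?_⟩
  have h0 := hval 0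
  have h3 := hval 3
  rw [← h, ← h30, h3, hf3, hf0] at h0
  have h4 := congrArg (Int.cast : ℤ → ZMod 2) (q.sign_mul_self 0)
  push_cast at h4 h0
  have h5 : ∀ s : ZMod 2, s * s = 1 → 0 = -s → False := by decide
  exact h5 _ h4 h0

/-- Two paths on the same white side and on different black sides would have to cross. -/
theorem not_linked_flip (hg : IsWhiteSide q g) {γ : ZMod 2} (hL : Linked q g γ) :
    ¬ Linked q.flip g γ := by
  classical
  intro hL'
  obtain ⟨φ, hφ, h1, h2, h3⟩ := hL.exists_pattern hg
  obtain ⟨φ', hφ', h1', h2', h3'⟩ := hL'.exists_pattern hg.flip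
  -- An intersection number: for the product of the two patterns, the relation from the cut is `(a -
  -- b)(c - d) = 0` modulo 2, with `a ≠ b` and `c ≠ d`.
  have h4 := hg.sum_eq_zero (φ := fun h => φ h * φ' h) (fun h => by simp only [hφ h, hφ' h]) γ
    (fun b => if q.side b then 1 else 0) fun y hy _ => .inl (by simp only [side_iff q hy])
  have h5 : ∀ i, val q g (fun h => φ h * φ' h) γ i = val q g φ γ i * val q g φ' γ i := fun i => by
    simp only [val]
    split_ifs <;> rfl
  simp only [h5] at h4
  rw [ZMod.sum_univ_four] at h4
  have hw0 : ¬ q.side (q.w 0) := by rw [q.side_w]; decide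
  have hw1 : q.side (q.w 1) := by rw [q.side_w]; decide
  have hw2 : ¬ q.side (q.w 2) := by rw [q.side_w]; decide
  have hw3 : q.side (q.w 3) := by rw [q.side_w]; decide
  have hw4 : q.w (3 + 1) = q.w 0 := rfl
  have hw5 : q.w (0 + 1) = q.w 1 := rfl
  have hw6 : q.w (1 + 1) = q.w 2 := rfl
  have hw7 : q.w (2 + 1) = q.w 3 := rfl
  rw [hw4, hw5, hw6, hw7, if_neg hw0, if_pos hw1, if_neg hw2, if_pos hw3] at h4
  change val q g φ' γ 1 = val q g φ' γ 2 at h1'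
  change val q g φ' γ 3 = val q g φ' γ 0 at h2'
  change val q g φ' γ 0 ≠ val q g φ' γ 1 at h3'
  rw [h1, h2, ← h1', h2'] at h4
  rw [h1] at h3
  have h6 : ∀ a b c d : ZMod 2, a ≠ b → c ≠ d →
    (1 - 0) * (b * c) + (0 - 1) * (b * d) + (1 - 0) * (a * d) + (0 - 1) * (a * c) ≠ 0 := by decide
  exact h6 _ _ _ _ h3 h3' h4

/-- Two paths on the same black side and on different white sides would be branches. -/
theorem not_linked_add_one (hT : IsTilingSubgroup D.flows) (hg : IsWhiteSide q g)
    {γ : ZMod 2} (hL : Linked q g γ) : ¬ Linked q g (γ + 1) := by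
  classical
  intro hL'
  rw [← chessboardLattice_eq, chessboardLattice] at hT
  have hγ : ∀ γ : ZMod 2, γ ≠ γ + 1 := by decide
  -- A path in a quadrant is closed up by the new edge of the graph on the even side.
  have hpath : ∀ γ, Linked q g γ → ∃ p ∈ FlowLattice q.tail q.head, p none = 1 ∧
      ∀ e : q.EvenEdge, p (some e) ≠ 0 → g (e.1, 0) = γ := by
    rintro γ ⟨z, hz, hz'⟩
    refine ⟨fun e => e.elim 1 fun e => z e.1, ?_, rfl, fun e he => (hz _ he).2.2⟩
    rw [mem_flowLattice_iff]
    intro u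
    rw [Fintype.sum_option]
    change 1 * (u (q.w 0) - u (q.w 2)) + ∑ e : q.EvenEdge, z e.1 * (u (D.taitHead e.1) -
      u (D.taitTail e.1)) = 0
    rw [Fintype.sum_of_injective (fun e : q.EvenEdge => e.1) Subtype.val_injective _
      (fun y => z y * (u (D.taitHead y) - u (D.taitTail y))) (fun y hy => ?_) fun _ => rfl, hz']
    · ring
    · have h1 : z y = 0 := by
        by_contra h
        exact hy ⟨⟨y, (hz y h).1, (hz y h).2.1⟩, rfl⟩
      rw [h1, zero_mul]
  refine not_branching (q.gluing.isTilingSubgroup_fst_snd hT).1 (e₀ := none)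
    (S := fun e => ∃ e', e = some e' ∧ g (e'.1, 0) = γ) ⟨?_, fun f hf => ?_, ?_, ?_⟩
  · rintro ⟨e', h, -⟩
    cases h
  · obtain ⟨⟨F, hF⟩, hFf, -, -⟩ := q.gluing.exists_of_fst_snd ⟨f, hf⟩ 0 0
    -- Flows are split by cutting off their white potential to one white side. Off the 4-cycle both
    -- white corners lie on the same side, so each edge keeps its value or gets zero.
    obtain ⟨ψ, hψ, hψF⟩ := exists_whiteDiff D.isAlternating D.isConnected D.planar
      (D.chessboardLattice_eq ▸ hF : F ∈ D.flows)
    have hψ' : IsInvariant fun h => if g h = γ then ψ h else 0 := fun h => by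
      simp only [hg.inv h, hψ h]
    have hF' := whiteDiff_mem_flows D.isAlternating hψ'
    rw [← chessboardLattice_eq, chessboardLattice] at hF'
    have h1 : ∀ e : q.EvenEdge, whiteDiff (fun h => if g h = γ then ψ h else 0) e.1 =
        if g (e.1, 0) = γ then F e.1 else 0 := fun e => by
      rw [whiteDiff, ← hg.eq e.1 (ne_of_not_side q e.2.1 e.2.2), ← hψF, whiteDiff]
      split_ifs
      · rfl
      · rfl
    refine ⟨q.gluing.fst ⟨_, hF'⟩, (q.gluing.fst ⟨_, hF'⟩).2, ?_, fun e h2 h3 => ?_⟩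
    · rintro _ ⟨e, rfl, he⟩
      rw [q.fst_some, h1, if_pos he, ← q.fst_some hF, hFf]
    · cases e with
      | none => exact absurd rfl h3
      | some e => rw [q.fst_some, h1, if_neg fun h => h2 ⟨e, rfl, h⟩]
  · obtain ⟨p, hp, h1, h2⟩ := hpath _ hL
    refine ⟨p, hp, fun e h3 h4 => ?_, by rw [h1, mul_one]⟩
    cases e with
    | none => exact absurd rfl h4
    | some e =>
      by_contra h5
      exact h3 ⟨e, rfl, h2 e h5⟩
  · obtain ⟨p, hp, h1, h2⟩ := hpath _ hL'
    refine ⟨p, hp, ?_, by rw [h1, mul_one]⟩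
    rintro _ ⟨e, rfl, he⟩
    by_contra h5
    exact hγ γ (he.symm.trans (h2 e h5))

end IsWhiteSide

end AltDiagram

/-! ### Tangles with four ends -/

namespace DiagramCode

variable {C : DiagramCode} {S : C.HalfEdge → Prop} {e : ZMod 4 → C.HalfEdge}

/-- The half-edges of a tangle and of a crossing outside of it. -/
def contractMap (C : DiagramCode) (S : C.HalfEdge → Prop) (e : ZMod 4 → C.HalfEdge)
    (h : Option {y // ∀ j, S (y, j)} × ZMod 4) : C.HalfEdge :=
  h.1.elim (e h.2) fun y => (y.1, h.2)

open Classical in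
/-- The code that consists of a tangle with four ends and of one crossing outside. -/
noncomputable def contract (C : DiagramCode) (S : C.HalfEdge → Prop) (e : ZMod 4 → C.HalfEdge) :
    DiagramCode where
  Crossing := Option {y // ∀ j, S (y, j)}
  fintype := inferInstance
  decEq := inferInstance
  opp h := Function.invFun (C.contractMap S e) (C.opp (C.contractMap S e h))

/-- `S` consists of all half-edges of some crossings and of four half-edges of other crossings. -/
structure IsTangle (S : C.HalfEdge → Prop) (e : ZMod 4 → C.HalfEdge) : Prop where
  opp : ∀ h, S h → S (C.opp h)
  mem_iff : ∀ h, S h ↔ (∀ j, S (h.1, j)) ∨ ∃ p, h = e p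
  not_mem : ∀ p, ¬ ∀ j, S ((e p).1, j)
  injective : Function.Injective e
  isOver : ∀ p, IsOver (e p).2 ↔ IsOver p

namespace IsTangle

theorem contractMap_injective (hS : IsTangle S e) : Function.Injective (C.contractMap S e) := by
  rintro ⟨_ | y, i⟩ ⟨_ | z, j⟩ h
  · exact congrArg (Prod.mk none) (hS.injective h)
  · exact absurd z.2 (by
      rw [← show (e i).1 = z.1 from congrArg Prod.fst h]
      exact hS.not_mem i)
  · exact absurd y.2 (by
      rw [show y.1 = (e j).1 from congrArg Prod.fst h]
      exact hS.not_mem j)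
  · exact Prod.ext (congrArg some (Subtype.ext (congrArg Prod.fst h))) (congrArg Prod.snd h :)

theorem exists_contractMap (hS : IsTangle S e) {h : C.HalfEdge} (hh : S h) :
    ∃ z, C.contractMap S e z = h := by
  rcases (hS.mem_iff h).1 hh with h1 | ⟨p, rfl⟩
  · exact ⟨(some ⟨h.1, h1⟩, h.2), rfl⟩
  · exact ⟨(none, p), rfl⟩

theorem contractMap_mem (hS : IsTangle S e) (z : (C.contract S e).HalfEdge) :
    S (C.contractMap S e z) := by
  obtain ⟨_ | y, i⟩ := z
  · exact (hS.mem_iff _).2 (.inr ⟨i, rfl⟩)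
  · exact y.2 i

theorem contractMap_opp (hS : IsTangle S e) (z : (C.contract S e).HalfEdge) :
    C.contractMap S e ((C.contract S e).opp z) = C.opp (C.contractMap S e z) :=
  Function.invFun_eq (hS.exists_contractMap (hS.opp _ (hS.contractMap_mem z)))

theorem isAlternating (hS : IsTangle S e) (hA : C.IsAlternating) :
    (C.contract S e).IsAlternating := by
  have hover : ∀ z : (C.contract S e).HalfEdge, IsOver (C.contractMap S e z).2 ↔ IsOver z.2 := by
    rintro ⟨_ | y, i⟩
    · exact hS.isOver i
    · exact Iff.rfl
  refine ⟨fun z => hS.contractMap_injective ?_, fun z => ?_⟩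
  · rw [hS.contractMap_opp, hS.contractMap_opp, hA.opp_opp]
  · rw [← hover, hS.contractMap_opp, hA.alternating, hover]

/-- A nonempty closed set of crossings that avoids the outer crossing would be closed in the whole
diagram too. So every such set contains the outer crossing, and so does its complement if nonempty.
-/
theorem isConnected (hS : IsTangle S e) (hA : C.IsAlternating) (hC : C.IsConnected) :
    (C.contract S e).IsConnected := by
  classical
  have hnone : ∀ (P : (C.contract S e).Crossing → Prop) (hP : ∀ h : (C.contract S e).HalfEdge,
      P h.1 → P ((C.contract S e).opp h).1) (x), P x → P none := by
    intro P hP x hx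
    by_contra h0
    let P' : C.Crossing → Prop := fun y => ∃ hy : ∀ j, S (y, j), P (some ⟨y, hy⟩)
    obtain _ | x := x
    · exact h0 hx
    have := hC P' (fun h ⟨hy, h1⟩ => by
      have h2 := hP (some ⟨h.1, hy⟩, h.2) h1
      have h3 := hS.contractMap_opp (some ⟨h.1, hy⟩, h.2)
      generalize hz : (C.contract S e).opp (some ⟨h.1, hy⟩, h.2) = z at h2 h3
      obtain ⟨_ | z, j⟩ := z
      · exact absurd h2 h0
      · have h4 : C.opp h = (z.1, j) := h3.symm
        rw [h4]
        exact ⟨z.2, h2⟩) x.1 (e 0).1 ⟨x.2, hx⟩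
    exact hS.not_mem 0 this.1
  intro P hP x y hx
  by_contra hy
  have hP' : ∀ h : (C.contract S e).HalfEdge, ¬ P h.1 → ¬ P ((C.contract S e).opp h).1 := by
    intro h h1 h2
    refine h1 ?_
    have := hP _ h2
    rwa [(hS.isAlternating hA).opp_opp] at this
  exact hnone (fun z => ¬ P z) hP' y hy (hnone P hP x hx)

end IsTangle

/-- A code with a circle between two tangles is a composition. -/
theorem iso_compose (hA : C.IsAlternating) {C₁ C₂ : DiagramCode} {c₁ : C₁.Crossing}
    {c₂ : C₂.Crossing} {x : ZMod 4 → C.Crossing} {k : ZMod 4 → ZMod 4}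
    (hk : ∀ p, IsOver (k p) ↔ IsOver p)
    (hopp : ∀ p, C.opp (x p, k p + 1) = (x (p + 1), k (p + 1) - 1))
    {m₁ : C₁.HalfEdge → C.HalfEdge} {m₂ : C₂.HalfEdge → C.HalfEdge}
    {y₁ : {y // y ≠ c₁} → C.Crossing} {y₂ : {y // y ≠ c₂} → C.Crossing}
    (ho₁ : ∀ z, m₁ (C₁.opp z) = C.opp (m₁ z)) (ho₂ : ∀ z, m₂ (C₂.opp z) = C.opp (m₂ z))
    (hm₁ : ∀ p, m₁ (c₁, p) = (x p, k p)) (hm₂ : ∀ q, m₂ (c₂, q) = (x (-q), k (-q) + 2))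
    (hy₁ : ∀ y i, m₁ (y.1, i) = (y₁ y, i)) (hy₂ : ∀ y i, m₂ (y.1, i) = (y₂ y, i))
    (hbij : Function.Bijective (Sum.elim y₁ (Sum.elim y₂ x))) :
    C.Iso (C₁.compose C₂ c₁ c₂ 0) ∧
      Fintype.card C.Crossing + 2 = Fintype.card C₁.Crossing + Fintype.card C₂.Crossing + 4 := by
  constructor
  swap
  · rw [← Fintype.card_congr (Equiv.ofBijective _ hbij), Fintype.card_sum, Fintype.card_sum,
      ← Fintype.card_congr (Equiv.optionSubtypeNe c₁), ← Fintype.card_congr (Equiv.optionSubtypeNe c₂),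
      Fintype.card_option, Fintype.card_option, ZMod.card]
    ring
  let f : (C₁.compose C₂ c₁ c₂ 0).Crossing ≃ C.Crossing := Equiv.ofBijective _ hbij
  -- The new crossing `p` is turned so that its half-edge towards the first tangle gets number `p`.
  -- By `hk` the turn preserves the under-strand.
  let r : (C₁.compose C₂ c₁ c₂ 0).Crossing → ZMod 4 :=
    Sum.elim (fun _ => 0) (Sum.elim (fun _ => 0) fun p => k p - p)
  let M : (C₁.compose C₂ c₁ c₂ 0).HalfEdge → C.HalfEdge := fun z => (f z.1, z.2 + r z.1)
  have hMc : ∀ p i, M (circle p i) = (x p, i + (k p - p)) := fun _ _ => rfl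
  have hMl : ∀ z, M (leftMap z) = m₁ z := by
    rintro ⟨y, i⟩
    by_cases hy : y = c₁
    · subst hy
      rw [leftMap_self, hMc, hm₁, add_sub_cancel]
    · rw [leftMap_ne ⟨y, hy⟩, hy₁ ⟨y, hy⟩]
      exact Prod.ext rfl (add_zero i)
  have hMr : ∀ z, M (rightMap z) = m₂ z := by
    rintro ⟨y, i⟩
    by_cases hy : y = c₂
    · subst hy
      rw [rightMap_self, hMc, hm₂, zero_sub]
      exact Prod.ext rfl (by ring)
    · rw [rightMap_ne ⟨y, hy⟩, hy₂ ⟨y, hy⟩]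
      exact Prod.ext rfl (add_zero i)
  have key : ∀ z, C.opp (M z) = M ((C₁.compose C₂ c₁ c₂ 0).opp z) := by
    refine compose_cases (fun h => ?_) (fun h => ?_) (fun p => ?_) fun p => ?_
    · rw [opp_leftMap, hMl, hMl, ho₁]
    · rw [opp_rightMap, hMr, hMr, ho₂]
    · rw [opp_circle_next, hMc, hMc, show p + 1 + (k p - p) = k p + 1 by ring, hopp]
      exact Prod.ext rfl (by ring)
    · have h1 := hopp (p - 1)
      rw [sub_add_cancel] at h1
      rw [opp_circle_prev, hMc, hMc, show p - 1 + (k p - p) = k p - 1 by ring, ← h1, hA.opp_opp]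
      exact Prod.ext rfl (by ring)
  refine Iso.symm ⟨f, r, ?_, fun y i => key (y, i)⟩
  have h0 : ∀ i p : ZMod 4, (IsOver i ↔ IsOver p) → i - p = 0 ∨ i - p = 2 := by decide
  rintro (y | y | p)
  · exact .inl rfl
  · exact .inl rfl
  · exact h0 _ _ (hk p)

end DiagramCode

namespace AltDiagram

open DiagramCode

variable {D : AltDiagram}

/-- A circle with four crossings between two tangles makes the diagram a composition. -/
theorem exists_isComposition {x : ZMod 4 → D.Crossing} {k : ZMod 4 → ZMod 4}
    (hx : Function.Injective x) (hk : ∀ p, IsOver (k p) ↔ IsOver p)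
    (hopp : ∀ p, D.opp (x p, k p + 1) = (x (p + 1), k (p + 1) - 1)) {S₁ S₂ : D.HalfEdge → Prop}
    (h₁ : ∀ h, S₁ h → S₁ (D.opp h)) (h₂ : ∀ h, S₂ h → S₂ (D.opp h))
    (hS₁ : ∀ p j, S₁ (x p, j) ↔ j = k p) (hS₂ : ∀ p j, S₂ (x p, j) ↔ j = k p + 2)
    (hdisj : ∀ h, S₁ h → ¬ S₂ h)
    (hcover : ∀ y, (∀ p, y ≠ x p) → (∀ j, S₁ (y, j)) ∨ ∀ j, S₂ (y, j)) :
    ∃ D₁ D₂ : AltDiagram, D.IsComposition D₁ D₂ ∧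
      Fintype.card D₁.Crossing < Fintype.card D.Crossing ∧
      Fintype.card D₂.Crossing < Fintype.card D.Crossing := by
  classical
  have hA := D.isAlternating
  have k1 : ∀ i : ZMod 4, i + 1 ≠ i := by decide
  have k2 : ∀ i : ZMod 4, i + 1 ≠ i + 2 := by decide
  have hn₁ : ∀ p, ¬ ∀ j, S₁ (x p, j) := fun p h => k1 _ ((hS₁ p _).1 (h (k p + 1)))
  have hn₂ : ∀ p, ¬ ∀ j, S₂ (x p, j) := fun p h => k2 _ ((hS₂ p _).1 (h (k p + 1)))
  let e₁ : ZMod 4 → D.HalfEdge := fun p => (x p, k p)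
  -- Seen from the second tangle, the circle is traversed in the opposite direction, so the ends are
  -- numbered backwards.
  let e₂ : ZMod 4 → D.HalfEdge := fun q => (x (-q), k (-q) + 2)
  have hT₁ : IsTangle S₁ e₁ := by
    refine ⟨h₁, fun h => ⟨fun hh => ?_, ?_⟩, hn₁, fun p q h => hx (congrArg Prod.fst h), hk⟩
    · by_cases h3 : ∃ p, h.1 = x p
      · obtain ⟨p, hp⟩ := h3
        refine .inr ⟨p, Prod.ext hp ?_⟩
        rw [show h = (x p, h.2) from Prod.ext hp rfl, hS₁] at hh
        exact hh
      · exact .inl ((hcover h.1 (by simpa using h3)).resolve_right fun h4 => hdisj h hh (h4 h.2))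
    · rintro (h3 | ⟨p, rfl⟩)
      · exact h3 h.2
      · exact (hS₁ p _).2 rfl
  have hT₂ : IsTangle S₂ e₂ := by
    refine ⟨h₂, fun h => ⟨fun hh => ?_, ?_⟩, fun q => hn₂ (-q),
      fun p q h => neg_injective (hx (congrArg Prod.fst h)), fun q => ?_⟩
    · by_cases h3 : ∃ p, h.1 = x p
      · obtain ⟨p, hp⟩ := h3
        refine .inr ⟨-p, ?_⟩
        rw [show h = (x p, h.2) from Prod.ext hp rfl, hS₂] at hh
        simp only [e₂, neg_neg]
        exact Prod.ext hp hh
      · exact .inl ((hcover h.1 (by simpa using h3)).resolve_left fun h4 => hdisj h (h4 h.2) hh)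
    · rintro (h3 | ⟨q, rfl⟩)
      · exact h3 h.2
      · exact (hS₂ _ _).2 rfl
    · have h3 : ∀ i : ZMod 4, IsOver (i + 2) ↔ IsOver i := by decide
      have h4 : ∀ i : ZMod 4, IsOver (-i) ↔ IsOver i := by decide
      rw [h3, hk, h4]
  have hA₁ := hT₁.isAlternating hA
  have hA₂ := hT₂.isAlternating hA
  have hC₁ := hT₁.isConnected hA D.isConnected
  have hC₂ := hT₂.isConnected hA D.isConnected
  have ho₁ := hT₁.contractMap_opp
  have ho₂ := hT₂.contractMap_opp
  let m₁ : (D.contract S₁ e₁).HalfEdge → D.HalfEdge := D.contractMap S₁ e₁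
  let m₂ : (D.contract S₂ e₂).HalfEdge → D.HalfEdge := D.contractMap S₂ e₂
  have hm₁ : ∀ p, m₁ (none, p) = (x p, k p) := fun _ => rfl
  have hm₂ : ∀ q, m₂ (none, q) = (x (-q), k (-q) + 2) := fun _ => rfl
  change ∀ z, m₁ _ = D.opp (m₁ z) at ho₁
  change ∀ z, m₂ _ = D.opp (m₂ z) at ho₂
  let s₁ : {y : (D.contract S₁ e₁).Crossing // y ≠ none} → {y // ∀ j, S₁ (y, j)} := fun y =>
    y.1.get (Option.ne_none_iff_isSome.1 y.2)
  let s₂ : {y : (D.contract S₂ e₂).Crossing // y ≠ none} → {y // ∀ j, S₂ (y, j)} := fun y =>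
    y.1.get (Option.ne_none_iff_isSome.1 y.2)
  have hs₁ : ∀ y, y.1 = some (s₁ y) := fun y => (Option.some_get _).symm
  have hs₂ : ∀ y, y.1 = some (s₂ y) := fun y => (Option.some_get _).symm
  obtain ⟨hiso, hcard⟩ := iso_compose hA hk hopp (y₁ := fun y => (s₁ y).1)
    (y₂ := fun y => (s₂ y).1) ho₁ ho₂ hm₁ hm₂ (fun y i => by rw [hs₁]; rfl)
    (fun y i => by rw [hs₂]; rfl) (by
      constructor
      · rintro (a | a | a) (b | b | b) hab
        · exact congrArg Sum.inl (Subtype.ext ((hs₁ a).trans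
            ((congrArg some (Subtype.ext hab)).trans (hs₁ b).symm)))
        · exact absurd ((s₂ b).2 0) (by
            rw [← show (s₁ a).1 = (s₂ b).1 from hab]
            exact hdisj _ ((s₁ a).2 0))
        · exact absurd (s₁ a).2 (by rw [show (s₁ a).1 = x b from hab]; exact hn₁ b)
        · exact absurd ((s₂ a).2 0) (by
            rw [show (s₂ a).1 = (s₁ b).1 from hab]
            exact hdisj _ ((s₁ b).2 0))
        · exact congrArg (Sum.inr ∘ Sum.inl) (Subtype.ext ((hs₂ a).trans
            ((congrArg some (Subtype.ext hab)).trans (hs₂ b).symm)))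
        · exact absurd (s₂ a).2 (by rw [show (s₂ a).1 = x b from hab]; exact hn₂ b)
        · exact absurd (s₁ b).2 (by rw [← show x a = (s₁ b).1 from hab]; exact hn₁ a)
        · exact absurd (s₂ b).2 (by rw [← show x a = (s₂ b).1 from hab]; exact hn₂ a)
        · exact congrArg (Sum.inr ∘ Sum.inr) (hx hab)
      · intro y
        by_cases h3 : ∃ p, y = x p
        · obtain ⟨p, rfl⟩ := h3
          exact ⟨.inr (.inr p), rfl⟩
        rcases hcover y (by simpa using h3) with h4 | h4
        · exact ⟨.inl ⟨some ⟨y, h4⟩, Option.some_ne_none _⟩, rfl⟩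
        · exact ⟨.inr (.inl ⟨some ⟨y, h4⟩, Option.some_ne_none _⟩), rfl⟩)
  -- With `c + 2 = c₁ + c₂ + 4`, the bounds `R ≤ R₁ + R₂` and `Rᵢ ≤ cᵢ + 2` are equalities, so both
  -- tangles close up on the sphere.
  have hp := D.planar ⟨x 0⟩
  have hle₁ := card_region_le hA₁ hC₁ none
  have hle₂ := card_region_le hA₂ hC₂ none
  have hle := card_region_compose (C₁ := D.contract S₁ e₁) (C₂ := D.contract S₂ e₂) (c₁ := none)
    (c₂ := none) (s := 0)
  rw [← hiso.card_region] at hle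
  have hpos₁ : 0 < Fintype.card (D.contract S₁ e₁).Crossing := Fintype.card_pos_iff.2 ⟨none⟩
  have hpos₂ : 0 < Fintype.card (D.contract S₂ e₂).Crossing := Fintype.card_pos_iff.2 ⟨none⟩
  refine ⟨ofCode _ hA₁ hC₁ fun _ => ?_, ofCode _ hA₂ hC₂ fun _ => ?_,
    ⟨none, none, 0, .inl rfl, hiso⟩, ?_, ?_⟩
  · omega
  · omega
  · change Fintype.card (D.contract S₁ e₁).Crossing < _
    omega
  · change Fintype.card (D.contract S₂ e₂).Crossing < _
    omega

end AltDiagram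

/-! ### Finding the circle: unlinked quadrants contain no crossings -/

namespace DiagramCode

variable {C : DiagramCode}

/-- Two half-edges next to the same black and white regions belong to the same edge. Being
different, they are its two ends. -/
theorem SeparatesEdges.opp_eq (hA : C.IsAlternating) (hC : C.SeparatesEdges) {h k : C.HalfEdge}
    (hb : rg (blackCorner h) = rg (blackCorner k)) (hw : rg (whiteCorner h) = rg (whiteCorner k))
    (hne : h ≠ k) : C.opp h = k := by
  have key : ∀ {h k : C.HalfEdge}, IsOver h.2 → ¬ IsOver k.2 →
      rg (blackCorner h) = rg (blackCorner k) → rg (whiteCorner h) = rg (whiteCorner k) →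
      h = C.opp k := by
    intro h k hh hk hb hw
    rw [blackCorner, if_pos hh, blackCorner, if_neg hk] at hb
    rw [whiteCorner, if_pos hh, whiteCorner, if_neg hk] at hw
    refine hC _ _ ?_ ?_
    · rw [hb, isInvariant_rg.right_eq hA]
    · rw [hw, isInvariant_rg]
  by_cases hh : IsOver h.2 <;> by_cases hk : IsOver k.2
  · rw [blackCorner, if_pos hh, blackCorner, if_pos hk] at hb
    rw [whiteCorner, if_pos hh, whiteCorner, if_pos hk] at hw
    exact absurd (hC _ _ hb hw) hne
  · rw [key hh hk hb hw, hA.opp_opp]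
  · exact (key hk hh hb.symm hw.symm).symm
  · rw [blackCorner, if_neg hh, blackCorner, if_neg hk] at hb
    rw [whiteCorner, if_neg hh, whiteCorner, if_neg hk] at hw
    exact absurd (hC _ _ hw hb) hne

end DiagramCode

namespace AltDiagram

open DiagramCode

variable {D : AltDiagram}

theorem black_eq_or (q : Square D.taitTail D.taitHead) (i j : ZMod 4) :
    black (D := D) (q.x i, j) = q.w i ∨ black (D := D) (q.x i, j) = q.w (i + 1) := by
  have h1 : black (D := D) (q.x i, j) = D.taitHead (q.x i) ∨
      black (D := D) (q.x i, j) = D.taitTail (q.x i) := by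
    match j with
    | 0 => exact .inl rfl
    | 1 => exact .inr rfl
    | 2 => exact .inr rfl
    | 3 => exact .inl rfl
  rcases q.ends i with ⟨h2, h3⟩ | ⟨h2, h3⟩ <;> rw [h2, h3] at h1 <;> tauto

open Classical in
/-- The position of a half-edge relative to the cut. -/
noncomputable def blackSide (q : Square D.taitTail D.taitHead) (h : D.HalfEdge) : ZMod 2 :=
  if q.side (black h) then 1 else 0

theorem blackSide_flip (q : Square D.taitTail D.taitHead) (h : D.HalfEdge) :
    blackSide q.flip h = blackSide q h + 1 := by
  have h1 : q.flip.side (black h) ↔ ¬ q.side (black h) := Iff.rfl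
  by_cases h2 : q.side (black h)
  · rw [blackSide, blackSide, if_pos h2, if_neg (by rwa [h1, not_not])]
    rfl
  · rw [blackSide, blackSide, if_neg h2, if_pos (by rwa [h1])]
    rfl

theorem blackSide_opp (q : Square D.taitTail D.taitHead) (h : D.HalfEdge) :
    blackSide q (D.opp h) = blackSide q h := by rw [blackSide, black_opp, blackSide]

theorem blackSide_eq_zero_iff (q : Square D.taitTail D.taitHead) (h : D.HalfEdge) :
    blackSide q h = 0 ↔ ¬ q.side (black h) := by
  rw [blackSide]
  split_ifs with h1 <;> simp [h1]

namespace IsWhiteSide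

variable {q : Square D.taitTail D.taitHead} {g φ : D.HalfEdge → ZMod 2}

theorem black_eq_of_not_side {i j : ZMod 4} (hi : IsOver i)
    (hj : blackSide q (q.x i, j) = 0) : black (D := D) (q.x i, j) = q.w (i + 1) := by
  rw [blackSide_eq_zero_iff] at hj
  refine (black_eq_or q i j).resolve_left fun h => hj ?_
  rw [h, q.side_w]
  exact hi

theorem black_eq_of_not_side' {i j : ZMod 4} (hi : ¬ IsOver i)
    (hj : blackSide q (q.x i, j) = 0) : black (D := D) (q.x i, j) = q.w i := by
  rw [blackSide_eq_zero_iff] at hj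
  refine (black_eq_or q i j).resolve_right fun h => hj ?_
  rw [h, q.side_w, isOver_add_one]
  exact hi

/-- Without a path on one side, two crossings of the 4-cycle are joined directly. -/
theorem opp_eq (hg : IsWhiteSide q g) (hs : D.SeparatesEdges) {γ : ZMod 2} (hL : ¬ Linked q g γ)
    {i j j' : ZMod 4} (hi : IsOver i) (hj : blackSide q (q.x i, j) = 0)
    (hγ : g (whiteCorner (q.x i, j)) = γ) (hj' : blackSide q (q.x (i + 1), j') = 0)
    (hγ' : g (whiteCorner (q.x (i + 1), j')) = γ) : D.opp (q.x i, j) = (q.x (i + 1), j') := by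
  classical
  have hb := black_eq_of_not_side hi hj
  have hb' := black_eq_of_not_side' (by rw [isOver_add_one]; exact not_not.2 hi) hj'
  refine hs.opp_eq D.isAlternating (congrArg Subtype.val (hb.trans hb'.symm)) ?_ fun h => ?_
  swap
  · have h1 : ∀ i : ZMod 4, i ≠ i + 1 := by decide
    exact h1 _ (q.x_injective (congrArg Prod.fst h))
  rw [rg_eq_iff]
  intro φ hφ
  rw [← hg.val_eq (φ := φ) hγ, ← hg.val_eq (φ := φ) hγ']
  obtain ⟨K, hK0, hK2, hK⟩ := exists_separating hL
  have hw0 : ¬ q.side (q.w 0) := by rw [q.side_w]; decide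
  have hw1 : q.side (q.w 1) := by rw [q.side_w]; decide
  have hw2 : ¬ q.side (q.w 2) := by rw [q.side_w]; decide
  have hw3 : q.side (q.w 3) := by rw [q.side_w]; decide
  -- The even vertices are divided into `K` and its complement without an edge between them in this
  -- quadrant. Each class meets the 4-cycle in one vertex, so the relation compares the white values
  -- at the two edges of the 4-cycle at this vertex.
  have hsum : ∀ P : Prop → Prop,
      ∑ i, ((if ¬ q.side (q.w (i + 1)) ∧ P (K (q.w (i + 1))) then (1 : ZMod 2) else 0) -
        if ¬ q.side (q.w i) ∧ P (K (q.w i)) then 1 else 0) * val q g φ γ i = 0 := fun P => by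
    refine hg.sum_eq_zero hφ γ (fun b => if ¬ q.side b ∧ P (K b) then 1 else 0) fun y hy h1 => .inl ?_
    have h2 := side_iff q hy
    by_cases h3 : q.side (D.taitTail y)
    · rw [if_neg (fun h => h.1 h3), if_neg (fun h => h.1 (h2.1 h3))]
    · have h4 := propext (hK y h3 (fun h => h3 (h2.2 h)) h1)
      simp only [h2, h4]
  have hw4 : q.w (3 + 1) = q.w 0 := rfl
  have hw6 : q.w (1 + 1) = q.w 2 := rfl
  have hw7 : q.w (2 + 1) = q.w 3 := rfl
  rcases hi with rfl | rfl
  · have h1 := hsum Not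
    rw [ZMod.sum_univ_four] at h1
    simp only [hw4, hw6, hw7, hw0, hw1, hw2, hw3, hK0, hK2, not_true, not_false_eq_true,
      false_and, and_true, and_false, if_true, if_false, sub_self, zero_mul, zero_add, add_zero,
      zero_sub, sub_zero, one_mul, neg_one_mul] at h1
    change val q g φ γ 1 = val q g φ γ 2
    exact eq_of_sub_eq_zero (by linear_combination h1)
  · have h1 := hsum id
    rw [ZMod.sum_univ_four] at h1
    simp only [hw4, hw6, hw7, hw0, hw1, hw2, hw3, hK0, hK2, not_true, not_false_eq_true, id,
      false_and, and_true, and_false, if_true, if_false, sub_self, zero_mul, zero_add, add_zero,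
      zero_sub, sub_zero, one_mul, neg_one_mul] at h1
    change val q g φ γ 3 = val q g φ γ 0
    exact eq_of_sub_eq_zero (by linear_combination h1)

/-- The four half-edges at a crossing of the 4-cycle. -/
theorem label (hg : IsWhiteSide q g) (i j : ZMod 4) :
    (IsOver j → blackSide q (q.x i, j + 1) = blackSide q (q.x i, j) ∧
      g (whiteCorner (q.x i, j + 1)) = g (whiteCorner (q.x i, j)) + 1) ∧
    (¬ IsOver j → blackSide q (q.x i, j + 1) = blackSide q (q.x i, j) + 1 ∧
      g (whiteCorner (q.x i, j + 1)) = g (whiteCorner (q.x i, j))) := by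
  have h1 : g (q.x i, 2) = g (q.x i, 0) + 1 := by
    have h2 : ∀ a b : ZMod 2, a ≠ b → b = a + 1 := by decide
    exact h2 _ _ (hg.ne i)
  have h2 : blackSide q (q.x i, 1) = blackSide q (q.x i, 0) + 1 := by
    have h3 := q.not_side_iff i
    rw [blackSide, blackSide, black_zero, black_one]
    by_cases h4 : q.side (D.taitTail (q.x i))
    · rw [if_pos h4, if_neg (by tauto)]
      rfl
    · rw [if_neg h4, if_pos (by tauto)]
      rfl
  have h3 : blackSide q (q.x i, 2) = blackSide q (q.x i, 1) := rfl
  have h4 : blackSide q (q.x i, 3) = blackSide q (q.x i, 0) := rfl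
  obtain ⟨-, -, -, -, w0, w1, w2, w3⟩ := corners (C := D.toDiagramCode) (q.x i)
  have h5 : ∀ a : ZMod 2, a = a + 1 + 1 := by decide
  match j with
  | 0 =>
    refine ⟨fun h => absurd h (by decide), fun _ => ⟨h2, ?_⟩⟩
    change g (whiteCorner (q.x i, 1)) = _
    rw [w0, w1]
  | 1 =>
    refine ⟨fun _ => ⟨h3, ?_⟩, fun h => absurd (by decide) h⟩
    change g (whiteCorner (q.x i, 2)) = _
    rw [w1, w2, h1]
  | 2 =>
    refine ⟨fun h => absurd h (by decide), fun _ => ⟨?_, ?_⟩⟩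
    · change blackSide q (q.x i, 3) = _
      rw [h3, h4, h2]
      exact h5 _
    · change g (whiteCorner (q.x i, 3)) = _
      rw [w3, w2]
  | 3 =>
    refine ⟨fun _ => ⟨h4.symm, ?_⟩, fun h => absurd (by decide) h⟩
    change g (whiteCorner (q.x i, 0)) = _
    rw [w3, w0, h1]
    exact h5 _

theorem exists_label (hg : IsWhiteSide q g) (i : ZMod 4) (β γ : ZMod 2) :
    ∃ j, blackSide q (q.x i, j) = β ∧ g (whiteCorner (q.x i, j)) = γ := by
  obtain ⟨-, h0⟩ := hg.label i 0
  obtain ⟨h1, -⟩ := hg.label i 1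
  obtain ⟨-, h2⟩ := hg.label i 2
  obtain ⟨a0, b0⟩ := h0 (by decide)
  obtain ⟨a1, b1⟩ := h1 (by decide)
  obtain ⟨a2, b2⟩ := h2 (by decide)
  rw [show (0 : ZMod 4) + 1 = 1 from rfl] at a0 b0
  rw [show (1 : ZMod 4) + 1 = 2 from rfl] at a1 b1
  rw [show (2 : ZMod 4) + 1 = 3 from rfl] at a2 b2
  have key : ∀ a b β γ : ZMod 2, (a = β ∧ b = γ) ∨ (a + 1 = β ∧ b = γ) ∨ (a + 1 = β ∧ b + 1 = γ) ∨
    (a + 1 + 1 = β ∧ b + 1 = γ) := by decide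
  rcases key (blackSide q (q.x i, 0)) (g (whiteCorner (q.x i, 0))) β γ with h | h | h | h
  · exact ⟨0, h⟩
  · exact ⟨1, by rwa [a0, b0]⟩
  · exact ⟨2, by rwa [a1, b1, a0, b0]⟩
  · exact ⟨3, by rwa [a2, b2, a1, b1, a0, b0]⟩

theorem label_const (hg : IsWhiteSide q g) {y : D.Crossing} (hy : ∀ i, y ≠ q.x i) (j : ZMod 4) :
    blackSide q (y, j) = blackSide q (y, 0) ∧ g (whiteCorner (y, j)) = g (y, 0) := by
  obtain ⟨-, -, -, -, w0, w1, w2, w3⟩ := corners (C := D.toDiagramCode) y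
  have h1 : blackSide q (y, 1) = blackSide q (y, 0) := by
    rw [blackSide, blackSide, black_zero, black_one]
    have h2 := side_iff q hy
    by_cases h3 : q.side (D.taitTail y)
    · rw [if_pos h3, if_pos (h2.1 h3)]
    · rw [if_neg h3, if_neg fun h => h3 (h2.2 h)]
  revert j
  rw [ZMod.forall_four, w0, w1, w2, w3]
  exact ⟨⟨rfl, rfl⟩, ⟨h1, rfl⟩, ⟨h1, (hg.eq y hy).symm⟩, ⟨rfl, (hg.eq y hy).symm⟩⟩

/-- Without a path on one side, this side contains no crossings. -/
theorem not_label (hg : IsWhiteSide q g) (hs : D.SeparatesEdges) {γ : ZMod 2}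
    (hL : ¬ Linked q g γ) {y : D.Crossing} (hy : ∀ i, y ≠ q.x i)
    (hb : blackSide q (y, 0) = 0) : g (y, 0) ≠ γ := by
  intro hγ
  -- In an unlinked quadrant, the half-edges at the 4-cycle are joined only among each other. A
  -- crossing in the quadrant could not be connected to the 4-cycle.
  have hsq : ∀ i j, blackSide q (q.x i, j) = 0 → g (whiteCorner (q.x i, j)) = γ →
      ∃ i', (D.opp (q.x i, j)).1 = q.x i' := by
    intro i j h1 h2
    by_cases hi : IsOver i
    · obtain ⟨j', h3, h4⟩ := hg.exists_label (i + 1) 0 γ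
      exact ⟨i + 1, by rw [hg.opp_eq hs hL hi h1 h2 h3 h4]⟩
    · obtain ⟨j', h3, h4⟩ := hg.exists_label (i - 1) 0 γ
      have h5 : IsOver (i - 1) := by rwa [isOver_sub_one]
      have h6 := hg.opp_eq hs hL (j' := j) h5 h3 h4 (by rwa [sub_add_cancel])
        (by rwa [sub_add_cancel])
      rw [sub_add_cancel] at h6
      exact ⟨i - 1, by rw [← h6, D.opp_opp]⟩
  have := D.isConnected (fun y => (∀ i, y ≠ q.x i) ∧ blackSide q (y, 0) = 0 ∧ g (y, 0) = γ)
    (fun h ⟨h1, h2, h3⟩ => by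
      generalize h' : D.opp h = z
      obtain ⟨y', j'⟩ := z
      have h4 : blackSide q (y', j') = 0 := by
        rw [← h', blackSide_opp]
        exact (hg.label_const h1 h.2).1.trans h2
      have h5 : g (whiteCorner (y', j')) = γ := by
        rw [← h', hg.inv.whiteCorner_opp D.isAlternating]
        exact (hg.label_const h1 h.2).2.trans h3
      have h6 : ∀ i, y' ≠ q.x i := by
        rintro i rfl
        obtain ⟨i', h7⟩ := hsq i j' h4 h5
        rw [← h', D.opp_opp] at h7
        exact h1 i' h7
      exact ⟨h6, (hg.label_const h6 j').1.symm.trans h4, (hg.label_const h6 j').2.symm.trans h5⟩)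
    y (q.x 0) ⟨hy, hb, hγ⟩
  exact this.1 0 rfl

end IsWhiteSide

end AltDiagram

namespace AltDiagram

open DiagramCode

variable {D : AltDiagram}

namespace IsWhiteSide

variable {q : Square D.taitTail D.taitHead} {g : D.HalfEdge → ZMod 2}

/-- Quadrants that share a black or a white side are not both linked, so linked quadrants lie on one
diagonal and the other diagonal is free. -/
theorem exists_not_linked (hT : IsTilingSubgroup D.flows) (hg : IsWhiteSide q g) :
    ∃ γ, ¬ Linked q g γ ∧ ¬ Linked q.flip g (γ + 1) := by
  have h11 : (1 : ZMod 2) + 1 = 0 := rfl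
  by_cases h0 : Linked q g 0
  · refine ⟨1, hg.not_linked_add_one hT h0, ?_⟩
    rw [h11]
    exact hg.not_linked_flip h0
  by_cases h1 : Linked q.flip g 1
  · refine ⟨1, fun h => hg.not_linked_flip h h1, ?_⟩
    exact hg.flip.not_linked_add_one hT h1
  · exact ⟨0, h0, h1⟩

theorem label_add_two (hg : IsWhiteSide q g) (i j : ZMod 4) :
    blackSide q (q.x i, j + 2) = blackSide q (q.x i, j) + 1 ∧
      g (whiteCorner (q.x i, j + 2)) = g (whiteCorner (q.x i, j)) + 1 := by
  obtain ⟨h1, h2⟩ := hg.label i j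
  obtain ⟨h3, h4⟩ := hg.label i (j + 1)
  rw [isOver_add_one, add_assoc] at h3 h4
  change _ → blackSide q (q.x i, j + 2) = _ ∧ g (whiteCorner (q.x i, j + 2)) = _ at h3 h4
  by_cases h : IsOver j
  · rw [(h4 (not_not.2 h)).1, (h4 (not_not.2 h)).2, (h1 h).1, (h1 h).2]
    exact ⟨rfl, rfl⟩
  · rw [(h3 h).1, (h3 h).2, (h2 h).1, (h2 h).2]
    exact ⟨rfl, rfl⟩

theorem label_injective (hg : IsWhiteSide q g) (i : ZMod 4) :
    Function.Injective fun j => (blackSide q (q.x i, j), g (whiteCorner (q.x i, j))) := by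
  refine (Finite.injective_iff_surjective_of_equiv
    (Fintype.equivOfCardEq (α := ZMod 4) (β := ZMod 2 × ZMod 2) rfl)).2 ?_
  rintro ⟨β, γ⟩
  obtain ⟨j, h1, h2⟩ := hg.exists_label i β γ
  exact ⟨j, Prod.ext h1 h2⟩

/-- The 4-cycle gives rise to a circle that separates the diagram into two tangles. -/
theorem exists_isComposition (hT : IsTilingSubgroup D.flows) (hs : D.SeparatesEdges)
    (hg : IsWhiteSide q g) : ∃ D₁ D₂ : AltDiagram, D.IsComposition D₁ D₂ ∧
      Fintype.card D₁.Crossing < Fintype.card D.Crossing ∧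
      Fintype.card D₂.Crossing < Fintype.card D.Crossing := by
  obtain ⟨γ, hL, hL'⟩ := hg.exists_not_linked hT
  have e1 : ∀ a : ZMod 2, a + 1 + 1 = a := by decide
  have e2 : ∀ a b : ZMod 2, a = b + 1 → b = a + 1 := by decide
  -- The quadrants. `S 0 γ` and `S 1 (γ + 1)` are unlinked and carry the circle; `S 0 (γ + 1)` and
  -- `S 1 γ` are the tangles.
  let S : ZMod 2 → ZMod 2 → D.HalfEdge → Prop := fun β c h => blackSide q h = β ∧
    g (whiteCorner h) = c
  have hSopp : ∀ β c h, S β c h → S β c (D.opp h) := fun β c h ⟨h1, h2⟩ =>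
    ⟨(blackSide_opp q h).trans h1, (hg.inv.whiteCorner_opp D.isAlternating h).trans h2⟩
  have hSu : ∀ {β c i j}, S β c (q.x i, j) → ∀ j', S β c (q.x i, j') ↔ j' = j := by
    intro β c i j h j'
    refine ⟨fun h' => hg.label_injective i (Prod.ext (h'.1.trans h.1.symm) (h'.2.trans h.2.symm)),
      fun h' => h' ▸ h⟩
  have hS2 : ∀ {β c i j}, S β c (q.x i, j) → S (β + 1) (c + 1) (q.x i, j + 2) := by
    intro β c i j h
    obtain ⟨h1, h2⟩ := hg.label_add_two i j
    exact ⟨by rw [h1, h.1], by rw [h2, h.2]⟩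
  have hcover : ∀ y, (∀ p, y ≠ q.x p) → (∀ j, S 0 (γ + 1) (y, j)) ∨ ∀ j, S 1 γ (y, j) := by
    intro y hy
    have h1 := hg.label_const hy
    have h2 : blackSide q (y, 0) = 0 → g (y, 0) ≠ γ := hg.not_label hs hL hy
    have h3 : blackSide q (y, 0) + 1 = 0 → g (y, 0) ≠ γ + 1 := by
      rw [← blackSide_flip]
      exact hg.flip.not_label hs hL' fun i => hy (i + 1)
    have key : ∀ a b γ : ZMod 2, (a = 0 → b ≠ γ) → (a + 1 = 0 → b ≠ γ + 1) →
      (a = 0 ∧ b = γ + 1) ∨ (a = 1 ∧ b = γ) := by decide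
    refine (key _ _ _ h2 h3).imp (fun h j => ?_) fun h j => ?_
    · exact ⟨(h1 j).1.trans h.1, (h1 j).2.trans h.2⟩
    · exact ⟨(h1 j).1.trans h.1, (h1 j).2.trans h.2⟩
  have finish : ∀ (σ : ZMod 4 ≃ ZMod 4) (k : ZMod 4 → ZMod 4), (∀ p, IsOver (k p) ↔ IsOver p) →
      (∀ p, D.opp (q.x (σ p), k p + 1) = (q.x (σ (p + 1)), k (p + 1) - 1)) →
      (∀ p, S 0 (γ + 1) (q.x (σ p), k p)) → ∃ D₁ D₂ : AltDiagram, D.IsComposition D₁ D₂ ∧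
        Fintype.card D₁.Crossing < Fintype.card D.Crossing ∧
        Fintype.card D₂.Crossing < Fintype.card D.Crossing := by
    intro σ k hk hopp hlab
    refine AltDiagram.exists_isComposition (x := fun p => q.x (σ p)) (q.x_injective.comp σ.injective)
      hk hopp (hSopp 0 (γ + 1)) (hSopp 1 γ) (fun p => hSu (hlab p)) (fun p => hSu ?_)
      (fun h h1 h2 => ?_) fun y hy => hcover y fun i => ?_
    · have h1 := hS2 (hlab p)
      rwa [e1, zero_add] at h1
    · exact absurd (h1.1.symm.trans h2.1) (by decide)
    · rw [← σ.apply_symm_apply i]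
      exact hy (σ.symm i)
  -- The half-edge by which the circle leaves `x p` towards `x (p + 1)`. The edges of the circle lie
  -- alternately in the two unlinked quadrants.
  have hn : ∀ p, ∃ n, S (if IsOver p then 0 else 1) (if IsOver p then γ else γ + 1) (q.x p, n) :=
    fun p => hg.exists_label p _ _
  choose n hn using hn
  have hopp : ∀ p, D.opp (q.x p, n p) = (q.x (p + 1), n (p + 1) + 2) := by
    intro p
    have h1 := hn p
    have h2 := hS2 (hn (p + 1))
    by_cases hp : IsOver p
    · rw [if_pos hp, if_pos hp] at h1
      rw [if_neg (by rw [isOver_add_one]; tauto), if_neg (by rw [isOver_add_one]; tauto), e1] at h2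
      exact hg.opp_eq hs hL hp h1.1 h1.2 h2.1 h2.2
    · rw [if_neg hp, if_neg hp] at h1
      rw [if_pos (by rwa [isOver_add_one]), if_pos (by rwa [isOver_add_one])] at h2
      have hx : q.flip.x (p - 1) = q.x p := congrArg q.x (sub_add_cancel p 1)
      have hx' : q.flip.x (p - 1 + 1) = q.x (p + 1) := congrArg q.x (by ring)
      have := hg.flip.opp_eq hs hL' (i := p - 1) (j := n p) (j' := n (p + 1) + 2)
        (by rwa [isOver_sub_one]) (by rw [hx, blackSide_flip, h1.1]; rfl) (by rw [hx, h1.2])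
        (by rw [hx', blackSide_flip, h2.1]; rfl) (by rw [hx', h2.2])
      rwa [hx, hx'] at this
  have i2 : ∀ i : ZMod 4, IsOver (i + 2) ↔ IsOver i := by decide
  have hpar : ∀ p, IsOver (n (p + 1)) ↔ ¬ IsOver (n p) := by
    intro p
    have := D.alternating (q.x p, n p)
    rwa [hopp, i2] at this
  -- The circle goes over and under alternately, so one crossing decides the parity at all four.
  have hpar' : ∀ p, (IsOver (n p) ↔ IsOver p) ↔ (IsOver (n 0) ↔ IsOver 0) := by
    have hstep : ∀ p, (IsOver (n (p + 1)) ↔ IsOver (p + 1)) ↔ (IsOver (n p) ↔ IsOver p) := by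
      intro p
      rw [hpar, isOver_add_one, not_iff_not]
    have h1 := hstep 0
    have h2 := hstep 1
    have h3 := hstep 2
    exact ZMod.forall_four.2 ⟨Iff.rfl, h1, h2.trans h1, h3.trans (h2.trans h1)⟩
  have hl := fun p => hg.label p (n p - 1)
  simp only [sub_add_cancel, isOver_sub_one, not_not] at hl
  by_cases h0 : IsOver (n 0) ↔ IsOver 0
  · have hk : ∀ p, IsOver (n p) ↔ IsOver p := fun p => (hpar' p).2 h0
    -- Here the first tangle is next to the circle on the wrong hand, so the circle is traversed
    -- backwards. The shift by one restores the parity.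
    refine finish (Equiv.subLeft 1) (fun p => n (1 - p) - 1 + 2) (fun p => ?_) (fun p => ?_)
      fun p => ?_
    · have h1 : ∀ p : ZMod 4, ¬ IsOver (1 - p) ↔ IsOver p := by decide
      rw [i2, isOver_sub_one, hk, h1]
    · have h1 := hopp (-p)
      change D.opp (q.x (1 - p), n (1 - p) - 1 + 2 + 1) =
        (q.x (1 - (p + 1)), n (1 - (p + 1)) - 1 + 2 - 1)
      rw [show 1 - (p + 1) = -p by ring, show n (1 - p) - 1 + 2 + 1 = n (-p + 1) + 2 by
        rw [show 1 - p = -p + 1 by ring]; ring, show 1 - p = -p + 1 by ring, ← h1, D.opp_opp]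
      exact Prod.ext rfl (by ring)
    · change S 0 (γ + 1) (q.x (1 - p), n (1 - p) - 1 + 2)
      generalize 1 - p = p
      have h1 : S 1 γ (q.x p, n p - 1) := by
        have h2 := hn p
        by_cases hp : IsOver p
        · rw [if_pos hp, if_pos hp] at h2
          obtain ⟨h3, h4⟩ := (hl p).2 ((hk p).2 hp)
          exact ⟨e2 _ _ (h2.1.symm.trans h3), h4.symm.trans h2.2⟩
        · rw [if_neg hp, if_neg hp] at h2
          obtain ⟨h3, h4⟩ := (hl p).1 fun h => hp ((hk p).1 h)
          exact ⟨h3.symm.trans h2.1, add_right_cancel (h4.symm.trans h2.2)⟩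
      exact hS2 h1
  · have hk : ∀ p, IsOver (n p) ↔ ¬ IsOver p := fun p => by
      exact (not_iff_comm.1 (not_iff.1 (mt (hpar' p).1 h0))).symm
    refine finish (Equiv.refl _) (fun p => n p - 1) (fun p => ?_) (fun p => ?_) fun p => ?_
    · rw [isOver_sub_one, hk, not_not]
    · change D.opp (q.x p, n p - 1 + 1) = (q.x (p + 1), n (p + 1) - 1 - 1)
      rw [sub_add_cancel, hopp]
      exact Prod.ext rfl (by
        have h1 : ∀ a : ZMod 4, a + 2 = a - 1 - 1 := by decide
        exact h1 _)
    · change S 0 (γ + 1) (q.x p, n p - 1)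
      have h2 := hn p
      by_cases hp : IsOver p
      · rw [if_pos hp, if_pos hp] at h2
        obtain ⟨h3, h4⟩ := (hl p).1 fun h => (hk p).1 h hp
        exact ⟨h3.symm.trans h2.1, e2 _ _ (h2.2.symm.trans h4)⟩
      · rw [if_neg hp, if_neg hp] at h2
        obtain ⟨h3, h4⟩ := (hl p).2 ((hk p).2 hp)
        exact ⟨add_right_cancel (h3.symm.trans h2.1), h4.symm.trans h2.2⟩

end IsWhiteSide

end AltDiagram

/-! ### The recursive family, primality and reducedness -/

namespace AltDiagram

open DiagramCode

variable {D : AltDiagram}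

theorem iso_round [IsEmpty D.Crossing] : D.Iso round :=
  ⟨Equiv.equivOfIsEmpty D.Crossing Empty, fun _ => 0, isEmptyElim, isEmptyElim⟩

/-- A diagram with separated edges that has a nugatory crossing on a white region has no other
crossing. -/
theorem iso_oneCrossing (hs : D.SeparatesEdges) {x : D.Crossing}
    (hx : (rg (x, 0) : D.Region) = rg (x, 2)) : D.Iso oneCrossing := by
  have hA := D.isAlternating
  have h12 : D.opp (x, 1) = (x, 2) :=
    hs.opp_eq hA rfl hx fun h => absurd (congrArg Prod.snd h) (show (1 : ZMod 4) ≠ 2 by decide)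
  have h03 : D.opp (x, 0) = (x, 3) :=
    hs.opp_eq hA rfl hx fun h => absurd (congrArg Prod.snd h) (show (0 : ZMod 4) ≠ 3 by decide)
  have hopp : ∀ i, D.opp (x, i) = (x, 3 - i) := ZMod.forall_four.2
    ⟨h03, h12, by rw [← h12, D.opp_opp]; rfl, by rw [← h03, D.opp_opp]; rfl⟩
  have hall : ∀ y, y = x := fun y => D.isConnected (fun y => y = x) (fun h hh => by
    rw [show h = (x, h.2) from Prod.ext hh rfl, hopp]) x y rfl
  have : Unique D.Crossing := ⟨⟨x⟩, hall⟩
  refine ⟨Equiv.ofUnique D.Crossing Unit, fun _ => 0, fun _ => .inl rfl, fun y i => ?_⟩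
  rw [hall y, hopp, add_zero, add_zero]
  rfl

/-- The white difference of the indicator of a white region is a flow. It is nonzero at a crossing
whose two white corners lie in different regions. -/
theorem rg_eq_of_flows_eq_zero (h : ∀ f ∈ D.flows, f = 0) (x : D.Crossing) :
    (rg (x, 0) : D.Region) = rg (x, 2) := by
  classical
  have h1 := congrFun (h _ (whiteDiff_mem_flows D.isAlternating
    (isInvariant_of_region fun r : D.Region => if r = rg (x, 2) then 1 else 0))) x
  by_contra hne
  simp [whiteDiff, hne] at h1

theorem isTilingSubgroup_of_eq_zero (h : ∀ f ∈ D.flows, f = 0) : IsTilingSubgroup D.flows := by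
  have : Subsingleton D.flows := ⟨fun a b => Subtype.ext ((h a a.2).trans (h b b.2).symm)⟩
  refine ⟨0, 0, Function.injective_of_subsingleton _, fun a b => ?_, fun x =>
    ⟨x, ⟨⟨0, Subsingleton.elim _ _⟩, fun i => i.elim0⟩, fun y _ => Subsingleton.elim _ _⟩⟩
  change _ = (a : D.Crossing → ℤ) ⬝ᵥ b
  rw [h a a.2, zero_dotProduct]
  exact Finset.sum_eq_zero fun i _ => i.elim0

theorem separatesEdges_round : round.SeparatesEdges := fun h => Empty.elim h.1

theorem isTilingSubgroup_round : IsTilingSubgroup round.flows :=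
  isTilingSubgroup_of_eq_zero fun _ _ => funext fun x => Empty.elim x

theorem exists_invariant_oneCrossing : ∃ F : ZMod 4 → ZMod 3,
    IsInvariant (C := oneCrossingCode) (fun h => F h.2) ∧ F 1 ≠ F 3 ∧
    ∀ i j, F i = F j → F (i - 1) = F (j - 1) → i = j := by
  refine ⟨fun i => if i = 1 then 1 else if i = 3 then 2 else 0, fun h => ?_, by decide, by decide⟩
  have key : ∀ i : ZMod 4, (if 3 - i - 1 = 1 then (1 : ZMod 3) else if 3 - i - 1 = 3 then 2 else 0) =
    if i = 1 then 1 else if i = 3 then 2 else 0 := by decide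
  exact key h.2

theorem separatesEdges_oneCrossing : oneCrossing.SeparatesEdges := by
  obtain ⟨F, hF, -, h⟩ := exists_invariant_oneCrossing
  exact fun a b h1 h2 => Prod.ext rfl (h _ _ (hF.eq_of_rg_eq h1) (hF.eq_of_rg_eq h2))

theorem isTilingSubgroup_oneCrossing : IsTilingSubgroup oneCrossing.flows := by
  classical
  obtain ⟨F, hF, h1, -⟩ := exists_invariant_oneCrossing
  refine isTilingSubgroup_of_eq_zero fun f hf => funext fun x => ?_
  have h2 := hf _ (hF.comp fun a => if a = F 3 then 1 else 0)
  have h3 : blackDiff (C := oneCrossingCode) (fun h => if F h.2 = F 3 then (1 : ℤ) else 0) =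
      fun _ => 1 := by
    funext y
    simp [blackDiff, h1]
  change f ⬝ᵥ blackDiff (C := oneCrossingCode) (fun h => if F h.2 = F 3 then (1 : ℤ) else 0) = 0 at h2
  rw [h3] at h2
  have h4 : ∀ f : Unit → ℤ, f ⬝ᵥ (fun _ => 1) = f () := fun f => by simp [dotProduct]
  exact (h4 f).symm.trans h2

/-- The recursively defined family consists of the diagrams with tiling lattices that are not
connected sums. -/
theorem inFamily_iff : InFamily D ↔ IsTilingSubgroup D.flows ∧ D.SeparatesEdges := by
  constructor
  · intro h
    induction h with
    | round D h => exact ⟨h.isTilingSubgroup isTilingSubgroup_round, h.separatesEdges separatesEdges_round⟩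
    | oneCrossing D h =>
      exact ⟨h.isTilingSubgroup isTilingSubgroup_oneCrossing,
        h.separatesEdges separatesEdges_oneCrossing⟩
    | composition D D₁ D₂ _ _ h ih₁ ih₂ =>
      obtain ⟨c₁, c₂, s, hs, h⟩ := h
      exact ⟨h.isTilingSubgroup ((composeGluing D₁.isAlternating D₂.isAlternating c₁ c₂
          hs).isTilingSubgroup ih₁.1 ih₂.1), h.separatesEdges (separatesEdges_compose
            D₁.isAlternating D₂.isAlternating hs ih₁.2 ih₂.2 (rg_ne_of_isTilingSubgroup ih₁.1 c₁)
            (rg_ne_of_isTilingSubgroup ih₂.1 c₂))⟩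
  · induction hn : Fintype.card D.Crossing using Nat.strong_induction_on generalizing D with
    | _ n ih =>
    rintro ⟨hT, hs⟩
    by_cases hx : IsEmpty D.Crossing
    · exact .round D iso_round
    obtain ⟨x⟩ := not_isEmpty_iff.1 hx
    by_cases h0 : ∀ f ∈ D.flows, f = 0
    · exact .oneCrossing D (iso_oneCrossing hs (rg_eq_of_flows_eq_zero h0 x))
    push Not at h0
    obtain ⟨f, hf, hf0⟩ := h0
    have hT' := hT
    rw [← chessboardLattice_eq, chessboardLattice] at hT' hf
    -- A nonzero flow yields a 4-cycle that is a cut, hence a circle and a composition. Both factors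
    -- have fewer crossings and inherit the two properties.
    obtain ⟨q⟩ := exists_square hT' hf hf0
    obtain ⟨g, hg⟩ := exists_isWhiteSide q
    obtain ⟨D₁, D₂, hD, h₁, h₂⟩ := hg.exists_isComposition hT hs
    obtain ⟨c₁, c₂, s, hc, h⟩ := id hD
    obtain ⟨ht₁, ht₂⟩ := (composeGluing D₁.isAlternating D₂.isAlternating c₁ c₂
      hc).isTilingSubgroup_fst_snd (h.symm.isTilingSubgroup hT)
    obtain ⟨hs₁, hs₂⟩ := separatesEdges_of_compose (h.symm.separatesEdges hs)
    exact .composition D D₁ D₂ (ih _ (hn ▸ h₁) rfl ⟨ht₁, hs₁⟩) (ih _ (hn ▸ h₂) rfl ⟨ht₂, hs₂⟩) hD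

theorem inFamily_of_isComposition {D₁ D₂ : AltDiagram} (h : D.IsComposition D₁ D₂) :
    InFamily D ↔ InFamily D₁ ∧ InFamily D₂ := by
  refine ⟨fun hD => ?_, fun hD => .composition D D₁ D₂ hD.1 hD.2 h⟩
  rw [inFamily_iff] at hD
  obtain ⟨c₁, c₂, s, hc, h⟩ := h
  obtain ⟨ht₁, ht₂⟩ := (composeGluing D₁.isAlternating D₂.isAlternating c₁ c₂
    hc).isTilingSubgroup_fst_snd (h.symm.isTilingSubgroup hD.1)
  obtain ⟨hs₁, hs₂⟩ := separatesEdges_of_compose (h.symm.separatesEdges hD.2)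
  exact ⟨inFamily_iff.2 ⟨ht₁, hs₁⟩, inFamily_iff.2 ⟨ht₂, hs₂⟩⟩

/-- A diagram is a connected sum of diagrams with separated edges. -/
theorem isConnectedSumOf_of_splice {S : Set AltDiagram} {P : AltDiagram → Prop}
    (hS : ∀ D, P D → D.SeparatesEdges → D ∈ S)
    (hP : ∀ (D D₁ D₂ : AltDiagram) (h₁ : D₁.HalfEdge) (h₂ : D₂.HalfEdge), IsOver h₁.2 → IsOver h₂.2 →
      D.toDiagramCode.Iso (D₁.splice D₂.toDiagramCode h₁ h₂) → P D → P D₁ ∧ P D₂) (hD : P D) :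
    IsConnectedSumOf S D := by
  induction hn : Fintype.card D.Crossing using Nat.strong_induction_on generalizing D with
  | _ n ih =>
  by_cases hs : D.SeparatesEdges
  · exact .summand D (hS D hD hs)
  obtain ⟨D₁, D₂, h₁, h₂, ho₁, ho₂, hi, hc₁, hc₂⟩ := D.exists_iso_splice hs
  obtain ⟨hP₁, hP₂⟩ := hP D D₁ D₂ h₁ h₂ ho₁ ho₂ hi hD
  exact .sum D D₁ D₂ (ih _ (hn ▸ hc₁) hP₁ rfl) (ih _ (hn ▸ hc₂) hP₂ rfl)
    (.inl ⟨h₁, h₂, ho₁, ho₂, hi⟩)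

theorem isTilingSubgroup_of_iso_splice {D₁ D₂ : AltDiagram} {h₁ : D₁.HalfEdge} {h₂ : D₂.HalfEdge}
    (ho₁ : IsOver h₁.2) (ho₂ : IsOver h₂.2)
    (h : D.toDiagramCode.Iso (D₁.splice D₂.toDiagramCode h₁ h₂)) :
    IsTilingSubgroup D.flows ↔ IsTilingSubgroup D₁.flows ∧ IsTilingSubgroup D₂.flows := by
  rw [← isTilingSubgroup_splice_iff D₁.isAlternating D₂.isAlternating ho₁ ho₂]
  exact ⟨h.symm.isTilingSubgroup, h.isTilingSubgroup⟩

theorem isTilingSubgroup_iff_isConnectedSumOf :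
    IsTilingSubgroup D.flows ↔ IsConnectedSumOf family D := by
  constructor
  · refine isConnectedSumOf_of_splice (P := fun D => IsTilingSubgroup D.flows)
      (fun D h1 h2 => inFamily_iff.2 ⟨h1, h2⟩) fun D D₁ D₂ h₁ h₂ ho₁ ho₂ h => ?_
    exact (isTilingSubgroup_of_iso_splice ho₁ ho₂ h).1
  · intro h
    induction h with
    | summand D h => exact (inFamily_iff.1 h).1
    | sum D D₁ D₂ _ _ h ih₁ ih₂ =>
      rcases h with ⟨h₁, h₂, ho₁, ho₂, h⟩ | ⟨-, h⟩ | ⟨-, h⟩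
      · exact (isTilingSubgroup_of_iso_splice ho₁ ho₂ h).2 ⟨ih₁, ih₂⟩
      · exact h.isTilingSubgroup ih₂
      · exact h.isTilingSubgroup ih₁

/-- The edges that connect two summands violate separation, and conversely a violation allows
splitting into summands with crossings. -/
theorem isPrime_iff : D.IsPrime ↔ D.SeparatesEdges := by
  constructor
  · intro hp
    by_contra hs
    obtain ⟨D₁, D₂, h₁, h₂, ho₁, ho₂, hi, -⟩ := D.exists_iso_splice hs
    rcases hp D₁ D₂ (.inl ⟨h₁, h₂, ho₁, ho₂, hi⟩) with ⟨f, -⟩ | ⟨f, -⟩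
    · exact isEmptyElim (α := Empty) (f h₁.1)
    · exact isEmptyElim (α := Empty) (f h₂.1)
  · rintro hs D₁ D₂ (⟨h₁, h₂, ho₁, ho₂, h⟩ | h | h)
    · exact absurd (h.symm.separatesEdges hs)
        (not_separatesEdges_splice D₁.isAlternating D₂.isAlternating ho₁ ho₂)
    · exact .inl h.1
    · exact .inr h.1

theorem IsReduced.of_iso {D' : AltDiagram} (h : D'.Iso D) (hD : D.IsReduced) : D'.IsReduced := by
  rintro x ⟨i, hx⟩
  obtain ⟨y, j, hy⟩ := Iso.exists_region_eq h hx
  exact hD y ⟨j, hy⟩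

/-- Corners of one summand lie in the same region of the connected sum exactly if they do in the
summand. -/
theorem isReduced_of_iso_splice {D₁ D₂ : AltDiagram} {h₁ : D₁.HalfEdge} {h₂ : D₂.HalfEdge}
    (ho₁ : IsOver h₁.2) (ho₂ : IsOver h₂.2)
    (h : D.toDiagramCode.Iso (D₁.splice D₂.toDiagramCode h₁ h₂)) :
    D.IsReduced ↔ D₁.IsReduced ∧ D₂.IsReduced := by
  have hl := fun x i => rg_spliceLeft_iff (h := (x, i)) (k := (x, i + 2)) D₁.isAlternating
    D₂.isAlternating ho₁ ho₂
  have hr := fun x i => rg_spliceRight_iff (h := (x, i)) (k := (x, i + 2)) D₁.isAlternating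
    D₂.isAlternating ho₁ ho₂
  constructor
  · intro hD
    constructor
    · rintro x ⟨i, hx⟩
      obtain ⟨y, j, hy⟩ := h.symm.exists_region_eq ((hl x i).2 hx :)
      exact hD y ⟨j, hy⟩
    · rintro x ⟨i, hx⟩
      obtain ⟨y, j, hy⟩ := h.symm.exists_region_eq ((hr x i).2 hx :)
      exact hD y ⟨j, hy⟩
  · rintro ⟨hD₁, hD₂⟩ x ⟨i, hx⟩
    obtain ⟨y | y, j, hy⟩ := h.exists_region_eq hx
    · exact hD₁ y ⟨j, (hl y j).1 hy⟩
    · exact hD₂ y ⟨j, (hr y j).1 hy⟩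

theorem not_isReduced_of_iso_oneCrossing (h : D.Iso oneCrossing) : ¬ D.IsReduced := by
  intro hD
  exact IsReduced.of_iso (Iso.symm h) hD () ⟨0, Quot.sound rfl⟩

/-- A crossing with both black corners in one region is a loop of the Tait graph and gives a flow of
norm 1. If the white corners coincide, separation closes up the four half-edges at this single
crossing. -/
theorem isReduced_of_separatesEdges (hT : IsTilingSubgroup D.flows) (hs : D.SeparatesEdges)
    (h : ¬ D.Iso oneCrossing) : D.IsReduced := by
  rintro x ⟨i, hi⟩
  match i with
  | 0 => exact h (iso_oneCrossing hs hi)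
  | 1 => exact rg_ne_of_isTilingSubgroup hT x hi
  | 2 => exact h (iso_oneCrossing hs hi.symm)
  | 3 => exact rg_ne_of_isTilingSubgroup hT x hi.symm

theorem isReduced_iff_isConnectedSumOf (hT : IsTilingSubgroup D.flows) :
    D.IsReduced ↔ IsConnectedSumOf (family \ {D' | D'.Iso oneCrossing}) D := by
  constructor
  · intro hD
    refine isConnectedSumOf_of_splice (P := fun D => IsTilingSubgroup D.flows ∧ D.IsReduced)
      (fun D h1 h2 => ⟨inFamily_iff.2 ⟨h1.1, h2⟩, fun h => not_isReduced_of_iso_oneCrossing h h1.2⟩)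
      (fun D D₁ D₂ h₁ h₂ ho₁ ho₂ h hD => ?_) ⟨hT, hD⟩
    rw [isTilingSubgroup_of_iso_splice ho₁ ho₂ h, isReduced_of_iso_splice ho₁ ho₂ h] at hD
    tauto
  · intro h
    clear hT
    induction h with
    | summand D h =>
      obtain ⟨h1, h2⟩ := inFamily_iff.1 h.1
      exact isReduced_of_separatesEdges h1 h2 h.2
    | sum D D₁ D₂ _ _ h ih₁ ih₂ =>
      rcases h with ⟨h₁, h₂, ho₁, ho₂, h⟩ | ⟨-, h⟩ | ⟨-, h⟩
      · exact (isReduced_of_iso_splice ho₁ ho₂ h).2 ⟨ih₁, ih₂⟩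
      · exact ih₂.of_iso h
      · exact ih₁.of_iso h

end AltDiagram

theorem mainTheorem8 (D : AltDiagram) :
    (D.HasTwoCubeTilingLattice ↔ AltDiagram.IsConnectedSumOf AltDiagram.family D) ∧
    (D.HasTwoCubeTilingLattice →
      ((D.IsPrime ↔ D ∈ AltDiagram.family) ∧
        (D.IsReduced ↔ AltDiagram.IsConnectedSumOf
          (AltDiagram.family \ {D' | D'.Iso AltDiagram.oneCrossing}) D))) ∧
    (∀ D₁ D₂ : AltDiagram, D.IsComposition D₁ D₂ →
      (D ∈ AltDiagram.family ↔ D₁ ∈ AltDiagram.family ∧ D₂ ∈ AltDiagram.family)) := by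
  rw [D.hasTwoCubeTilingLattice_iff]
  refine ⟨AltDiagram.isTilingSubgroup_iff_isConnectedSumOf, fun hT => ⟨?_,
    AltDiagram.isReduced_iff_isConnectedSumOf hT⟩, fun D₁ D₂ h =>
      AltDiagram.inFamily_of_isComposition h⟩
  rw [AltDiagram.isPrime_iff]
  exact ⟨fun hs => AltDiagram.inFamily_iff.2 ⟨hT, hs⟩, fun h => (AltDiagram.inFamily_iff.1 h).2⟩
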